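/- Let $\mathrm{HV}=\mathbb C[\partial]L\oplus\mathbb C[\partial]N$ be the Heisenberg–Virasoro Lie conformal algebra, with $\lambda$-brackets $[L_\lambda L]=(\partial+2\lambda)L$, $[L_\lambda N]=(\partial+\lambda)N$, $[N_\lambda L]=\lambda N$, $[N_\lambda N]=0$. For $\alpha,\beta,\Delta\in\mathbb C$ let $V(\alpha,\beta,\Delta)=\mathbb C[\partial]v_\Delta$ be the conformal $\mathrm{HV}$-module, free of rank one over $\mathbb C[\partial]$, with $L_\lambda v_\Delta=(\partial+\alpha+\Delta\lambda)v_\Delta$ and $N_\lambda v_\Delta=\beta v_\Delta$. Let $\alpha,\beta,\Delta,\bar\alpha,\bar\beta,\bar\Delta\in\mathbb C$ with $(\Delta,\beta)\neq(0,0)$ and $(\bar\Delta,\bar\beta)\neq(0,0)$, and consider extensions of conformal $\mathrm{HV}$-modules $$0\longrightarrow V(\bar\alpha,\bar\beta,\bar\Delta)\longrightarrow E\longrightarrow V(\alpha,\beta,\Delta)\longrightarrow 0 .$$ An extension is trivial if it is equivalent (by a homomorphism of the middle terms inducing the identity on both ends) to the direct sum. Every such $E$ is, for some lift of $v_\Delta$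 to $E$ (denoted again by $v_\Delta$) and some $f,k\in\mathbb C[\partial,\lambda]$, given by $$L_\lambda v_\Delta=(\partial+\alpha+\Delta\lambda)v_\Delta+f(\partial,\lambda)v_{\bar\Delta},\qquad N_\lambda v_\Delta=\beta v_\Delta+k(\partial,\lambda)v_{\bar\Delta}. \tag{$*$}$$ Nontrivial extensions exist only if $\alpha=\bar\alpha$ and $\beta=\bar\beta$. In that case, every nontrivial extension is equivalent to one given by $(*)$ with $(f,k)$ in the following list, and conversely each pair in the list is realized by an extension, and every extension given by it is nontrivial. Here $\bar\partial=\partial+\alpha$, and the letters $a_i,b_i,c_i$ denote complex constants. For $\beta=\bar\beta=0$: * (i) $\Delta=\bar\Delta$, $f=c_0+c_1\lambda$, $k=a_0$, with $(c_0,c_1,a_0)\neq(0,0,0)$. * (ii) $\Delta-\bar\Delta=1$, $f=0$, $k=a_1\lambda$, with $a_1\neq0$. * (iii) $\Delta-\bar\Delta=2$, $f=c_2\lambda^2(2\bar\partial+\lambda)$, $k=a_2\lambda(\bar\partial-\bar\Delta\lambda)$, with $(c_2,a_2)\neq(0,0)$. * (iv) $(\Delta,\bar\Delta)=(1,-2)$,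 $f=c_3\bar\partial\lambda^2(\bar\partial+\lambda)$, $k=a_3\lambda(\bar\partial^2+3\bar\partial\lambda+2\lambda^2)$, with $(c_3,a_3)\neq(0,0)$. * (iv') $\Delta-\bar\Delta=3$, $\bar\Delta\neq-2$, $f=c_3\bar\partial\lambda^2(\bar\partial+\lambda)$, $k=0$, with $c_3\neq0$. * (v) $\Delta-\bar\Delta=4$, $f=c_5\lambda^2(4\bar\partial^3+6\bar\partial^2\lambda-\bar\partial\lambda^2+\bar\Delta\lambda^3)$, $k=0$, with $c_5\neq0$. * (vi) $(\Delta,\bar\Delta)=(1,-4)$, $f=c_6(\bar\partial^4\lambda^2-10\bar\partial^2\lambda^4-17\bar\partial\lambda^5-8\lambda^6)$, $k=0$, with $c_6\neq0$. * (vii) $(\Delta,\bar\Delta)=\bigl(\tfrac72\pm\tfrac{\sqrt{19}}2,-\tfrac52\pm\tfrac{\sqrt{19}}2\bigr)$ (same sign in both entries), $f=c_7\bigl(\bar\partial^4\lambda^3-(2\bar\Delta+3)\bar\partial^3\lambda^4-3\bar\Delta\bar\partial^2\lambda^5-(3\bar\Delta+1)\bar\partial\lambda^6-(\bar\Delta+\tfrac9{28})\lambda^7\bigr)$,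 $k=0$, with $c_7\neq0$. For $\beta=\bar\beta\neq0$: * (i) $\Delta=\bar\Delta$, $k=a_0$, $f=c_0+c_1\lambda$, with $(a_0,c_0,c_1)\neq(0,0,0)$. * (ii) $\Delta-\bar\Delta=1$, $k=b_2\lambda$, $f=c_2\lambda^2$, with $\beta c_2\neq\bar\Delta b_2$. * (iii) $\Delta-\bar\Delta=2$, $k=b_2\lambda^2$, $f=\frac{b_2}{\beta}\bar\partial\lambda^2+c_3\lambda^3$, with $(b_2,c_3)\neq(0,0)$. Furthermore (for arbitrary $\alpha,\bar\alpha,\beta,\bar\beta$), an extension given by $(*)$ with a pair $(f,k)$ is trivial if and only if there is a polynomial $\phi\in\mathbb C[\partial]$ with $$f(\partial,\lambda)=(\partial+\alpha+\Delta\lambda)\phi(\partial)-(\partial+\bar\alpha+\bar\Delta\lambda)\phi(\partial+\lambda),\qquad k(\partial,\lambda)=\beta\phi(\partial)-\bar\beta\phi(\partial+\lambda),$$ and every $\phi$ occurs in this way for some trivial extension. -/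

import Mathlib

open Polynomial

universe u v w

/-! ### Polynomials in `λ` with coefficients in a vector space

An element of `V[λ] = ℂ[λ] ⊗ V` is the finitely supported family `c : ℕ →₀ V` of its
coefficients, standing for `∑ λ ^ j • c j`. As `ℂ` is infinite, two elements of `V[λ]`
(or of `V[λ, μ]`) are equal if and only if all their values at complex numbers are equal. -/

/-- The value of `∑ λ ^ j • c j` at the complex number `l`. -/
noncomputable def lamEval {V : Type*} [AddCommGroup V] [Module ℂ V] (l : ℂ) :
    (ℕ →₀ V) →ₗ[ℂ] V :=
  Finsupp.lsum ℂ fun j => (l ^ j) • LinearMap.id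

/-- The result `∑ T ^ j (c j)` of substituting an operator `T` for `λ` in `∑ λ ^ j • c j`,
the powers of `T` being moved to the left of the coefficients. -/
noncomputable def lamSubst {V : Type*} [AddCommGroup V] [Module ℂ V] (T : Module.End ℂ V) :
    (ℕ →₀ V) →ₗ[ℂ] V :=
  Finsupp.lsum ℂ fun j => T ^ j

/-! ### Lie conformal algebras and conformal modules -/

/-- A Lie conformal algebra: a `ℂ[∂]`-module `R` (a complex vector space with an operator
`∂ = der`) with a `ℂ`-bilinear `λ`-bracket `R × R → R[λ]` satisfying conformal sesquilinearity,
skew-symmetry `[a_λ b] = -[b_{-λ-∂} a]` and the Jacobi identity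
`[a_λ [b_μ c]] = [[a_λ b]_{λ+μ} c] + [b_μ [a_λ c]]`. -/
structure LieConformalAlgebra (R : Type*) [AddCommGroup R] [Module ℂ R] where
  der : R →ₗ[ℂ] R
  bracket : R →ₗ[ℂ] R →ₗ[ℂ] (ℕ →₀ R)
  der_bracket : ∀ (a b : R) (l : ℂ),
    lamEval l (bracket (der a) b) = -l • lamEval l (bracket a b)
  bracket_der : ∀ (a b : R) (l : ℂ),
    lamEval l (bracket a (der b)) =
      der (lamEval l (bracket a b)) + l • lamEval l (bracket a b)
  skew : ∀ (a b : R) (l : ℂ),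
    lamEval l (bracket a b) = -lamSubst (-(l • LinearMap.id) - der) (bracket b a)
  jacobi : ∀ (a b c : R) (l m : ℂ),
    lamEval l (bracket a (lamEval m (bracket b c))) =
      lamEval (l + m) (bracket (lamEval l (bracket a b)) c) +
        lamEval m (bracket b (lamEval l (bracket a c)))

/-- A conformal module over a Lie conformal algebra `A`: a `ℂ[∂]`-module `V` with a bilinear map
`(a, v) ↦ a_λ v ∈ V[λ]` such that `[a_λ, b_μ] = [a_λ b]_{λ+μ}` and
`(∂ a)_λ = [∂, a_λ] = -λ a_λ`. -/
structure ConformalModule {R : Type*} [AddCommGroup R] [Module ℂ R] (A : LieConformalAlgebra R)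
    (V : Type*) [AddCommGroup V] [Module ℂ V] where
  der : V →ₗ[ℂ] V
  act : R →ₗ[ℂ] V →ₗ[ℂ] (ℕ →₀ V)
  act_bracket : ∀ (a b : R) (v : V) (l m : ℂ),
    lamEval l (act a (lamEval m (act b v))) - lamEval m (act b (lamEval l (act a v))) =
      lamEval (l + m) (act (lamEval l (A.bracket a b)) v)
  act_der : ∀ (a : R) (v : V) (l : ℂ),
    lamEval l (act (A.der a) v) = -l • lamEval l (act a v)
  der_act : ∀ (a : R) (v : V) (l : ℂ),
    der (lamEval l (act a v)) - lamEval l (act a (der v)) = -l • lamEval l (act a v)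

namespace ConformalModule

section

variable {R : Type*} [AddCommGroup R] [Module ℂ R] {A : LieConformalAlgebra R}
variable {V : Type*} [AddCommGroup V] [Module ℂ V] {W : Type*} [AddCommGroup W] [Module ℂ W]

/-- `φ` is a homomorphism of conformal modules: it commutes with `∂` and with all `a_λ`. -/
def IsHom (M : ConformalModule A V) (N : ConformalModule A W) (φ : V →ₗ[ℂ] W) : Prop :=
  (∀ v, φ (M.der v) = N.der (φ v)) ∧
    ∀ (a : R) (v : V) (l : ℂ), φ (lamEval l (M.act a v)) = lamEval l (N.act a (φ v))

theorem lamEval_prod (l : ℂ) (c : ℕ →₀ V) (d : ℕ →₀ W) :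
    lamEval l (Finsupp.mapRange.linearMap (LinearMap.inl ℂ V W) c +
      Finsupp.mapRange.linearMap (LinearMap.inr ℂ V W) d) = (lamEval l c, lamEval l d) := by
  have h1 : ∀ c : ℕ →₀ V, lamEval l (Finsupp.mapRange.linearMap (LinearMap.inl ℂ V W) c) =
      (lamEval l c, 0) := by
    intro c
    induction c using Finsupp.induction_linear with
    | zero => simp only [map_zero]; rfl
    | add x y hx hy => simp only [map_add, hx, hy]; simp
    | single j x => simp [lamEval]
  have h2 : ∀ d : ℕ →₀ W, lamEval l (Finsupp.mapRange.linearMap (LinearMap.inr ℂ V W) d) =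
      (0, lamEval l d) := by
    intro d
    induction d using Finsupp.induction_linear with
    | zero => simp only [map_zero]; rfl
    | add x y hx hy => simp only [map_add, hx, hy]; simp
    | single j x => simp [lamEval]
  rw [map_add, h1, h2]; simp

/-- The direct sum of two conformal modules. -/
noncomputable def directSum (M : ConformalModule A V) (N : ConformalModule A W) :
    ConformalModule A (V × W) where
  der := LinearMap.prodMap M.der N.der
  act := LinearMap.mk₂ ℂ
    (fun a x => Finsupp.mapRange.linearMap (LinearMap.inl ℂ V W) (M.act a x.1) +
      Finsupp.mapRange.linearMap (LinearMap.inr ℂ V W) (N.act a x.2))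
    (fun a b x => by simp only [map_add, LinearMap.add_apply]; abel)
    (fun c a x => by simp only [map_smul, LinearMap.smul_apply, smul_add])
    (fun a x y => by simp only [Prod.fst_add, Prod.snd_add, map_add]; abel)
    (fun c a x => by simp only [Prod.smul_fst, Prod.smul_snd, map_smul, smul_add])
  act_bracket a b x l m := by
    simp only [LinearMap.mk₂_apply, lamEval_prod, Prod.mk_sub_mk, M.act_bracket, N.act_bracket]
  act_der a x l := by
    simp only [LinearMap.mk₂_apply, lamEval_prod, M.act_der, N.act_der, Prod.smul_mk]
  der_act a x l := by
    simp only [LinearMap.mk₂_apply, lamEval_prod, LinearMap.prodMap_apply, Prod.mk_sub_mk,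
      M.der_act, N.der_act, Prod.smul_mk]

/-- An extension of `N` by `M`: a short exact sequence `0 → M → E → N → 0` of conformal modules,
with `E` in the universe `w`. -/
structure Extension (M : ConformalModule A V) (N : ConformalModule A W) where
  carrier : Type w
  [addCommGroup : AddCommGroup carrier]
  [module : Module ℂ carrier]
  mod : ConformalModule A carrier
  i : V →ₗ[ℂ] carrier
  p : carrier →ₗ[ℂ] W
  i_hom : M.IsHom mod i
  p_hom : mod.IsHom N p
  i_injective : Function.Injective i
  p_surjective : Function.Surjective p
  exact : LinearMap.range i = LinearMap.ker p

attribute [instance] Extension.addCommGroup Extension.module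

namespace Extension

variable {M : ConformalModule A V} {N : ConformalModule A W}

/-- Equivalence of extensions: a homomorphism between the middle terms that induces the identity
on `M` and on `N`. -/
def Equivalent (E : Extension.{u} M N) (E' : Extension.{v} M N) : Prop :=
  ∃ ψ : E.carrier →ₗ[ℂ] E'.carrier, E.mod.IsHom E'.mod ψ ∧
    (∀ x, ψ (E.i x) = E'.i x) ∧ ∀ y, E'.p (ψ y) = E.p y

/-- The split extension `0 → M → M ⊕ N → N → 0`. -/
noncomputable def split (M : ConformalModule A V) (N : ConformalModule A W) : Extension M N where
  carrier := V × W
  mod := M.directSum N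
  i := LinearMap.inl ℂ V W
  p := LinearMap.snd ℂ V W
  i_hom := ⟨fun v => by simp [directSum], fun a v l => by
    simp only [directSum, LinearMap.mk₂_apply, lamEval_prod]; simp⟩
  p_hom := ⟨fun v => by simp [directSum], fun a v l => by
    simp only [directSum, LinearMap.mk₂_apply, lamEval_prod]; simp⟩
  i_injective := LinearMap.inl_injective
  p_surjective := LinearMap.snd_surjective
  exact := LinearMap.range_inl ℂ V W

/-- Trivial extensions are those equivalent to the direct sum. -/
def IsTrivial (E : Extension.{u} M N) : Prop := E.Equivalent (split M N)

end Extension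

end

end ConformalModule

/-! ### The Heisenberg-Virasoro conformal algebra

In `ℂ[X][X]` the inner variable `C X` is `∂` and the outer variable `X` is `λ`. -/

namespace HeisenbergVirasoro

/-- `ℂ[∂][λ]` as the space of polynomials in `λ` with coefficients in `ℂ[∂]`. -/
noncomputable def coeffs : ℂ[X][X] →ₗ[ℂ] (ℕ →₀ ℂ[X]) where
  toFun P := Finsupp.onFinset P.support P.coeff fun _ h => mem_support_iff.mpr h
  map_add' P Q := by ext1 j; simp
  map_smul' c P := by ext1 j; simp

theorem lamSubst_coeffs (T : Module.End ℂ ℂ[X]) (r : ℂ[X]) (hT : ∀ q, T q = r * q)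
    (P : ℂ[X][X]) : lamSubst T (coeffs P) = P.eval r := by
  have hp : ∀ (j : ℕ) (q : ℂ[X]), (T ^ j) q = r ^ j * q := by
    intro j
    induction j with
    | zero => simp
    | succ j ih => intro q; rw [pow_succ, Module.End.mul_apply, ih, hT, pow_succ, mul_assoc]
  rw [eval_eq_sum, Polynomial.sum]
  simp only [lamSubst, Finsupp.lsum_apply, coeffs, LinearMap.coe_mk, AddHom.coe_mk]
  rw [Finsupp.onFinset_sum _ (fun j => by simp)]
  exact Finset.sum_congr rfl fun j _ => by rw [hp, mul_comm]

theorem lamEval_coeffs (l : ℂ) (P : ℂ[X][X]) : lamEval l (coeffs P) = P.eval (C l) := by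
  rw [← lamSubst_coeffs (l • LinearMap.id) (C l) (fun q => by simp [smul_eq_C_mul])]
  congr 2
  ext j : 1
  exact LinearMap.ext fun x => by
    simp [lamEval, lamSubst, _root_.smul_pow, ← Module.End.one_eq_id]

/-- The polynomial `p(-λ) q(∂ + λ) s(∂, λ)`: if `a_λ v = s(∂, λ) u`, then
`(p(∂) a)_λ (q(∂) v) = p(-λ) q(∂ + λ) s(∂, λ) u`. -/
noncomputable def sesq (s : ℂ[X][X]) : ℂ[X] →ₗ[ℂ] ℂ[X] →ₗ[ℂ] ℂ[X][X] :=
  LinearMap.mk₂ ℂ (fun p q => aeval (-X : ℂ[X][X]) p * aeval (C X + X : ℂ[X][X]) q * s)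
    (fun p p' q => by simp [add_mul]) (fun c p q => by simp)
    (fun p q q' => by simp [mul_add, add_mul]) (fun c p q => by simp)

theorem eval_sesq (s : ℂ[X][X]) (p q r : ℂ[X]) :
    (sesq s p q).eval r = aeval (-r) p * aeval (X + r) q * s.eval r := by
  have h : ∀ (P : ℂ[X][X]) (t : ℂ[X]), (aeval P t).eval r = aeval (P.eval r) t := by
    intro P t
    induction t using Polynomial.induction_on' with
    | add a b ha hb => simp [ha, hb]
    | monomial n c => simp [aeval_monomial, Polynomial.algebraMap_apply]
  simp [sesq, h]

theorem aeval_aeval' (r t q : ℂ[X]) :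
    aeval r (aeval t q) = aeval (aeval r t) q := by
  rw [← aeval_algHom_apply]

/-- The `λ`-bracket of `ℂ[∂]L ⊕ ℂ[∂]N` given on `p(∂)L + p'(∂)N = (p, p')` by sesquilinearity from
`[L_λ L] = (∂ + 2λ)L`, `[L_λ N] = (∂ + λ)N`, `[N_λ L] = λN`, `[N_λ N] = 0`. -/
noncomputable def bracket : (ℂ[X] × ℂ[X]) →ₗ[ℂ] (ℂ[X] × ℂ[X]) →ₗ[ℂ] (ℕ →₀ ℂ[X] × ℂ[X]) :=
  LinearMap.mk₂ ℂ
    (fun a b =>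
      Finsupp.mapRange.linearMap (LinearMap.inl ℂ ℂ[X] ℂ[X])
        (coeffs (sesq (C X + 2 * X) a.1 b.1)) +
      Finsupp.mapRange.linearMap (LinearMap.inr ℂ ℂ[X] ℂ[X])
        (coeffs (sesq (C X + X) a.1 b.2 + sesq X a.2 b.1)))
    (fun a b x => by
      simp only [map_add, LinearMap.add_apply, Prod.fst_add, Prod.snd_add]; abel)
    (fun c a x => by
      simp only [map_smul, map_add, LinearMap.smul_apply, Prod.smul_fst, Prod.smul_snd, smul_add])
    (fun a x y => by simp only [Prod.fst_add, Prod.snd_add, map_add]; abel)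
    (fun c a x => by simp only [Prod.smul_fst, Prod.smul_snd, map_smul, map_add, smul_add])

theorem lamEval_bracket (l : ℂ) (a b : ℂ[X] × ℂ[X]) :
    lamEval l (bracket a b) =
      (aeval (-C l) a.1 * aeval (X + C l) b.1 * (X + 2 * C l),
        aeval (-C l) a.1 * aeval (X + C l) b.2 * (X + C l) +
          aeval (-C l) a.2 * aeval (X + C l) b.1 * C l) := by
  simp only [bracket, LinearMap.mk₂_apply, ConformalModule.lamEval_prod, lamEval_coeffs]
  simp [eval_sesq]

theorem lamSubst_bracket (a b : ℂ[X] × ℂ[X]) (T : Module.End ℂ (ℂ[X] × ℂ[X])) (r : ℂ[X])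
    (hT : ∀ x, T x = (r * x.1, r * x.2)) :
    lamSubst T (bracket a b) =
      (aeval (-r) a.1 * aeval (X + r) b.1 * (X + 2 * r),
        aeval (-r) a.1 * aeval (X + r) b.2 * (X + r) +
          aeval (-r) a.2 * aeval (X + r) b.1 * r) := by
  have hp : ∀ (j : ℕ) (x : ℂ[X] × ℂ[X]), (T ^ j) x =
      (((LinearMap.mulLeft ℂ r) ^ j) x.1, ((LinearMap.mulLeft ℂ r) ^ j) x.2) := by
    intro j
    induction j with
    | zero => simp
    | succ j ih =>
      intro x
      rw [pow_succ, Module.End.mul_apply, ih, hT, pow_succ]; rfl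
  have h1 : ∀ c : ℕ →₀ ℂ[X], lamSubst T (Finsupp.mapRange.linearMap
      (LinearMap.inl ℂ ℂ[X] ℂ[X]) c) = (lamSubst (LinearMap.mulLeft ℂ r) c, 0) := by
    intro c
    induction c using Finsupp.induction_linear with
    | zero => simp only [map_zero]; rfl
    | add x y hx hy => simp only [map_add, hx, hy]; simp
    | single j x => simp [lamSubst, hp]
  have h2 : ∀ c : ℕ →₀ ℂ[X], lamSubst T (Finsupp.mapRange.linearMap
      (LinearMap.inr ℂ ℂ[X] ℂ[X]) c) = (0, lamSubst (LinearMap.mulLeft ℂ r) c) := by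
    intro c
    induction c using Finsupp.induction_linear with
    | zero => simp only [map_zero]; rfl
    | add x y hx hy => simp only [map_add, hx, hy]; simp
    | single j x => simp [lamSubst, hp]
  simp only [bracket, LinearMap.mk₂_apply]
  rw [map_add, h1, h2, lamSubst_coeffs _ r (fun q => rfl), lamSubst_coeffs _ r (fun q => rfl)]
  simp [eval_sesq]

/-- The Heisenberg-Virasoro conformal algebra `HV = ℂ[∂]L ⊕ ℂ[∂]N`. -/
noncomputable def HV : LieConformalAlgebra (ℂ[X] × ℂ[X]) where
  der := LinearMap.prodMap (LinearMap.mulLeft ℂ X) (LinearMap.mulLeft ℂ X)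
  bracket := bracket
  der_bracket a b l := by
    rw [lamEval_bracket, lamEval_bracket]
    ext1 <;> simp [smul_eq_C_mul] <;> ring
  bracket_der a b l := by
    rw [lamEval_bracket, lamEval_bracket]
    ext1 <;> simp [smul_eq_C_mul] <;> ring
  skew a b l := by
    rw [lamSubst_bracket b a _ (-C l - X) (fun x => by
      ext1 <;> simp [smul_eq_C_mul] <;> ring), lamEval_bracket]
    have e : -(-C l - X : ℂ[X]) = X + C l := by ring
    have e' : (X + (-C l - X) : ℂ[X]) = -C l := by ring
    rw [e, e']
    ext1 <;> simp <;> ring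
  jacobi a b c l m := by
    have e : (X + C l + C m : ℂ[X]) = X + C m + C l := by ring
    have e' : (-C m + -C l + C l : ℂ[X]) = -C m := by ring
    simp only [lamEval_bracket]
    ext1 <;> simp [aeval_aeval', aeval_C, map_ofNat, e, e'] <;> ring_nf

/-- The generator `L`. -/
noncomputable def L : ℂ[X] × ℂ[X] := (1, 0)

/-- The generator `N`. -/
noncomputable def N : ℂ[X] × ℂ[X] := (0, 1)

theorem bracket_L_L (l : ℂ) : lamEval l (HV.bracket L L) = HV.der L + (2 * l) • L := by
  change lamEval l (bracket L L) = _
  rw [lamEval_bracket]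
  ext1 <;> simp [L, HV, smul_eq_C_mul, ← C_ofNat]

theorem bracket_L_N (l : ℂ) : lamEval l (HV.bracket L N) = HV.der N + l • N := by
  change lamEval l (bracket L N) = _
  rw [lamEval_bracket]
  ext1 <;> simp [L, N, HV, smul_eq_C_mul]

theorem bracket_N_L (l : ℂ) : lamEval l (HV.bracket N L) = l • N := by
  change lamEval l (bracket N L) = _
  rw [lamEval_bracket]
  ext1 <;> simp [L, N, smul_eq_C_mul]

theorem bracket_N_N (l : ℂ) : lamEval l (HV.bracket N N) = 0 := by
  change lamEval l (bracket N N) = _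
  rw [lamEval_bracket]
  ext1 <;> simp [N]

/-! ### The modules `V(α, β, Δ)` -/

/-- The action on `V(α, β, Δ)` that extends `L_λ v = (∂ + α + Δλ)v`, `N_λ v = βv` to `ℂ[∂]v` by
sesquilinearity. -/
noncomputable def modAct (α β Δ : ℂ) : (ℂ[X] × ℂ[X]) →ₗ[ℂ] ℂ[X] →ₗ[ℂ] (ℕ →₀ ℂ[X]) :=
  LinearMap.mk₂ ℂ
    (fun a q => coeffs (sesq (C X + C (C α) + C (C Δ) * X) a.1 q + sesq (C (C β)) a.2 q))
    (fun a b x => by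
      simp only [map_add, LinearMap.add_apply, Prod.fst_add, Prod.snd_add]; abel)
    (fun c a x => by
      simp only [map_smul, map_add, LinearMap.smul_apply, Prod.smul_fst, Prod.smul_snd, smul_add])
    (fun a x y => by simp only [map_add]; abel)
    (fun c a x => by simp only [map_smul, map_add, smul_add])

theorem lamEval_modAct (α β Δ l : ℂ) (a : ℂ[X] × ℂ[X]) (q : ℂ[X]) :
    lamEval l (modAct α β Δ a q) =
      aeval (-C l) a.1 * aeval (X + C l) q * (X + C α + C Δ * C l) +
        aeval (-C l) a.2 * aeval (X + C l) q * C β := by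
  simp [modAct, lamEval_coeffs, eval_sesq]

/-- The conformal `HV`-module `V(α, β, Δ) = ℂ[∂]v`, the generator `v` being `1`. -/
noncomputable def modV (α β Δ : ℂ) : ConformalModule HV ℂ[X] where
  der := LinearMap.mulLeft ℂ X
  act := modAct α β Δ
  act_bracket a b q l m := by
    change _ = lamEval (l + m) (modAct α β Δ (lamEval l (bracket a b)) q)
    have e : (X + C l + C m : ℂ[X]) = X + C m + C l := by ring
    have e' : (-C m + -C l + C l : ℂ[X]) = -C m := by ring
    simp only [lamEval_bracket, lamEval_modAct]
    simp [aeval_aeval', aeval_C, map_ofNat, e, e']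
    ring_nf
  act_der a q l := by
    rw [lamEval_modAct, lamEval_modAct]
    simp [HV, smul_eq_C_mul]
    ring
  der_act a q l := by
    rw [lamEval_modAct, lamEval_modAct]
    simp [smul_eq_C_mul]
    ring

theorem modV_L (α β Δ l : ℂ) :
    lamEval l ((modV α β Δ).act L 1) = (modV α β Δ).der 1 + (α + Δ * l) • (1 : ℂ[X]) := by
  change lamEval l (modAct α β Δ L 1) = _
  rw [lamEval_modAct]
  simp [L, modV, smul_eq_C_mul, add_assoc]

theorem modV_N (α β Δ l : ℂ) :
    lamEval l ((modV α β Δ).act N 1) = β • (1 : ℂ[X]) := by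
  change lamEval l (modAct α β Δ N 1) = _
  rw [lamEval_modAct]
  simp [N, smul_eq_C_mul]

/-! ### Extensions of `V(α, β, Δ)` by `V(α', β', Δ')` and the list of cocycles -/

/-- The extension `E` is given by the pair `(f, k)`: for some lift `x` of the generator of
`V(α, β, Δ)` to `E`, with `v'` the generator of `V(α', β', Δ')`,
`L_λ x = (∂ + α + Δλ)x + f(∂, λ)v'` and `N_λ x = βx + k(∂, λ)v'`.
(Then `E = ℂ[∂]v' ⊕ ℂ[∂]x` as a `ℂ[∂]`-module, and `(f, k)` determines the action on `E`.) -/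
def IsGivenBy {α β Δ α' β' Δ' : ℂ}
    (E : ConformalModule.Extension.{u} (modV α' β' Δ') (modV α β Δ)) (f k : ℂ[X][X]) : Prop :=
  ∃ x : E.carrier, E.p x = 1 ∧
    (∀ l : ℂ, lamEval l (E.mod.act L x) =
      E.mod.der x + (α + Δ * l) • x + E.i (f.eval (C l))) ∧
    ∀ l : ℂ, lamEval l (E.mod.act N x) = β • x + E.i (k.eval (C l))

/-- `scal c` is the constant polynomial `c ∈ ℂ` in `ℂ[∂][λ]`. -/
noncomputable abbrev scal (c : ℂ) : ℂ[X][X] := C (C c)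

/-- `∂ + α` in `ℂ[∂][λ]`. -/
noncomputable abbrev dbar (α : ℂ) : ℂ[X][X] := C X + C (C α)

/-- `λ` in `ℂ[∂][λ]`. -/
noncomputable abbrev lam : ℂ[X][X] := X

/-- The list of pairs `(f, k)` for `β = 0`. -/
def ListedZero (α Δ Δ' : ℂ) (f k : ℂ[X][X]) : Prop :=
  (Δ = Δ' ∧ ∃ c₀ c₁ a₀ : ℂ, (c₀, c₁, a₀) ≠ (0, 0, 0) ∧
    f = scal c₀ + scal c₁ * lam ∧ k = scal a₀) ∨
  (Δ - Δ' = 1 ∧ ∃ a₁ : ℂ, a₁ ≠ 0 ∧ f = 0 ∧ k = scal a₁ * lam) ∨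
  (Δ - Δ' = 2 ∧ ∃ c₂ a₂ : ℂ, (c₂, a₂) ≠ (0, 0) ∧
    f = scal c₂ * (lam ^ 2 * (2 * dbar α + lam)) ∧
    k = scal a₂ * (lam * (dbar α - scal Δ' * lam))) ∨
  (Δ = 1 ∧ Δ' = -2 ∧ ∃ c₃ a₃ : ℂ, (c₃, a₃) ≠ (0, 0) ∧
    f = scal c₃ * (dbar α * lam ^ 2 * (dbar α + lam)) ∧
    k = scal a₃ * (lam * (dbar α ^ 2 + 3 * dbar α * lam + 2 * lam ^ 2))) ∨
  (Δ - Δ' = 3 ∧ Δ' ≠ -2 ∧ ∃ c₃ : ℂ, c₃ ≠ 0 ∧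
    f = scal c₃ * (dbar α * lam ^ 2 * (dbar α + lam)) ∧ k = 0) ∨
  (Δ - Δ' = 4 ∧ ∃ c₅ : ℂ, c₅ ≠ 0 ∧
    f = scal c₅ * (lam ^ 2 * (4 * dbar α ^ 3 + 6 * dbar α ^ 2 * lam - dbar α * lam ^ 2 +
      scal Δ' * lam ^ 3)) ∧ k = 0) ∨
  (Δ = 1 ∧ Δ' = -4 ∧ ∃ c₆ : ℂ, c₆ ≠ 0 ∧
    f = scal c₆ * (dbar α ^ 4 * lam ^ 2 - 10 * dbar α ^ 2 * lam ^ 4 - 17 * dbar α * lam ^ 5 -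
      8 * lam ^ 6) ∧ k = 0) ∨
  (∃ s : ℂ, s ^ 2 = 19 ∧ Δ = 7 / 2 + s / 2 ∧ Δ' = -5 / 2 + s / 2 ∧ ∃ c₇ : ℂ, c₇ ≠ 0 ∧
    f = scal c₇ * (dbar α ^ 4 * lam ^ 3 - scal (2 * Δ' + 3) * dbar α ^ 3 * lam ^ 4 -
      scal (3 * Δ') * dbar α ^ 2 * lam ^ 5 - scal (3 * Δ' + 1) * dbar α * lam ^ 6 -
      scal (Δ' + 9 / 28) * lam ^ 7) ∧ k = 0)

/-- The list of pairs `(f, k)` for `β ≠ 0`. For `Δ - Δ' = 1`, the pair `(Δ'λ², βλ)` is the trivial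
one with `φ = -(∂ + α)`, so the multiples of it are left out. -/
def ListedNonzero (α β Δ Δ' : ℂ) (f k : ℂ[X][X]) : Prop :=
  (Δ = Δ' ∧ ∃ a₀ c₀ c₁ : ℂ, (a₀, c₀, c₁) ≠ (0, 0, 0) ∧
    k = scal a₀ ∧ f = scal c₀ + scal c₁ * lam) ∨
  (Δ - Δ' = 1 ∧ ∃ b₂ c₂ : ℂ, β * c₂ ≠ Δ' * b₂ ∧
    k = scal b₂ * lam ∧ f = scal c₂ * lam ^ 2) ∨
  (Δ - Δ' = 2 ∧ ∃ b₂ c₃ : ℂ, (b₂, c₃) ≠ (0, 0) ∧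
    k = scal b₂ * lam ^ 2 ∧ f = scal (b₂ / β) * dbar α * lam ^ 2 + scal c₃ * lam ^ 3)

/-- The list of pairs `(f, k)`. -/
def Listed (α β Δ Δ' : ℂ) (f k : ℂ[X][X]) : Prop :=
  (β = 0 ∧ ListedZero α Δ Δ' f k) ∨ (β ≠ 0 ∧ ListedNonzero α β Δ Δ' f k)

/-- `f = (∂ + α + Δλ)φ(∂) - (∂ + α' + Δ'λ)φ(∂ + λ)`. -/
noncomputable def trivialF (α Δ α' Δ' : ℂ) (φ : ℂ[X]) : ℂ[X][X] :=
  (C X + scal α + scal Δ * lam) * C φ -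
    (C X + scal α' + scal Δ' * lam) * aeval (C X + lam : ℂ[X][X]) φ

/-- `k = β φ(∂) - β' φ(∂ + λ)`. -/
noncomputable def trivialK (β β' : ℂ) (φ : ℂ[X]) : ℂ[X][X] :=
  scal β * C φ - scal β' * aeval (C X + lam : ℂ[X][X]) φ

end HeisenbergVirasoro

/-! The classification is a computation of first cohomology. A lift of the generator turns an
extension into a pair `(f, k)`; the module axioms for the brackets LL, LN, NN become the three
identities of `IsCocycle`; changing the lift by `φ(∂)v'` adds the trivial pair of `φ`. So the task
is to find all cocycles modulo trivial pairs.

If `α ≠ α'`, or if `α = α'` and `β ≠ β'`, putting one of the two variables `λ`, `μ` equal to zero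
exhibits `φ`: it is `f(∂, 0) / (α - α')` or `k(∂, 0) / (β - β')` (`isTrivial_of_ne`,
`isTrivial_of_ne_right`). Otherwise the translation `∂ ↦ ∂ + γ` reduces to `α = α' = 0`, and the
coefficients of `λ ^ i μ ^ j` are compared. After subtracting a trivial pair, Euler identities make
`f`, up to its value at `λ = 0`, homogeneous of degree `n + 1` and `k` of degree `n`, where `n = Δ -
Δ'` (`homogeneous`, `exists_normalized`); the pair vanishes unless `n` is a natural number. What
remains is a linear system for numbers `a_j = lead f j` and `b_j = lead k j`.

Apart from small cases `f` is divisible by `λ ^ 2`, and a recursion determines it by `(a_2, a_3)`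
(`ext_lead`). In this plane the trivial cocycles, coming from `φ = s ∂ ^ n`, form the line spanned
by `(t_2, t_3)`, where `t_2 = n(n-1)/2 + nΔ'` and `t_3 = n(n-1)(n-2)/6 + n(n-1)Δ'/2`. Hence at most
one further cocycle exists up to scalars. It exists for `n = 2, 3, 4`; for `n ≥ 5` two expressions
for `a_6` force `(2Δ' + n - 1) ^ 2 = 3n + 1`, and for `n ≥ 7` two expressions for `a_8` exclude it
(`elimination_of_five_le`, `elimination_of_seven_le`). For `n = 5` and `n = 6` the quadratic
condition yields `Δ' = -4` (or the excluded `0`) and the values with `√19`.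

If `β = 0`, then `k` is independent of `f` and determined by `b_1`; the same elimination leaves `n ≤
3`. If `β ≠ 0`, the NN identity and the link between `f` and `k` in the LN identity leave only `n ≤
2`. Nontriviality of the listed `f` with `n ≥ 2` and `β = 0` says that `(a_2, a_3)` is off the
trivial line (`IsTransversal`); the other pairs are tested directly, mostly by evaluation at a few
points. -/

namespace ConformalModule

/-! ### Extensions of conformal modules in general. -/

variable {R : Type*} [AddCommGroup R] [Module ℂ R] {A : LieConformalAlgebra R}
variable {V : Type*} [AddCommGroup V] [Module ℂ V] {W : Type*} [AddCommGroup W] [Module ℂ W]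

theorem lamEval_mapRange (φ : V →ₗ[ℂ] W) (l : ℂ) (c : ℕ →₀ V) :
    lamEval l (Finsupp.mapRange.linearMap φ c) = φ (lamEval l c) := by
  induction c using Finsupp.induction_linear with
  | zero => simp
  | add x y hx hy => simp only [map_add, hx, hy]
  | single j x => simp [lamEval]

theorem lamEval_single (l : ℂ) (j : ℕ) (v : V) : lamEval l (Finsupp.single j v) = l ^ j • v := by
  simp [lamEval]

theorem IsHom.symm {M : ConformalModule A V} {N : ConformalModule A W} (e : V ≃ₗ[ℂ] W)
    (h : M.IsHom N e.toLinearMap) : N.IsHom M e.symm.toLinearMap := by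
  refine ⟨fun v => e.injective ?_, fun a v l => e.injective ?_⟩
  · have := h.1 (e.symm v)
    simp at this ⊢
    exact this.symm
  · have := h.2 a (e.symm v) l
    simp at this ⊢
    exact this.symm

/-- A linear map that commutes with `∂` commutes with `a_λ` on a `∂`-stable subspace. -/
theorem act_der_comm {M : ConformalModule A V} {N : ConformalModule A W} {ψ : V →ₗ[ℂ] W}
    (h : ∀ v, ψ (M.der v) = N.der (ψ v)) {a : R} {v : V} {l : ℂ}
    (hv : ψ (lamEval l (M.act a v)) = lamEval l (N.act a (ψ v))) :
    ψ (lamEval l (M.act a (M.der v))) = lamEval l (N.act a (ψ (M.der v))) := by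
  have h1 := congrArg ψ (M.der_act a v l)
  have h2 := N.der_act a (ψ v) l
  rw [map_sub, h, map_smul, hv] at h1
  rw [h, ← sub_right_inj, h1, h2]

theorem der_act_comm {M : ConformalModule A V} {N : ConformalModule A W} {ψ : V →ₗ[ℂ] W}
    {a : R} {v : V} {l : ℂ}
    (hv : ψ (lamEval l (M.act a v)) = lamEval l (N.act a (ψ v))) :
    ψ (lamEval l (M.act (A.der a) v)) = lamEval l (N.act (A.der a) (ψ v)) := by
  rw [M.act_der, N.act_der, map_smul, hv]

namespace Extension

variable {M : ConformalModule A V} {N : ConformalModule A W}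

theorem p_i (E : Extension.{u} M N) (v : V) : E.p (E.i v) = 0 := by
  have : E.i v ∈ LinearMap.ker E.p := E.exact ▸ LinearMap.mem_range_self E.i v
  exact this

theorem exists_i_of_p_eq_zero (E : Extension.{u} M N) {e : E.carrier} (h : E.p e = 0) :
    ∃ v, E.i v = e := by
  have : e ∈ LinearMap.range E.i := E.exact ▸ h
  exact this

theorem Equivalent.trans {E : Extension.{u} M N} {E' : Extension.{v} M N}
    {E'' : Extension.{w} M N} (h : E.Equivalent E') (h' : E'.Equivalent E'') :
    E.Equivalent E'' := by
  obtain ⟨ψ, h1, h2, h3⟩ := h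
  obtain ⟨χ, k1, k2, k3⟩ := h'
  exact ⟨χ ∘ₗ ψ, ⟨fun v => by simp [h1.1, k1.1], fun a v l => by simp [h1.2, k1.2]⟩,
    fun x => by simp [h2, k2], fun y => by simp [h3, k3]⟩

/-- The short five lemma: a homomorphism that is the identity on both ends is bijective. -/
theorem Equivalent.symm {E : Extension.{u} M N} {E' : Extension.{v} M N}
    (h : E.Equivalent E') : E'.Equivalent E := by
  obtain ⟨ψ, h1, h2, h3⟩ := h
  have hi : Function.Injective ψ := by
    rw [injective_iff_map_eq_zero]
    intro e he
    obtain ⟨v, rfl⟩ := E.exists_i_of_p_eq_zero (e := e) (by rw [← h3, he, map_zero])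
    rw [h2] at he
    rw [E'.i_injective (he.trans (map_zero _).symm), map_zero]
  have hs : Function.Surjective ψ := by
    intro e'
    obtain ⟨e, he⟩ := E.p_surjective (E'.p e')
    obtain ⟨v, hv⟩ := E'.exists_i_of_p_eq_zero (e := e' - ψ e) (by rw [map_sub, h3, he, sub_self])
    exact ⟨e + E.i v, by rw [map_add, h2, hv]; abel⟩
  let e := LinearEquiv.ofBijective ψ ⟨hi, hs⟩
  refine ⟨e.symm.toLinearMap, IsHom.symm e h1, fun x => e.injective ?_, fun y => ?_⟩
  · exact (e.apply_symm_apply _).trans (h2 x).symm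
  · exact (h3 (e.symm y)).symm.trans (congrArg _ (e.apply_symm_apply y))

end Extension

end ConformalModule

namespace HeisenbergVirasoro

open ConformalModule

/-! ### Cocycles and the extensions that they define -/

/-- The conditions on `(f, k)` for `L_λ v = (∂ + α + Δλ)v + f(∂, λ)v'`, `N_λ v = βv + k(∂, λ)v'`
to define a conformal module. -/
structure IsCocycle (α β Δ α' β' Δ' : ℂ) (f k : ℂ[X][X]) : Prop where
  LL : ∀ x l m : ℂ, (x + l + α + Δ * m) * f.evalEval x l +
    (x + α' + Δ' * l) * f.evalEval (x + l) m - (x + m + α + Δ * l) * f.evalEval x m -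
    (x + α' + Δ' * m) * f.evalEval (x + m) l = (l - m) * f.evalEval x (l + m)
  LN : ∀ x l m : ℂ, β * f.evalEval x l + (x + α' + Δ' * l) * k.evalEval (x + l) m -
    (x + m + α + Δ * l) * k.evalEval x m - β' * f.evalEval (x + m) l =
      -m * k.evalEval x (l + m)
  NN : ∀ x l m : ℂ, β * k.evalEval x l + β' * k.evalEval (x + l) m =
    β * k.evalEval x m + β' * k.evalEval (x + m) l

theorem aeval_neg_C (l : ℂ) (p : ℂ[X]) : aeval (-C l : ℂ[X]) p = C (p.eval (-l)) := by
  rw [← C_neg, ← algebraMap_eq, aeval_algebraMap_apply, coe_aeval_eq_eval]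

theorem eval_aeval_shift (l x : ℂ) (q : ℂ[X]) :
    (aeval (X + C l : ℂ[X]) q).eval x = q.eval (x + l) := by
  rw [← comp_eq_aeval]; simp

/-- The action on `ℂ[∂]v' ⊕ ℂ[∂]v` defined by the pair `(f, k)`. -/
noncomputable def extAct (α β Δ α' β' Δ' : ℂ) (f k : ℂ[X][X]) :
    (ℂ[X] × ℂ[X]) →ₗ[ℂ] (ℂ[X] × ℂ[X]) →ₗ[ℂ] (ℕ →₀ ℂ[X] × ℂ[X]) :=
  LinearMap.mk₂ ℂ
    (fun a y =>
      Finsupp.mapRange.linearMap (LinearMap.inl ℂ ℂ[X] ℂ[X])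
        (modAct α' β' Δ' a y.1 + coeffs (sesq f a.1 y.2 + sesq k a.2 y.2)) +
      Finsupp.mapRange.linearMap (LinearMap.inr ℂ ℂ[X] ℂ[X]) (modAct α β Δ a y.2))
    (fun a b x => by
      simp only [map_add, LinearMap.add_apply, Prod.fst_add, Prod.snd_add]; abel)
    (fun c a x => by
      simp only [map_smul, map_add, LinearMap.smul_apply, Prod.smul_fst, Prod.smul_snd, smul_add])
    (fun a x y => by simp only [Prod.fst_add, Prod.snd_add, map_add]; abel)
    (fun c a x => by simp only [Prod.smul_fst, Prod.smul_snd, map_smul, map_add, smul_add])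

theorem lamEval_extAct (α β Δ α' β' Δ' : ℂ) (f k : ℂ[X][X]) (l : ℂ) (a y : ℂ[X] × ℂ[X]) :
    lamEval l (extAct α β Δ α' β' Δ' f k a y) =
      (aeval (-C l) a.1 * aeval (X + C l) y.1 * (X + C α' + C Δ' * C l) +
          aeval (-C l) a.2 * aeval (X + C l) y.1 * C β' +
        (aeval (-C l) a.1 * aeval (X + C l) y.2 * f.eval (C l) +
          aeval (-C l) a.2 * aeval (X + C l) y.2 * k.eval (C l)),
        aeval (-C l) a.1 * aeval (X + C l) y.2 * (X + C α + C Δ * C l) +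
          aeval (-C l) a.2 * aeval (X + C l) y.2 * C β) := by
  simp only [extAct, LinearMap.mk₂_apply, lamEval_prod]
  simp only [map_add, lamEval_coeffs, lamEval_modAct, eval_sesq]

variable {α β Δ α' β' Δ' : ℂ} {f k : ℂ[X][X]}

/-- The conformal module `ℂ[∂]v' ⊕ ℂ[∂]v` defined by a cocycle. -/
noncomputable def extMod (h : IsCocycle α β Δ α' β' Δ' f k) :
    ConformalModule HV (ℂ[X] × ℂ[X]) where
  der := LinearMap.prodMap (LinearMap.mulLeft ℂ X) (LinearMap.mulLeft ℂ X)
  act := extAct α β Δ α' β' Δ' f k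
  act_bracket a b y l m := by
    change _ = lamEval (l + m) (extAct α β Δ α' β' Δ' f k (lamEval l (bracket a b)) y)
    simp only [lamEval_bracket, lamEval_extAct]
    ext1
    · refine Polynomial.funext fun x => ?_
      have e1 : x + m + l = x + l + m := by ring
      have e2 : -m + -l + l = -m := by ring
      have e3 : x + (l + m) = x + l + m := by ring
      have h1 := h.LL x l m
      have h2 := h.LN x l m
      have h3 := h.LN x m l
      have h4 := h.NN x l m
      rw [add_comm m l] at h3
      simp only [Polynomial.evalEval] at h1 h2 h3 h4
      simp only [Prod.fst_sub, eval_add, eval_sub, eval_mul, aeval_neg_C,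
        eval_aeval_shift, eval_C, eval_X, eval_ofNat, e1, e2, e3, neg_add_rev]
      -- By sesquilinearity the four pairs of generators contribute separately. The pair `(N, L)` is
      -- the LN identity with `λ` and `μ` exchanged, which accounts for the minus sign.
      linear_combination (a.1.eval (-l) * b.1.eval (-m) * y.2.eval (x + l + m)) * h1 +
        (a.1.eval (-l) * b.2.eval (-m) * y.2.eval (x + l + m)) * h2 -
        (a.2.eval (-l) * b.1.eval (-m) * y.2.eval (x + l + m)) * h3 +
        (a.2.eval (-l) * b.2.eval (-m) * y.2.eval (x + l + m)) * h4
    · refine Polynomial.funext fun x => ?_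
      have e1 : x + m + l = x + l + m := by ring
      have e2 : -m + -l + l = -m := by ring
      have e3 : x + (l + m) = x + l + m := by ring
      simp only [Prod.snd_sub, eval_add, eval_sub, eval_mul, aeval_neg_C,
        eval_aeval_shift, eval_C, eval_X, eval_ofNat, e1, e2, e3, neg_add_rev]
      ring
  act_der a y l := by
    rw [lamEval_extAct, lamEval_extAct]
    ext1 <;> simp [HV, smul_eq_C_mul] <;> ring
  der_act a y l := by
    rw [lamEval_extAct, lamEval_extAct]
    ext1 <;> simp [smul_eq_C_mul] <;> ring

/-- The extension defined by a cocycle. -/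
noncomputable def ext (h : IsCocycle α β Δ α' β' Δ' f k) :
    Extension.{0} (modV α' β' Δ') (modV α β Δ) where
  carrier := ℂ[X] × ℂ[X]
  mod := extMod h
  i := LinearMap.inl ℂ ℂ[X] ℂ[X]
  p := LinearMap.snd ℂ ℂ[X] ℂ[X]
  i_hom := ⟨fun v => by simp [extMod, modV], fun a v l => by
    simp only [extMod, modV, lamEval_extAct, lamEval_modAct]; simp⟩
  p_hom := ⟨fun v => by simp [extMod, modV], fun a v l => by
    simp only [extMod, modV, lamEval_extAct, lamEval_modAct]; simp⟩
  i_injective := LinearMap.inl_injective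
  p_surjective := LinearMap.snd_surjective
  exact := LinearMap.range_inl ℂ ℂ[X] ℂ[X]

theorem ext_isGivenBy (h : IsCocycle α β Δ α' β' Δ' f k) : IsGivenBy (ext h) f k := by
  refine ⟨((0 : ℂ[X]), (1 : ℂ[X])), rfl, fun l => ?_, fun l => ?_⟩
  · change lamEval l (extAct α β Δ α' β' Δ' f k L (0, 1)) =
      (X * (0 : ℂ[X]), X * (1 : ℂ[X])) + (α + Δ * l) • ((0 : ℂ[X]), (1 : ℂ[X])) +
        (f.eval (C l), (0 : ℂ[X]))
    rw [lamEval_extAct]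
    ext1 <;> simp [L, smul_eq_C_mul]
    ring
  · change lamEval l (extAct α β Δ α' β' Δ' f k N (0, 1)) =
      β • ((0 : ℂ[X]), (1 : ℂ[X])) + (k.eval (C l), (0 : ℂ[X]))
    rw [lamEval_extAct]
    ext1 <;> simp [N, smul_eq_C_mul]

theorem submodule_eq_top_of_der {S : Submodule ℂ (ℂ[X] × ℂ[X])} (hL : L ∈ S) (hN : N ∈ S)
    (hd : ∀ a ∈ S, HV.der a ∈ S) (a : ℂ[X] × ℂ[X]) : a ∈ S := by
  have h1 : ∀ p : ℂ[X], (p, (0 : ℂ[X])) ∈ S := by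
    intro p
    induction p using Polynomial.induction_on with
    | C c => simpa [L, smul_eq_C_mul] using S.smul_mem c hL
    | add p q hp hq => simpa using S.add_mem hp hq
    | monomial n c ih =>
      have := hd _ ih
      simp [HV] at this
      convert this using 2
      ring
  have h2 : ∀ p : ℂ[X], ((0 : ℂ[X]), p) ∈ S := by
    intro p
    induction p using Polynomial.induction_on with
    | C c => simpa [N, smul_eq_C_mul] using S.smul_mem c hN
    | add p q hp hq => simpa using S.add_mem hp hq
    | monomial n c ih =>
      have := hd _ ih
      simp [HV] at this
      convert this using 2
      ring
  simpa using S.add_mem (h1 a.1) (h2 a.2)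

section

variable {V W : Type*} [AddCommGroup V] [Module ℂ V] [AddCommGroup W] [Module ℂ W]

/-- For a map that commutes with `∂` it is enough to test `L_λ` and `N_λ`. -/
theorem comm_of_comm_L_N {M : ConformalModule HV V} {N' : ConformalModule HV W}
    {ψ : V →ₗ[ℂ] W} {v : V}
    (hL : ∀ l, ψ (lamEval l (M.act L v)) = lamEval l (N'.act L (ψ v)))
    (hN : ∀ l, ψ (lamEval l (M.act N v)) = lamEval l (N'.act N (ψ v))) (a : ℂ[X] × ℂ[X]) (l : ℂ) :
    ψ (lamEval l (M.act a v)) = lamEval l (N'.act a (ψ v)) := by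
  let S : Submodule ℂ (ℂ[X] × ℂ[X]) :=
    { carrier := {a | ψ (lamEval l (M.act a v)) = lamEval l (N'.act a (ψ v))}
      add_mem' := fun {a b} ha hb => by
        simp only [Set.mem_ofPred_eq, map_add, LinearMap.add_apply] at *; rw [ha, hb]
      zero_mem' := by simp
      smul_mem' := fun c a ha => by
        simp only [Set.mem_ofPred_eq, map_smul, LinearMap.smul_apply] at *; rw [ha] }
  exact submodule_eq_top_of_der (S := S) (hL l) (hN l) (fun a ha => der_act_comm ha) a

end

/-- The equivalence is `(q', q) ↦ i(q') + q(∂)x`, defined because `ℂ[∂]v` is free. It respects the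
action on `(q', 0)` because `i` does, on `(0, 1)` by the formulas defining `(f, k)`, and then on
every `(0, q)` by sesquilinearity. -/
theorem IsGivenBy.ext_equivalent {E : Extension.{u} (modV α' β' Δ') (modV α β Δ)}
    (hE : IsGivenBy E f k) (h : IsCocycle α β Δ α' β' Δ' f k) : (ext h).Equivalent E := by
  obtain ⟨x, hx, hL, hN⟩ := hE
  let χ : ℂ[X] →ₗ[ℂ] E.carrier :=
    (LinearMap.applyₗ x : Module.End ℂ E.carrier →ₗ[ℂ] E.carrier) ∘ₗ
      (aeval (E.mod.der : Module.End ℂ E.carrier)).toLinearMap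
  have χ1 : χ 1 = x := by simp [χ]
  have χX : ∀ q, χ (X * q) = E.mod.der (χ q) := by intro q; simp [χ]
  let ψ : ℂ[X] × ℂ[X] →ₗ[ℂ] E.carrier := LinearMap.coprod E.i χ
  have hd : ∀ v, ψ ((extMod h).der v) = E.mod.der (ψ v) := by
    intro v
    have := E.i_hom.1 v.1
    simp only [modV] at this
    change E.i (X * v.1) + χ (X * v.2) = _
    rw [χX, show X * v.1 = (LinearMap.mulLeft ℂ X) v.1 from rfl, this, ← map_add]
    rfl
  have hp : ∀ q, E.p (χ q) = q := by
    intro q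
    induction q using Polynomial.induction_on with
    | C c =>
      have : (C c : ℂ[X]) = c • 1 := by simp [smul_eq_C_mul]
      rw [this, map_smul, map_smul, χ1, hx]
    | add p q hp hq => simp only [map_add, hp, hq]
    | monomial n c ih =>
      have e : (C c * X ^ (n + 1) : ℂ[X]) = X * (C c * X ^ n) := by ring
      rw [e, χX, E.p_hom.1, ih]
      simp [modV]
  have h1 : ∀ (a : ℂ[X] × ℂ[X]) (l : ℂ) (q : ℂ[X]),
      ψ (lamEval l ((extMod h).act a (q, 0))) = lamEval l (E.mod.act a (ψ (q, 0))) := by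
    intro a l q
    have e : ψ (q, 0) = E.i q := by simp [ψ]
    rw [e, ← E.i_hom.2]
    have e' := (ext h).i_hom.2 a q l
    change (lamEval l ((modV α' β' Δ').act a q), (0 : ℂ[X])) =
      lamEval l ((extMod h).act a (q, 0)) at e'
    rw [← e']
    simp [ψ]
  have h2 : ∀ (a : ℂ[X] × ℂ[X]) (l : ℂ),
      ψ (lamEval l ((extMod h).act a (0, 1))) = lamEval l (E.mod.act a (ψ (0, 1))) := by
    intro a l
    have e : ψ (0, 1) = x := by simp [ψ, χ1]
    refine comm_of_comm_L_N (ψ := ψ) (fun l => ?_) (fun l => ?_) a l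
    · rw [e, hL]
      change ψ (lamEval l (extAct α β Δ α' β' Δ' f k L (0, 1))) = _
      have : lamEval l (extAct α β Δ α' β' Δ' f k L (0, 1)) =
          (f.eval (C l), X * 1 + (α + Δ * l) • 1) := by
        rw [lamEval_extAct]
        ext1 <;> simp [L, smul_eq_C_mul]
        ring
      rw [this]
      change E.i (f.eval (C l)) + χ (X * 1 + (α + Δ * l) • 1) = _
      rw [map_add, map_smul, χX, χ1]
      abel
    · rw [e, hN]
      change ψ (lamEval l (extAct α β Δ α' β' Δ' f k N (0, 1))) = _
      have : lamEval l (extAct α β Δ α' β' Δ' f k N (0, 1)) = (k.eval (C l), β • 1) := by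
        rw [lamEval_extAct]
        ext1 <;> simp [N, smul_eq_C_mul]
      rw [this]
      change E.i (k.eval (C l)) + χ (β • 1) = _
      rw [map_smul, χ1]
      abel
  have h3 : ∀ (a : ℂ[X] × ℂ[X]) (l : ℂ) (q : ℂ[X]),
      ψ (lamEval l ((extMod h).act a (0, q))) = lamEval l (E.mod.act a (ψ (0, q))) := by
    intro a l q
    induction q using Polynomial.induction_on with
    | C c =>
      have : ((0 : ℂ[X]), (C c : ℂ[X])) = c • ((0 : ℂ[X]), (1 : ℂ[X])) := by
        simp [smul_eq_C_mul]
      rw [this]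
      simp only [map_smul, h2]
    | add p q hp hq =>
      have : ((0 : ℂ[X]), p + q) = (0, p) + (0, q) := by simp
      rw [this]
      simp only [map_add, hp, hq]
    | monomial n c ih =>
      have e : ((0 : ℂ[X]), (C c * X ^ (n + 1) : ℂ[X])) =
          (extMod h).der ((0 : ℂ[X]), (C c * X ^ n : ℂ[X])) := by
        simp [extMod]; ring
      rw [e]
      exact act_der_comm hd ih
  have h4 : (extMod h).IsHom E.mod ψ := by
    refine ⟨hd, fun a v l => ?_⟩
    have : v = ((v.1, 0) + (0, v.2) : ℂ[X] × ℂ[X]) := by ext1 <;> simp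
    rw [this]
    simp only [map_add, h1, h3]
  refine ⟨ψ, h4, fun q => ?_, fun v => ?_⟩
  · change E.i q + χ 0 = E.i q
    rw [map_zero, add_zero]
  · change E.p (E.i v.1 + χ v.2) = v.2
    rw [map_add, E.p_i, hp, zero_add]

end HeisenbergVirasoro

/-! ### Passing from extensions to pairs `(f, k)`, and the pairs of trivial extensions. -/

namespace HeisenbergVirasoro

open ConformalModule

variable {α β Δ α' β' Δ' : ℂ} {f k : ℂ[X][X]}

theorem exists_coeffs_eq (d : ℕ →₀ ℂ[X]) : ∃ P : ℂ[X][X], coeffs P = d := by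
  refine ⟨d.sum fun j q => monomial j q, ?_⟩
  ext1 j
  change (d.sum fun j q => monomial j q).coeff j = d j
  rw [Finsupp.sum, finsetSum_coeff]
  simp only [coeff_monomial]
  rw [Finset.sum_ite_eq']
  split_ifs with h
  · rfl
  · exact (Finsupp.notMem_support_iff.mp h).symm

theorem eq_zero_of_eval_C (P : ℂ[X][X]) (h : ∀ l : ℂ, P.eval (C l) = 0) : P = 0 := by
  refine P.eq_zero_of_infinite_isRoot (Set.Infinite.mono ?_ (Set.infinite_range_of_injective
    (C_injective (R := ℂ))))
  rintro _ ⟨l, rfl⟩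
  exact h l

theorem ext_evalEval {P Q : ℂ[X][X]} (h : ∀ x l : ℂ, P.evalEval x l = Q.evalEval x l) :
    P = Q := by
  refine sub_eq_zero.mp (eq_zero_of_eval_C _ fun l => ?_)
  rw [eval_sub, sub_eq_zero]
  exact Polynomial.funext fun x => h x l

/-- A polynomial in `λ` that vanishes at all complex numbers has zero coefficients, so each
coefficient of `c` lies in `ker p = range i`; injectivity of `i` keeps the family of preimages
finitely supported. -/
theorem exists_coeffs_of_p_eq_zero (E : Extension.{u} (modV α' β' Δ') (modV α β Δ))
    (c : ℕ →₀ E.carrier) (h : ∀ l, E.p (lamEval l c) = 0) :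
    ∃ P : ℂ[X][X], ∀ l, lamEval l c = E.i (P.eval (C l)) := by
  obtain ⟨Q, hQ⟩ := exists_coeffs_eq (Finsupp.mapRange.linearMap E.p c)
  have hQ0 : Q = 0 := eq_zero_of_eval_C Q fun l => by
    rw [← lamEval_coeffs, hQ, lamEval_mapRange, h]
  rw [hQ0, map_zero] at hQ
  have hc : ∀ j, ∃ v, E.i v = c j := fun j =>
    E.exists_i_of_p_eq_zero (by simpa using (DFunLike.congr_fun hQ j).symm)
  choose g hg using hc
  let d : ℕ →₀ ℂ[X] := Finsupp.onFinset c.support g fun j hj => by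
    rw [Finsupp.mem_support_iff, ← hg]
    exact fun h0 => hj (E.i_injective (h0.trans (map_zero _).symm))
  obtain ⟨P, hP⟩ := exists_coeffs_eq d
  refine ⟨P, fun l => ?_⟩
  rw [← lamEval_coeffs, hP, ← lamEval_mapRange]
  congr 1
  ext1 j
  exact (hg j).symm

theorem exists_isGivenBy (E : Extension.{u} (modV α' β' Δ') (modV α β Δ)) :
    ∃ f k : ℂ[X][X], IsGivenBy E f k := by
  obtain ⟨x, hx⟩ := E.p_surjective 1
  have hd : E.p (E.mod.der x) = (modV α β Δ).der 1 := by rw [E.p_hom.1, hx]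
  obtain ⟨f, hf⟩ := exists_coeffs_of_p_eq_zero E (E.mod.act L x -
      (Finsupp.single 0 (E.mod.der x + α • x) + Finsupp.single 1 (Δ • x))) (fun l => by
    simp only [map_sub, map_add, lamEval_single, E.p_hom.2, hx, modV_L, hd, map_smul]
    module)
  obtain ⟨k, hk⟩ := exists_coeffs_of_p_eq_zero E (E.mod.act N x - Finsupp.single 0 (β • x))
    (fun l => by
      simp only [map_sub, lamEval_single, E.p_hom.2, hx, modV_N, map_smul]
      module)
  refine ⟨f, k, x, hx, fun l => ?_, fun l => ?_⟩
  · rw [← hf]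
    simp only [map_sub, map_add, lamEval_single]
    module
  · rw [← hk]
    simp only [map_sub, lamEval_single]
    module

theorem lamEval_act_i (E : Extension.{u} (modV α' β' Δ') (modV α β Δ)) (l : ℂ) (q : ℂ[X]) :
    lamEval l (E.mod.act L (E.i q)) = E.i (aeval (X + C l) q * (X + C α' + C Δ' * C l)) ∧
    lamEval l (E.mod.act N (E.i q)) = E.i (aeval (X + C l) q * C β') := by
  rw [← E.i_hom.2, ← E.i_hom.2]
  change E.i (lamEval l (modAct α' β' Δ' L q)) = _ ∧ E.i (lamEval l (modAct α' β' Δ' N q)) = _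
  rw [lamEval_modAct, lamEval_modAct]
  simp [L, N]

theorem der_i (E : Extension.{u} (modV α' β' Δ') (modV α β Δ)) (q : ℂ[X]) :
    E.mod.der (E.i q) = E.i (X * q) := by
  rw [← E.i_hom.1]
  rfl

/-- Expand the bracket axiom on the lift `x`. The terms in `x` and `∂x` cancel, since `V(α, β, Δ)`
is itself a module; the rest lies in the image of the injective map `i`. -/
theorem IsGivenBy.isCocycle {E : Extension.{u} (modV α' β' Δ') (modV α β Δ)}
    (hE : IsGivenBy E f k) : IsCocycle α β Δ α' β' Δ' f k := by
  obtain ⟨x, hx, hL, hN⟩ := hE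
  have hLd : ∀ l, lamEval l (E.mod.act L (E.mod.der x)) =
      E.mod.der (lamEval l (E.mod.act L x)) + l • lamEval l (E.mod.act L x) := fun l => by
    linear_combination (norm := module) (-1 : ℂ) • E.mod.der_act L x l
  have hNd : ∀ l, lamEval l (E.mod.act N (E.mod.der x)) =
      E.mod.der (lamEval l (E.mod.act N x)) + l • lamEval l (E.mod.act N x) := fun l => by
    linear_combination (norm := module) (-1 : ℂ) • E.mod.der_act N x l
  have hzero : ∀ q : ℂ[X], E.i q = 0 → q = 0 := fun q hq =>
    E.i_injective (hq.trans (map_zero _).symm)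
  have hsm : ∀ (c : ℂ) (q : ℂ[X]), E.i (C c * q) = c • E.i q := fun c q => by
    rw [← smul_eq_C_mul, map_smul]
  refine ⟨fun y l m => ?_, fun y l m => ?_, fun y l m => ?_⟩
  · have h := E.mod.act_bracket L L x l m
    rw [bracket_L_L] at h
    simp only [map_add, map_smul, LinearMap.add_apply, LinearMap.smul_apply, E.mod.act_der, hL,
      hLd, (lamEval_act_i E _ _).1, der_i] at h
    have key : C (α + l + Δ * m) * f.eval (C l) + X * f.eval (C l) +
        aeval (X + C l) (f.eval (C m)) * (X + C α' + C Δ' * C l) -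
        (C (α + m + Δ * l) * f.eval (C m) + X * f.eval (C m) +
        aeval (X + C m) (f.eval (C l)) * (X + C α' + C Δ' * C m)) -
        C (l - m) * f.eval (C (l + m)) = 0 := by
      refine hzero _ ?_
      simp only [map_add E.i, map_sub E.i, hsm]
      simp only [C_add]
      linear_combination (norm := module) h
    have := congrArg (eval y) key
    simp [eval_aeval_shift] at this
    simp only [evalEval, C_add]
    linear_combination this
  · have h := E.mod.act_bracket L N x l m
    rw [bracket_L_N] at h
    simp only [map_add, map_smul, LinearMap.add_apply, LinearMap.smul_apply, E.mod.act_der, hL, hN,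
      hNd, (lamEval_act_i E _ _).1, (lamEval_act_i E _ _).2, der_i] at h
    have key : C β * f.eval (C l) + aeval (X + C l) (k.eval (C m)) * (X + C α' + C Δ' * C l) -
        (C (α + m + Δ * l) * k.eval (C m) + X * k.eval (C m) +
        aeval (X + C m) (f.eval (C l)) * C β') + C m * k.eval (C (l + m)) = 0 := by
      refine hzero _ ?_
      simp only [map_add E.i, map_sub E.i, hsm]
      simp only [C_add]
      linear_combination (norm := module) h
    have := congrArg (eval y) key
    simp [eval_aeval_shift] at this
    simp only [evalEval, C_add]
    linear_combination this
  · have h := E.mod.act_bracket N N x l m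
    rw [bracket_N_N] at h
    simp only [map_add, map_smul, map_zero, LinearMap.zero_apply, hN,
      (lamEval_act_i E _ _).2] at h
    have key : C β * k.eval (C l) + aeval (X + C l) (k.eval (C m)) * C β' -
        (C β * k.eval (C m) + aeval (X + C m) (k.eval (C l)) * C β') = 0 := by
      refine hzero _ ?_
      simp only [map_add E.i, map_sub E.i, hsm]
      linear_combination (norm := module) h
    have := congrArg (eval y) key
    simp [eval_aeval_shift] at this
    simp only [evalEval]
    linear_combination this

theorem IsGivenBy.of_equivalent {E : Extension.{u} (modV α' β' Δ') (modV α β Δ)}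
    {E' : Extension.{v} (modV α' β' Δ') (modV α β Δ)} (hE : IsGivenBy E f k)
    (h : E.Equivalent E') : IsGivenBy E' f k := by
  obtain ⟨x, hx, hL, hN⟩ := hE
  obtain ⟨ψ, h1, h2, h3⟩ := h
  refine ⟨ψ x, by rw [h3, hx], fun l => ?_, fun l => ?_⟩
  · rw [← h1.2, hL, map_add, map_add, h1.1, map_smul, h2]
  · rw [← h1.2, hN, map_add, map_smul, h2]

theorem IsGivenBy.equivalent {E : Extension.{u} (modV α' β' Δ') (modV α β Δ)}
    {E' : Extension.{v} (modV α' β' Δ') (modV α β Δ)} (hE : IsGivenBy E f k)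
    (hE' : IsGivenBy E' f k) : E.Equivalent E' :=
  (hE.ext_equivalent hE.isCocycle).symm.trans (hE'.ext_equivalent hE.isCocycle)

theorem eval_aeval_CX_add_X (φ : ℂ[X]) (l : ℂ) :
    (aeval (C X + lam : ℂ[X][X]) φ).eval (C l) = aeval (X + C l) φ := by
  have := Polynomial.hom_eval₂ φ (algebraMap ℂ ℂ[X][X]) (evalRingHom (C l)) (C X + lam)
  simp only [coe_evalRingHom] at this
  rw [aeval_def, this, aeval_def]
  congr 1
  · ext c : 1
    simp [Polynomial.algebraMap_apply]
  · simp

theorem eval_trivialF (φ : ℂ[X]) (l : ℂ) : (trivialF α Δ α' Δ' φ).eval (C l) =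
    (X + C α + C Δ * C l) * φ - (X + C α' + C Δ' * C l) * aeval (X + C l) φ := by
  simp [trivialF, eval_aeval_CX_add_X]

theorem eval_trivialK (φ : ℂ[X]) (l : ℂ) : (trivialK β β' φ).eval (C l) =
    C β * φ - C β' * aeval (X + C l) φ := by
  simp [trivialK, eval_aeval_CX_add_X]

theorem evalEval_trivialF (φ : ℂ[X]) (x l : ℂ) : (trivialF α Δ α' Δ' φ).evalEval x l =
    (x + α + Δ * l) * φ.eval x - (x + α' + Δ' * l) * φ.eval (x + l) := by
  simp [evalEval, eval_trivialF, eval_aeval_shift]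

theorem evalEval_trivialK (φ : ℂ[X]) (x l : ℂ) : (trivialK β β' φ).evalEval x l =
    β * φ.eval x - β' * φ.eval (x + l) := by
  simp [evalEval, eval_trivialK, eval_aeval_shift]

/-- Replacing the lift `x` by `x - φ(∂)v'` changes `(f, k)` by the trivial pair of `φ`. -/
theorem IsGivenBy.add_trivial {E : Extension.{u} (modV α' β' Δ') (modV α β Δ)}
    (hE : IsGivenBy E f k) (φ : ℂ[X]) :
    IsGivenBy E (f + trivialF α Δ α' Δ' φ) (k + trivialK β β' φ) := by
  obtain ⟨x, hx, hL, hN⟩ := hE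
  have hsm : ∀ (c : ℂ) (q : ℂ[X]), E.i (C c * q) = c • E.i q := fun c q => by
    rw [← smul_eq_C_mul, map_smul]
  refine ⟨x - E.i φ, by rw [map_sub, hx, E.p_i, sub_zero], fun l => ?_, fun l => ?_⟩
  · have e : (f + trivialF α Δ α' Δ' φ).eval (C l) = f.eval (C l) + X * φ + C (α + Δ * l) * φ -
        aeval (X + C l) φ * (X + C α' + C Δ' * C l) := by
      rw [eval_add, eval_trivialF, C_add, C_mul]; ring
    simp only [e, map_sub, hL, (lamEval_act_i E _ _).1, map_add E.i, map_sub E.i, hsm, der_i]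
    module
  · have e : (k + trivialK β β' φ).eval (C l) = k.eval (C l) + C β * φ -
        aeval (X + C l) φ * C β' := by
      rw [eval_add, eval_trivialK]; ring
    simp only [e, map_sub, hN, (lamEval_act_i E _ _).2, map_add E.i, map_sub E.i, hsm]
    module

/-- The new pair describes the same module with another lift, so the identities need not be checked
again. -/
theorem IsCocycle.add_trivial (h : IsCocycle α β Δ α' β' Δ' f k) (φ : ℂ[X]) :
    IsCocycle α β Δ α' β' Δ' (f + trivialF α Δ α' Δ' φ) (k + trivialK β β' φ) :=
  ((ext_isGivenBy h).add_trivial φ).isCocycle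

theorem trivialF_neg (φ : ℂ[X]) : trivialF α Δ α' Δ' (-φ) = -trivialF α Δ α' Δ' φ := by
  simp [trivialF]; ring

theorem trivialK_neg (φ : ℂ[X]) : trivialK β β' (-φ) = -trivialK β β' φ := by
  simp [trivialK]; ring

theorem split_isGivenBy_zero :
    IsGivenBy (Extension.split (modV α' β' Δ') (modV α β Δ)) 0 0 := by
  refine ⟨((0 : ℂ[X]), (1 : ℂ[X])), rfl, fun l => ?_, fun l => ?_⟩
  · change lamEval l (((modV α' β' Δ').directSum (modV α β Δ)).act L ((0 : ℂ[X]), (1 : ℂ[X]))) =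
      ((modV α' β' Δ').der 0, (modV α β Δ).der 1) + (α + Δ * l) • ((0 : ℂ[X]), (1 : ℂ[X])) +
        (eval (C l) (0 : ℂ[X][X]), (0 : ℂ[X]))
    simp only [directSum, LinearMap.mk₂_apply, lamEval_prod, modV_L]
    simp
  · change lamEval l (((modV α' β' Δ').directSum (modV α β Δ)).act N ((0 : ℂ[X]), (1 : ℂ[X]))) =
      β • ((0 : ℂ[X]), (1 : ℂ[X])) + (eval (C l) (0 : ℂ[X][X]), (0 : ℂ[X]))
    simp only [directSum, LinearMap.mk₂_apply, lamEval_prod, modV_N]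
    simp

theorem split_isGivenBy (φ : ℂ[X]) : IsGivenBy (Extension.split (modV α' β' Δ') (modV α β Δ))
    (trivialF α Δ α' Δ' φ) (trivialK β β' φ) := by
  simpa using split_isGivenBy_zero.add_trivial (α := α) (β := β) (Δ := Δ) (α' := α') (β' := β')
    (Δ' := Δ') φ

/-- The lifts of the generator to the direct sum are exactly the vectors `(φ, 1)`. -/
theorem IsGivenBy.isTrivial_iff {E : Extension.{u} (modV α' β' Δ') (modV α β Δ)}
    (hE : IsGivenBy E f k) : E.IsTrivial ↔
      ∃ φ : ℂ[X], f = trivialF α Δ α' Δ' φ ∧ k = trivialK β β' φ := by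
  constructor
  · intro h
    obtain ⟨⟨φ, q⟩, hx, hL, hN⟩ := hE.of_equivalent h
    change q = 1 at hx
    subst hx
    -- The lift `(φ, 1)` is `(0, 1)` minus `-φ` in the first summand, hence the sign.
    refine ⟨-φ, ?_, ?_⟩
    · refine sub_eq_zero.mp (eq_zero_of_eval_C _ fun l => ?_)
      have h1 := congrArg Prod.fst (hL l)
      change (lamEval l (((modV α' β' Δ').directSum (modV α β Δ)).act L (φ, (1 : ℂ[X])))).1 =
        X * φ + (α + Δ * l) • φ + f.eval (C l) at h1
      simp only [directSum, LinearMap.mk₂_apply, lamEval_prod] at h1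
      change lamEval l (modAct α' β' Δ' L φ) = _ at h1
      rw [lamEval_modAct] at h1
      simp [L, smul_eq_C_mul] at h1
      rw [trivialF_neg, sub_neg_eq_add, eval_add, eval_trivialF]
      linear_combination -h1
    · refine sub_eq_zero.mp (eq_zero_of_eval_C _ fun l => ?_)
      have h1 := congrArg Prod.fst (hN l)
      change (lamEval l (((modV α' β' Δ').directSum (modV α β Δ)).act N (φ, (1 : ℂ[X])))).1 =
        β • φ + k.eval (C l) at h1
      simp only [directSum, LinearMap.mk₂_apply, lamEval_prod] at h1
      change lamEval l (modAct α' β' Δ' N φ) = _ at h1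
      rw [lamEval_modAct] at h1
      simp [N, smul_eq_C_mul] at h1
      rw [trivialK_neg, sub_neg_eq_add, eval_add, eval_trivialK]
      linear_combination -h1
  · rintro ⟨φ, rfl, rfl⟩
    exact hE.equivalent (split_isGivenBy φ)

theorem split_isTrivial : (Extension.split (modV α' β' Δ') (modV α β Δ)).IsTrivial :=
  ⟨LinearMap.id, ⟨fun _ => rfl, fun _ _ _ => rfl⟩, fun _ => rfl, fun _ => rfl⟩

end HeisenbergVirasoro

/-! ### The listed pairs satisfy the cocycle identities. -/

namespace HeisenbergVirasoro

variable {α β Δ α' β' Δ' : ℂ} {f k : ℂ[X][X]}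

theorem Listed.isCocycle (h : Listed α β Δ Δ' f k) : IsCocycle α β Δ α β Δ' f k := by
  rcases h with ⟨rfl, h⟩ | ⟨hβ, h⟩
  · rcases h with ⟨rfl, c₀, c₁, a₀, -, rfl, rfl⟩ | ⟨hΔ, a₁, -, rfl, rfl⟩ |
      ⟨hΔ, c₂, a₂, -, rfl, rfl⟩ | ⟨rfl, rfl, c₃, a₃, -, rfl, rfl⟩ | ⟨hΔ, -, c₃, -, rfl, rfl⟩ |
      ⟨hΔ, c₅, -, rfl, rfl⟩ | ⟨rfl, rfl, c₆, -, rfl, rfl⟩ | ⟨s, hs, rfl, rfl, c₇, -, rfl, rfl⟩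
    · constructor <;> intro x l m <;> simp [evalEval] <;> ring
    · obtain rfl : Δ = Δ' + 1 := by linear_combination hΔ
      constructor <;> intro x l m <;> simp [evalEval] <;> ring
    · obtain rfl : Δ = Δ' + 2 := by linear_combination hΔ
      constructor <;> intro x l m <;> simp [evalEval] <;> ring
    · constructor <;> intro x l m <;> simp [evalEval] <;> ring
    · obtain rfl : Δ = Δ' + 3 := by linear_combination hΔ
      constructor <;> intro x l m <;> simp [evalEval] <;> ring
    · obtain rfl : Δ = Δ' + 4 := by linear_combination hΔ
      constructor <;> intro x l m <;> simp [evalEval] <;> ring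
    · constructor <;> intro x l m <;> simp [evalEval] <;> ring
    · constructor <;> intro x l m <;> simp [evalEval]
      grind
  · rcases h with ⟨rfl, a₀, c₀, c₁, -, rfl, rfl⟩ | ⟨hΔ, b₂, c₂, -, rfl, rfl⟩ |
      ⟨hΔ, b₂, c₃, -, rfl, rfl⟩
    · constructor <;> intro x l m <;> simp [evalEval] <;> ring
    · obtain rfl : Δ = Δ' + 1 := by linear_combination hΔ
      constructor <;> intro x l m <;> simp [evalEval] <;> ring
    · obtain rfl : Δ = Δ' + 2 := by linear_combination hΔ
      constructor <;> intro x l m <;> simp [evalEval] <;> field_simp <;> ring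

end HeisenbergVirasoro

namespace HeisenbergVirasoro

variable {α β Δ α' β' Δ' : ℂ} {f k : ℂ[X][X]}

/-! ### Comparing coefficients in the cocycle conditions -/

theorem coeff_coeff_swap (P : ℂ[X][X]) (p q : ℕ) :
    ((Bivariate.swap P).coeff q).coeff p = (P.coeff p).coeff q := by
  induction P using Polynomial.induction_on' with
  | add P Q hP hQ => simp [hP, hQ]
  | monomial n g =>
    induction g using Polynomial.induction_on' with
    | add P Q hP hQ => simp only [map_add, coeff_add, hP, hQ]
    | monomial m c =>
      rw [Bivariate.swap_monomial_monomial]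
      simp only [coeff_monomial]
      split_ifs <;> simp_all [coeff_monomial]

/-- `f(x, λ)` as a polynomial in `λ`. -/
noncomputable def atPoint (x : ℂ) (f : ℂ[X][X]) : ℂ[X] := f.map (evalRingHom x)

/-- `f(x + λ, μ)` as a polynomial in `λ` and `μ`. -/
noncomputable def shiftPoint (x : ℂ) (f : ℂ[X][X]) : ℂ[X][X] :=
  f.map (taylorAlgHom x).toRingHom

/-- `f(x, λ + μ)` as a polynomial in `λ` and `μ`. -/
noncomputable def addPoint (x : ℂ) (f : ℂ[X][X]) : ℂ[X][X] :=
  taylor (X : ℂ[X]) ((atPoint x f).map C)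

theorem eval_atPoint (x l : ℂ) (f : ℂ[X][X]) : (atPoint x f).eval l = f.evalEval x l := by
  rw [atPoint, ← map_evalRingHom_eval]

theorem evalEval_shiftPoint (x l m : ℂ) (f : ℂ[X][X]) :
    (shiftPoint x f).evalEval l m = f.evalEval (x + l) m := by
  induction f using Polynomial.induction_on' with
  | add P Q hP hQ =>
    simp only [shiftPoint, Polynomial.map_add, evalEval_add] at *
    rw [hP, hQ]
  | monomial n g => simp [shiftPoint, evalEval, eval_monomial, taylor_eval, add_comm x l]

theorem evalEval_addPoint (x l m : ℂ) (f : ℂ[X][X]) :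
    (addPoint x f).evalEval l m = f.evalEval x (l + m) := by
  rw [← eval_atPoint x, addPoint, evalEval, taylor_eval]
  generalize atPoint x f = h
  induction h using Polynomial.induction_on' with
  | add P Q hP hQ => simp only [Polynomial.map_add, eval_add, hP, hQ]
  | monomial n g => simp [eval_monomial, add_comm l m]

theorem coeff_atPoint (x : ℂ) (f : ℂ[X][X]) (p : ℕ) :
    (atPoint x f).coeff p = (f.coeff p).eval x := by
  simp [atPoint]

theorem coeff_shiftPoint (x : ℂ) (f : ℂ[X][X]) (p q : ℕ) :
    ((shiftPoint x f).coeff q).coeff p = (hasseDeriv p (f.coeff q)).eval x := by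
  simp [shiftPoint, coeff_map, taylor_coeff]

theorem hasseDeriv_map_C (q : ℕ) (h : ℂ[X]) :
    hasseDeriv q (h.map (C : ℂ →+* ℂ[X])) = (hasseDeriv q h).map C := by
  ext1 n
  simp [hasseDeriv_coeff]

theorem coeff_addPoint (x : ℂ) (f : ℂ[X][X]) (p q : ℕ) :
    ((addPoint x f).coeff q).coeff p = ((p + q).choose q : ℂ) * (f.coeff (p + q)).eval x := by
  rw [addPoint, taylor_coeff, hasseDeriv_map_C, eval_map, eval₂_C_X, hasseDeriv_coeff,
    coeff_atPoint]

theorem evalEval_swap (P : ℂ[X][X]) (x y : ℂ) :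
    (Bivariate.swap P).evalEval x y = P.evalEval y x := by
  have := Bivariate.aevalAeval_swap (A := ℂ) x y P
  rwa [coe_aevalAeval_eq_evalEval, coe_aevalAeval_eq_evalEval] at this

/-- The condition on `f` in the definition of a cocycle, for `α = α' = 0`. -/
def IsVirasoroCocycle (Δ Δ' : ℂ) (f : ℂ[X][X]) : Prop :=
  ∀ x l m : ℂ, (x + l + Δ * m) * f.evalEval x l + (x + Δ' * l) * f.evalEval (x + l) m -
    (x + m + Δ * l) * f.evalEval x m - (x + Δ' * m) * f.evalEval (x + m) l =
      (l - m) * f.evalEval x (l + m)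

/-- Here `∂` is frozen at `x`, and in `ℂ[X][X]` the inner variable is now `λ` and the outer one `μ`.
-/
theorem IsVirasoroCocycle.eq_zero (h : IsVirasoroCocycle Δ Δ' f) (x : ℂ) :
    C (C x + X) * C (atPoint x f) + C (C Δ) * (X * C (atPoint x f)) +
      C (C x) * shiftPoint x f + C (C Δ') * (C X * shiftPoint x f) -
      (C (C x) * (atPoint x f).map C + X * (atPoint x f).map C +
        C (C Δ) * (C X * (atPoint x f).map C)) -
      (C (C x) * Bivariate.swap (shiftPoint x f) +
        C (C Δ') * (X * Bivariate.swap (shiftPoint x f))) -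
      (C X * addPoint x f - X * addPoint x f) = 0 := by
  refine ext_evalEval fun l m => ?_
  simp only [evalEval_add, evalEval_sub, evalEval_mul, evalEval_C, evalEval_map_C, evalEval_X,
    eval_atPoint, evalEval_shiftPoint, evalEval_addPoint, evalEval_swap, evalEval_zero,
    eval_add, eval_C, eval_X]
  linear_combination h x l m

/-- The coefficient of `λ ^ (p + 1) μ ^ (q + 1)`, with `∂` free again. Hasse derivatives come from
the Taylor expansion of `f(∂ + λ, μ)`, and the binomial coefficients from `(λ - μ)(λ + μ) ^ (p + q +
1)`. -/
theorem IsVirasoroCocycle.coeff_succ_succ (h : IsVirasoroCocycle Δ Δ' f) (p q : ℕ) :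
    (if q = 0 then C Δ * f.coeff (p + 1) else 0) + X * hasseDeriv (p + 1) (f.coeff (q + 1)) +
      C Δ' * hasseDeriv p (f.coeff (q + 1)) - (if p = 0 then C Δ * f.coeff (q + 1) else 0) -
      X * hasseDeriv (q + 1) (f.coeff (p + 1)) - C Δ' * hasseDeriv q (f.coeff (p + 1)) =
    C (((p + q + 1).choose (q + 1) : ℂ) - ((p + q + 1).choose q : ℂ)) * f.coeff (p + q + 1) := by
  refine Polynomial.funext fun x => ?_
  have := congrArg (fun P => coeff (coeff P (q + 1)) (p + 1)) (h.eq_zero x)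
  have e1 : p + (q + 1) = p + q + 1 := by ring
  have e2 : p + 1 + q = p + q + 1 := by ring
  simp only [coeff_add, coeff_sub, coeff_C_mul, coeff_X_mul, coeff_zero, coeff_C_succ, coeff_C,
    coeff_map, mul_zero, coeff_shiftPoint, coeff_coeff_swap, coeff_addPoint, e1, e2] at this
  simp only [eval_add, eval_sub, eval_mul, eval_C, eval_X]
  rcases eq_or_ne p 0 with rfl | hp <;> rcases eq_or_ne q 0 with rfl | hq <;>
    simp_all [coeff_atPoint] <;> linear_combination this

/-- At `μ = 0` all terms with `f(∂, λ)` cancel, and a condition on `f(∂, 0)` alone is left. -/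
theorem IsVirasoroCocycle.coeff_succ_zero (h : IsVirasoroCocycle Δ Δ' f) (p : ℕ) :
    X * hasseDeriv (p + 1) (f.coeff 0) + C Δ' * hasseDeriv p (f.coeff 0) =
      if p = 0 then C Δ * f.coeff 0 else 0 := by
  refine Polynomial.funext fun x => ?_
  have := congrArg (fun P => coeff (coeff P 0) (p + 1)) (h.eq_zero x)
  simp only [coeff_add, coeff_sub, coeff_C_mul, coeff_X_mul, coeff_zero, coeff_C_zero,
    coeff_map, coeff_shiftPoint, coeff_coeff_swap, coeff_addPoint, mul_coeff_zero,
    coeff_X_zero, zero_mul] at this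
  rcases eq_or_ne p 0 with rfl | hp <;>
    simp_all [coeff_atPoint, coeff_C, add_mul] <;> linear_combination this

/-- The mixed condition in the definition of a cocycle, for `α = α' = 0` and `β = β'`. -/
def IsMixedCocycle (β Δ Δ' : ℂ) (f k : ℂ[X][X]) : Prop :=
  ∀ x l m : ℂ, β * f.evalEval x l + (x + Δ' * l) * k.evalEval (x + l) m -
    (x + m + Δ * l) * k.evalEval x m - β * f.evalEval (x + m) l = -m * k.evalEval x (l + m)

theorem IsMixedCocycle.eq_zero (h : IsMixedCocycle β Δ Δ' f k) (x : ℂ) :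
    C (C β) * C (atPoint x f) + C (C x) * shiftPoint x k + C (C Δ') * (C X * shiftPoint x k) -
      (C (C x) * (atPoint x k).map C + X * (atPoint x k).map C +
        C (C Δ) * (C X * (atPoint x k).map C)) -
      C (C β) * Bivariate.swap (shiftPoint x f) + X * addPoint x k = 0 := by
  refine ext_evalEval fun l m => ?_
  simp only [evalEval_add, evalEval_sub, evalEval_mul, evalEval_C, evalEval_map_C, evalEval_X,
    eval_atPoint, evalEval_shiftPoint, evalEval_addPoint, evalEval_swap, evalEval_zero,
    eval_C, eval_X]
  linear_combination h x l m

theorem IsMixedCocycle.coeff_succ_succ (h : IsMixedCocycle β Δ Δ' f k) (p q : ℕ) :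
    X * hasseDeriv (p + 1) (k.coeff (q + 1)) + C Δ' * hasseDeriv p (k.coeff (q + 1)) -
      (if p = 0 then C Δ * k.coeff (q + 1) else 0) -
      C β * hasseDeriv (q + 1) (f.coeff (p + 1)) =
    -C ((p + q + 1).choose q : ℂ) * k.coeff (p + q + 1) := by
  refine Polynomial.funext fun x => ?_
  have := congrArg (fun P => coeff (coeff P (q + 1)) (p + 1)) (h.eq_zero x)
  have e2 : p + 1 + q = p + q + 1 := by ring
  simp only [coeff_add, coeff_sub, coeff_C_mul, coeff_X_mul, coeff_zero, coeff_C_succ, coeff_C,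
    coeff_map, mul_zero, coeff_shiftPoint, coeff_coeff_swap, coeff_addPoint, e2] at this
  rcases eq_or_ne p 0 with rfl | hp <;>
    simp_all [coeff_atPoint] <;> linear_combination this

/-- At `λ = 0` the terms in `k` cancel; what is left is `β f(∂, 0) = β f(∂ + μ, 0)`. -/
theorem IsMixedCocycle.coeff_zero_succ (h : IsMixedCocycle β Δ Δ' f k) (q : ℕ) :
    C β * hasseDeriv (q + 1) (f.coeff 0) = 0 := by
  refine Polynomial.funext fun x => ?_
  have := congrArg (fun P => coeff (coeff P (q + 1)) 0) (h.eq_zero x)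
  simp only [coeff_add, coeff_sub, coeff_C_mul, coeff_X_mul, coeff_zero, coeff_C_succ, coeff_C_zero,
    coeff_map, mul_zero, coeff_shiftPoint, coeff_coeff_swap, coeff_addPoint, mul_coeff_zero,
    coeff_X_zero, zero_mul] at this
  simp only [eval_mul, eval_C, eval_zero]
  simp [coeff_atPoint] at this
  linear_combination -this

theorem IsMixedCocycle.coeff_succ_zero (h : IsMixedCocycle β Δ Δ' f k) (p : ℕ) :
    X * hasseDeriv (p + 1) (k.coeff 0) + C Δ' * hasseDeriv p (k.coeff 0) =
      if p = 0 then C Δ * k.coeff 0 else 0 := by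
  refine Polynomial.funext fun x => ?_
  have := congrArg (fun P => coeff (coeff P 0) (p + 1)) (h.eq_zero x)
  simp only [coeff_add, coeff_sub, coeff_C_mul, coeff_X_mul, coeff_zero, coeff_C_zero,
    coeff_map, coeff_shiftPoint, coeff_coeff_swap, mul_coeff_zero,
    coeff_X_zero, zero_mul] at this
  rcases eq_or_ne p 0 with rfl | hp <;>
    simp_all [coeff_atPoint, coeff_C] <;> linear_combination this

/-- The symmetry condition in the definition of a cocycle, for `β = β' ≠ 0`. -/
def IsSymmetricCocycle (k : ℂ[X][X]) : Prop :=
  ∀ x l m : ℂ, k.evalEval x l + k.evalEval (x + l) m = k.evalEval x m + k.evalEval (x + m) l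

theorem IsSymmetricCocycle.eq_zero (h : IsSymmetricCocycle k) (x : ℂ) :
    C (atPoint x k) + shiftPoint x k - (atPoint x k).map C - Bivariate.swap (shiftPoint x k) =
      0 := by
  refine ext_evalEval fun l m => ?_
  simp only [evalEval_add, evalEval_sub, evalEval_C, evalEval_map_C,
    eval_atPoint, evalEval_shiftPoint, evalEval_swap, evalEval_zero]
  linear_combination h x l m

theorem IsSymmetricCocycle.coeff_succ_succ (h : IsSymmetricCocycle k) (p q : ℕ) :
    hasseDeriv (p + 1) (k.coeff (q + 1)) = hasseDeriv (q + 1) (k.coeff (p + 1)) := by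
  refine Polynomial.funext fun x => ?_
  have := congrArg (fun P => coeff (coeff P (q + 1)) (p + 1)) (h.eq_zero x)
  simp [coeff_shiftPoint, coeff_coeff_swap] at this
  linear_combination this

theorem IsSymmetricCocycle.coeff_succ_zero (h : IsSymmetricCocycle k) (p : ℕ) :
    hasseDeriv (p + 1) (k.coeff 0) = 0 := by
  refine Polynomial.funext fun x => ?_
  have := congrArg (fun P => coeff (coeff P 0) (p + 1)) (h.eq_zero x)
  simp [coeff_C, coeff_shiftPoint, coeff_coeff_swap, coeff_atPoint] at this
  rw [this, eval_zero]

end HeisenbergVirasoro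

namespace HeisenbergVirasoro

variable {α β Δ α' β' Δ' : ℂ} {f k : ℂ[X][X]}

/-! ### Coefficients of trivial pairs -/

theorem coeff_aeval_CX_add_X (φ : ℂ[X]) (p : ℕ) :
    (aeval (C X + lam : ℂ[X][X]) φ).coeff p = hasseDeriv p φ := by
  have h : aeval (C X + lam : ℂ[X][X]) φ = taylor X (φ.map C) := by
    rw [taylor_apply, comp, eval₂_map, aeval_def, add_comm]
    rfl
  rw [h, taylor_coeff, hasseDeriv_map_C, eval_map, eval₂_C_X]

theorem coeff_trivialF_zero (φ : ℂ[X]) : (trivialF 0 Δ 0 Δ' φ).coeff 0 = 0 := by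
  simp [trivialF, mul_coeff_zero, coeff_aeval_CX_add_X, -map_add]

theorem coeff_trivialF_succ (φ : ℂ[X]) (p : ℕ) : (trivialF 0 Δ 0 Δ' φ).coeff (p + 1) =
    (if p = 0 then C Δ * φ else 0) - X * hasseDeriv (p + 1) φ - C Δ' * hasseDeriv p φ := by
  have e : trivialF 0 Δ 0 Δ' φ = C (X * φ) + C (C Δ) * (X * C φ) -
      C X * aeval (C X + lam : ℂ[X][X]) φ - C (C Δ') * (X * aeval (C X + lam : ℂ[X][X]) φ) := by
    have z : scal 0 = 0 := by simp
    rw [trivialF, z]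
    simp; ring
  rw [e]
  simp only [coeff_sub, coeff_add, coeff_C_succ, coeff_C_mul, coeff_X_mul, coeff_aeval_CX_add_X,
    coeff_C]
  split_ifs <;> ring

theorem coeff_trivialK (φ : ℂ[X]) (p : ℕ) : (trivialK β β φ).coeff p =
    (if p = 0 then C β * φ else 0) - C β * hasseDeriv p φ := by
  rw [trivialK, coeff_sub, coeff_C_mul, coeff_C_mul, coeff_aeval_CX_add_X, coeff_C]
  split_ifs <;> simp

theorem hasseDeriv_C_mul_X_pow (a : ℂ) (m p : ℕ) :
    hasseDeriv p (C a * X ^ m) = C (m.choose p * a) * X ^ (m - p) := by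
  simp only [C_mul_X_pow_eq_monomial, hasseDeriv_monomial]

/-! ### Homogeneity -/

/-- If the coefficient of `∂ ^ i λ` in a Virasoro cocycle vanishes for `i ≠ Δ - Δ'`, the cocycle is
homogeneous of degree `Δ - Δ' + 1` up to its value at `λ = 0`. -/
theorem IsVirasoroCocycle.homogeneous (h : IsVirasoroCocycle Δ Δ' f)
    (h1 : ∀ i : ℕ, (Δ - Δ' - i) * (f.coeff 1).coeff i = 0) (p i : ℕ) :
    (Δ - Δ' - p - i) * (f.coeff (p + 1)).coeff i = 0 := by
  rcases eq_or_ne p 0 with rfl | hp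
  · simpa using h1 i
  -- The coefficient of `λ ^ (p + 1) μ` is an Euler identity for the coefficient of `f` at `λ ^ (p +
  -- 1)`, with an error term involving only the coefficient of `∂ ^ (i + p) λ`.
  have h2 := congrArg (fun P => P.coeff i) (h.coeff_succ_succ p 0)
  by_cases hi : Δ - Δ' - p - i = 0
  · rw [hi, zero_mul]
  have h3 : (f.coeff 1).coeff (i + p) = 0 := by
    refine (mul_eq_zero.mp (h1 (i + p))).resolve_left fun h0 => hi ?_
    push_cast at h0
    linear_combination h0
  have h4 : (X * hasseDeriv (p + 1) (f.coeff 1)).coeff i = 0 := by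
    cases i with
    | zero => simp [mul_coeff_zero]
    | succ i => rw [coeff_X_mul, hasseDeriv_coeff, ← add_assoc, add_right_comm, h3, mul_zero]
  have h5 : (X * hasseDeriv 1 (f.coeff (p + 1))).coeff i = i * (f.coeff (p + 1)).coeff i := by
    cases i with
    | zero => simp [mul_coeff_zero]
    | succ i => rw [coeff_X_mul, hasseDeriv_coeff]; simp
  simp only [if_true, hp, if_false, coeff_sub, coeff_add, coeff_C_mul, zero_add, h4, h5,
    hasseDeriv_coeff, h3, mul_zero, coeff_zero, add_zero, Nat.choose_zero_right,
    Nat.choose_one_right, Nat.cast_one, one_mul] at h2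
  push_cast at h2
  linear_combination h2

theorem IsVirasoroCocycle.homogeneous_zero (h : IsVirasoroCocycle Δ Δ' f) (i : ℕ) :
    (Δ - Δ' - i) * (f.coeff 0).coeff i = 0 := by
  have h2 := congrArg (fun P => P.coeff i) (h.coeff_succ_zero 0)
  cases i with
  | zero =>
    simp [mul_coeff_zero] at h2 ⊢
    grind
  | succ i =>
    simp [coeff_X_mul, coeff_derivative] at h2 ⊢
    grind

theorem IsMixedCocycle.homogeneous (h : IsMixedCocycle β Δ Δ' f k)
    (h1 : ∀ i : ℕ, (Δ - Δ' - i) * (f.coeff 1).coeff i = 0) (p i : ℕ) :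
    (Δ - Δ' - p - i) * (k.coeff p).coeff i = 0 := by
  cases p with
  | zero =>
    have h2 := congrArg (fun P => P.coeff i) (h.coeff_succ_zero 0)
    cases i with
    | zero =>
      simp [mul_coeff_zero] at h2 ⊢
      grind
    | succ i =>
      simp [coeff_X_mul, coeff_derivative] at h2 ⊢
      grind
  | succ p =>
    have h2 := congrArg (fun P => P.coeff i) (h.coeff_succ_succ 0 p)
    by_cases hi : Δ - Δ' - (p + 1 : ℕ) - i = 0
    · rw [hi, zero_mul]
    have h3 : (f.coeff 1).coeff (i + (p + 1)) = 0 := by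
      refine (mul_eq_zero.mp (h1 (i + (p + 1)))).resolve_left fun h0 => hi ?_
      push_cast at h0 ⊢
      linear_combination h0
    have h5 : (X * hasseDeriv 1 (k.coeff (p + 1))).coeff i = i * (k.coeff (p + 1)).coeff i := by
      cases i with
      | zero => simp [mul_coeff_zero]
      | succ i => rw [coeff_X_mul, hasseDeriv_coeff]; simp
    have e : ((p + 1).choose p : ℂ) = p + 1 := by
      rw [Nat.choose_succ_self_right]; simp
    simp only [zero_add, coeff_sub, coeff_add, coeff_C_mul, if_true, h5, hasseDeriv_zero',
      hasseDeriv_coeff, h3, mul_zero, ← C_neg, e] at h2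
    push_cast
    linear_combination -h2

/-- Evaluation at `1` reads off the coefficient of a monomial whatever its exponent; this is why
`lead` evaluates there. -/
theorem eq_C_mul_X_pow_of_coeff {g : ℂ[X]} {m : ℕ} (h : ∀ i, i ≠ m → g.coeff i = 0) :
    g = C (g.eval 1) * X ^ m := by
  have h1 : g = C (g.coeff m) * X ^ m := by
    ext i
    rw [coeff_C_mul_X_pow]
    split_ifs with hi
    · rw [hi]
    · exact h i hi
  have h2 : g.eval 1 = g.coeff m := by
    conv_lhs => rw [h1]
    simp
  rw [h2]
  exact h1

/-! ### Uniqueness -/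

/-- A Virasoro cocycle is determined by its coefficients at `λ ^ j` with `j ≤ 3`. -/
theorem IsVirasoroCocycle.eq_zero_of_coeff (h : IsVirasoroCocycle Δ Δ' f) (h0 : f.coeff 0 = 0)
    (h1 : f.coeff 1 = 0) (h2 : f.coeff 2 = 0) (h3 : f.coeff 3 = 0) : f = 0 := by
  have key : ∀ p, f.coeff (p + 3) = 0 := by
    intro p
    induction p with
    | zero => exact h3
    | succ p ih =>
      -- The coefficient of `λ ^ (p + 3) μ ^ 2` expresses the coefficient at `λ ^ (p + 4)` through
      -- those at `λ ^ 2` and `λ ^ (p + 3)`, with the nonzero factor `(p + 4)(p + 1) / 2`.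
      have e := h.coeff_succ_succ (p + 2) 1
      have e1 : p + 2 + 1 + 1 = p + 1 + 3 := by ring
      have e2 : p + 2 + 1 = p + 3 := by ring
      simp only [h2, e1, e2, ih, map_zero] at e
      have e3 : (0 : ℂ[X]) = C ((((p + 1 + 3).choose (1 + 1) : ℕ) : ℂ) -
          (((p + 1 + 3).choose 1 : ℕ) : ℂ)) * f.coeff (p + 1 + 3) := by
        simpa using e
      refine (mul_eq_zero.mp e3.symm).resolve_left fun h0 => ?_
      rw [C_eq_zero, one_add_one_eq_two, Nat.cast_choose_two, Nat.choose_one_right] at h0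
      push_cast at h0
      have h1 : ((p : ℂ) + 4) * (p + 1) = 0 := by linear_combination 2 * h0
      norm_cast at h1
  ext1 j
  rcases j with _ | _ | _ | j
  · exact h0
  · exact h1
  · exact h2
  · exact key j

/-- For `β = 0` the part `k` of a cocycle is determined by its coefficients at `1` and `λ`. -/
theorem IsMixedCocycle.eq_zero_of_coeff (h : IsMixedCocycle 0 Δ Δ' f k) (h0 : k.coeff 0 = 0)
    (h1 : k.coeff 1 = 0) : k = 0 := by
  have key : ∀ p, k.coeff (p + 1) = 0 := by
    intro p
    induction p with
    | zero => exact h1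
    | succ p ih =>
      -- For `β = 0` the coefficient of `λ ^ 2 μ ^ (p + 1)` gives the next coefficient of `k` from
      -- the previous one.
      have e := h.coeff_succ_succ 1 p
      have e1 : 1 + p + 1 = p + 1 + 1 := by ring
      simp only [ih, e1, map_zero] at e
      simp at e
      refine e.resolve_left ?_
      exact Nat.cast_ne_zero.mpr (Nat.choose_pos (by omega)).ne'
  ext1 j
  rcases j with _ | j
  · exact h0
  · exact key j

end HeisenbergVirasoro

namespace HeisenbergVirasoro

variable {α β Δ α' β' Δ' : ℂ} {f k : ℂ[X][X]}

/-! ### Binomial coefficients as polynomials -/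

theorem cast_choose_succ (m k : ℕ) :
    (m.choose (k + 1) : ℂ) = m.choose k * (m - k) / (k + 1) := by
  have hk : (k + 1 : ℂ) ≠ 0 := by norm_cast
  rw [eq_div_iff hk]
  have := Nat.choose_succ_right_eq m k
  rcases le_or_gt k m with h | h
  · rw [← Nat.cast_sub h]
    exact_mod_cast this
  · rw [Nat.choose_eq_zero_of_lt h, Nat.choose_eq_zero_of_lt (by omega)]
    simp

theorem cast_choose_three (m : ℕ) : (m.choose 3 : ℂ) = m * (m - 1) * (m - 2) / 6 := by
  rw [cast_choose_succ, Nat.cast_choose_two]; push_cast; ring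

theorem cast_choose_four (m : ℕ) : (m.choose 4 : ℂ) = m * (m - 1) * (m - 2) * (m - 3) / 24 := by
  rw [cast_choose_succ, cast_choose_three]; push_cast; ring

theorem cast_choose_five (m : ℕ) :
    (m.choose 5 : ℂ) = m * (m - 1) * (m - 2) * (m - 3) * (m - 4) / 120 := by
  rw [cast_choose_succ, cast_choose_four]; push_cast; ring

theorem cast_choose_six (m : ℕ) :
    (m.choose 6 : ℂ) = m * (m - 1) * (m - 2) * (m - 3) * (m - 4) * (m - 5) / 720 := by
  rw [cast_choose_succ, cast_choose_five]; push_cast; ring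

theorem cast_choose_seven (m : ℕ) :
    (m.choose 7 : ℂ) =
      m * (m - 1) * (m - 2) * (m - 3) * (m - 4) * (m - 5) * (m - 6) / 5040 := by
  rw [cast_choose_succ, cast_choose_six]; push_cast; ring

/-! ### Homogeneous cocycles of degree `n = Δ - Δ'` -/

/-- The value of the coefficient at `λ ^ j` at `∂ = 1`. -/
noncomputable def lead (f : ℂ[X][X]) (j : ℕ) : ℂ := (f.coeff j).eval 1

variable {n : ℕ}

theorem IsVirasoroCocycle.coeff_succ_eq (h : IsVirasoroCocycle Δ Δ' f) (hn : Δ - Δ' = n)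
    (h1 : ∀ i : ℕ, (Δ - Δ' - i) * (f.coeff 1).coeff i = 0) {p : ℕ} (hp : p ≤ n) :
    f.coeff (p + 1) = C (lead f (p + 1)) * X ^ (n - p) := by
  refine eq_C_mul_X_pow_of_coeff fun i hi => ?_
  refine (mul_eq_zero.mp (h.homogeneous h1 p i)).resolve_left fun h0 => hi ?_
  rw [hn, sub_sub, sub_eq_zero] at h0
  norm_cast at h0
  omega

theorem IsVirasoroCocycle.coeff_succ_eq_zero (h : IsVirasoroCocycle Δ Δ' f) (hn : Δ - Δ' = n)
    (h1 : ∀ i : ℕ, (Δ - Δ' - i) * (f.coeff 1).coeff i = 0) {p : ℕ} (hp : n < p) :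
    f.coeff (p + 1) = 0 := by
  ext1 i
  refine (mul_eq_zero.mp (h.homogeneous h1 p i)).resolve_left fun h0 => ?_
  rw [hn, sub_sub, sub_eq_zero] at h0
  norm_cast at h0
  omega

theorem IsVirasoroCocycle.coeff_zero_eq (h : IsVirasoroCocycle Δ Δ' f) (hn : Δ - Δ' = n) :
    f.coeff 0 = C (lead f 0) * X ^ n := by
  refine eq_C_mul_X_pow_of_coeff fun i hi => ?_
  refine (mul_eq_zero.mp (h.homogeneous_zero i)).resolve_left fun h0 => hi ?_
  rw [hn, sub_eq_zero] at h0
  norm_cast at h0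
  omega

theorem IsMixedCocycle.coeff_eq (h : IsMixedCocycle β Δ Δ' f k) (hn : Δ - Δ' = n)
    (h1 : ∀ i : ℕ, (Δ - Δ' - i) * (f.coeff 1).coeff i = 0) {p : ℕ} (hp : p ≤ n) :
    k.coeff p = C (lead k p) * X ^ (n - p) := by
  refine eq_C_mul_X_pow_of_coeff fun i hi => ?_
  refine (mul_eq_zero.mp (h.homogeneous h1 p i)).resolve_left fun h0 => hi ?_
  rw [hn, sub_sub, sub_eq_zero] at h0
  norm_cast at h0
  omega

theorem IsMixedCocycle.coeff_eq_zero (h : IsMixedCocycle β Δ Δ' f k) (hn : Δ - Δ' = n)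
    (h1 : ∀ i : ℕ, (Δ - Δ' - i) * (f.coeff 1).coeff i = 0) {p : ℕ} (hp : n < p) :
    k.coeff p = 0 := by
  ext1 i
  refine (mul_eq_zero.mp (h.homogeneous h1 p i)).resolve_left fun h0 => ?_
  rw [hn, sub_sub, sub_eq_zero] at h0
  norm_cast at h0
  omega

/-- No bound on `q` is needed: where the subtraction `n - q` is truncated, the leading coefficient
is zero. -/
theorem eval_one_hasseDeriv_coeff_succ (h : IsVirasoroCocycle Δ Δ' f) (hn : Δ - Δ' = n)
    (h1 : ∀ i : ℕ, (Δ - Δ' - i) * (f.coeff 1).coeff i = 0) (p q : ℕ) :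
    (hasseDeriv p (f.coeff (q + 1))).eval 1 = (n - q).choose p * lead f (q + 1) := by
  rcases le_or_gt q n with hq | hq
  · rw [h.coeff_succ_eq hn h1 hq, hasseDeriv_C_mul_X_pow]; simp
  · rw [lead, h.coeff_succ_eq_zero hn h1 hq]; simp

theorem IsMixedCocycle.eval_one_hasseDeriv_coeff (h : IsMixedCocycle β Δ Δ' f k) (hn : Δ - Δ' = n)
    (h1 : ∀ i : ℕ, (Δ - Δ' - i) * (f.coeff 1).coeff i = 0) (p q : ℕ) :
    (hasseDeriv p (k.coeff q)).eval 1 = (n - q).choose p * lead k q := by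
  rcases le_or_gt q n with hq | hq
  · rw [h.coeff_eq hn h1 hq, hasseDeriv_C_mul_X_pow]; simp
  · rw [lead, h.coeff_eq_zero hn h1 hq]; simp

theorem IsVirasoroCocycle.lead_eq (h : IsVirasoroCocycle Δ Δ' f) (hn : Δ - Δ' = n)
    (h1 : ∀ i : ℕ, (Δ - Δ' - i) * (f.coeff 1).coeff i = 0) (p q : ℕ) :
    lead f (q + 2) * ((n - (q + 1)).choose (p + 2) + Δ' * (n - (q + 1)).choose (p + 1)) -
      lead f (p + 2) * ((n - (p + 1)).choose (q + 2) + Δ' * (n - (p + 1)).choose (q + 1)) =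
    ((p + q + 3).choose (q + 2) - (p + q + 3).choose (q + 1)) * lead f (p + q + 3) := by
  have e := congrArg (eval 1) (h.coeff_succ_succ (p + 1) (q + 1))
  have e1 : p + 1 + (q + 1) + 1 = p + q + 3 := by ring
  simp only [Nat.succ_ne_zero, if_false, e1, eval_add, eval_sub, eval_mul, eval_C, eval_X,
    eval_zero, eval_one_hasseDeriv_coeff_succ h hn h1] at e
  change _ = _ * lead f (p + q + 3) at e
  linear_combination e

theorem IsMixedCocycle.lead_eq (h : IsMixedCocycle 0 Δ Δ' f k) (hn : Δ - Δ' = n)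
    (h1 : ∀ i : ℕ, (Δ - Δ' - i) * (f.coeff 1).coeff i = 0) (p q : ℕ) :
    lead k (q + 1) * ((n - (q + 1)).choose (p + 2) + Δ' * (n - (q + 1)).choose (p + 1)) =
      -((p + q + 2).choose q * lead k (p + q + 2)) := by
  have e := congrArg (eval 1) (h.coeff_succ_succ (p + 1) q)
  have e1 : p + 1 + q + 1 = p + q + 2 := by ring
  simp only [Nat.succ_ne_zero, if_false, e1, eval_add, eval_sub, eval_mul, eval_C, eval_X,
    eval_zero, h.eval_one_hasseDeriv_coeff hn h1, map_zero, zero_mul, eval_neg] at e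
  change _ = _ * lead k (p + q + 2) at e
  linear_combination e

/-! ### Vanishing of the lowest coefficients -/

theorem IsVirasoroCocycle.coeff_zero_eq_zero (h : IsVirasoroCocycle Δ Δ' f) (hn : Δ - Δ' = n)
    (hn0 : n ≠ 0) (h' : Δ' ≠ 0 ∨ 2 ≤ n) : f.coeff 0 = 0 := by
  have h0 := h.coeff_zero_eq hn
  suffices lead f 0 = 0 by rw [h0, this]; simp
  have e : Δ' * lead f 0 = 0 := by
    -- In the coefficient of `λ ^ (n + 1)` the Hasse derivative of order `n + 1` kills `∂ ^ n` and
    -- the one of order `n` leaves a constant.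
    have := congrArg (eval 1) (h.coeff_succ_zero n)
    rw [h0, hasseDeriv_C_mul_X_pow, hasseDeriv_C_mul_X_pow] at this
    simpa [hn0] using this
  by_contra hl
  have hΔ : Δ' = 0 := (mul_eq_zero.mp e).resolve_right hl
  obtain ⟨m, rfl⟩ := Nat.exists_eq_add_of_le' (h'.resolve_left (not_not.mpr hΔ))
  -- If `Δ' = 0`, the coefficient of `λ ^ n` is used instead; `n ≥ 2` makes its right side zero.
  have := congrArg (eval 1) (h.coeff_succ_zero (m + 1))
  rw [h0, hasseDeriv_C_mul_X_pow, hasseDeriv_C_mul_X_pow, hΔ] at this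
  simp at this
  exact hl this

theorem IsVirasoroCocycle.coeff_one_eq_zero (h : IsVirasoroCocycle Δ Δ' f) (hn : Δ - Δ' = n)
    (h1 : ∀ i : ℕ, (Δ - Δ' - i) * (f.coeff 1).coeff i = 0)
    (hn0 : n ≠ 0) (h' : Δ' ≠ 0 ∨ 2 ≤ n) : f.coeff 1 = 0 := by
  have h0 := h.coeff_succ_eq hn h1 (Nat.zero_le n)
  suffices lead f 1 = 0 by rw [h0, this]; simp
  have e : Δ' * lead f 1 = 0 := by
    -- In the coefficient of `λ ^ (n + 1) μ` the terms in `lead f (n + 1)` cancel because `Δ - Δ' =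
    -- n`. For `Δ' = 0` the coefficient of `λ ^ n μ` plays the same role below.
    have := congrArg (eval 1) (h.coeff_succ_succ n 0)
    simp only [eval_one_hasseDeriv_coeff_succ h hn h1, eval_add, eval_sub, eval_mul, eval_C,
      eval_X, if_true, hn0, if_false, eval_zero] at this
    simp at this
    change Δ * lead f (n + 1) + _ - _ = n * lead f (n + 1) at this
    linear_combination this - lead f (n + 1) * hn
  by_contra hl
  have hΔ : Δ' = 0 := (mul_eq_zero.mp e).resolve_right hl
  obtain ⟨m, rfl⟩ := Nat.exists_eq_add_of_le' (h'.resolve_left (not_not.mpr hΔ))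
  have := congrArg (eval 1) (h.coeff_succ_succ (m + 1) 0)
  simp only [eval_one_hasseDeriv_coeff_succ h hn h1, eval_add, eval_sub, eval_mul, eval_C,
    eval_X, if_true, eval_zero, Nat.succ_ne_zero, if_false, hΔ] at this
  rw [hΔ] at hn
  change Δ * lead f (m + 2) + _ + _ - _ - 1 * (_ * lead f (m + 2)) - _ = _ * lead f (m + 2) at this
  simp [show m + 2 - (m + 1) = 1 by omega] at this
  push_cast at hn
  apply hl
  linear_combination this - lead f (m + 2) * hn

theorem IsMixedCocycle.coeff_zero_eq_zero (h : IsMixedCocycle β Δ Δ' f k) (hn : Δ - Δ' = n)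
    (h1 : ∀ i : ℕ, (Δ - Δ' - i) * (f.coeff 1).coeff i = 0)
    (hn0 : n ≠ 0) (h' : Δ' ≠ 0) : k.coeff 0 = 0 := by
  have h0 := h.coeff_eq hn h1 (Nat.zero_le n)
  suffices lead k 0 = 0 by rw [h0, this]; simp
  have := congrArg (eval 1) (h.coeff_succ_zero n)
  rw [h0, hasseDeriv_C_mul_X_pow, hasseDeriv_C_mul_X_pow] at this
  simpa [hn0, h'] using this

/-! ### Elimination -/

theorem eq_div_of_eq_mul {a c u : ℂ} (h : u = c * a) (hc : c ≠ 0) : a = u / c := by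
  rw [h, mul_div_cancel_left₀ _ hc]

theorem eq_neg_div_of_eq_neg_mul {a c u : ℂ} (h : u = -(c * a)) (hc : c ≠ 0) : a = -u / c := by
  rw [h, neg_neg, mul_div_cancel_left₀ _ hc]

/-- The coefficients of `λ ^ 3 μ ^ 2`, `λ ^ 4 μ ^ 2`, `λ ^ 5 μ ^ 2` give `a_4, a_5, a_6` in terms of
`a_2, a_3`, and that of `λ ^ 3 μ ^ 4` gives `a_6` again. The difference factors; one factor is the
determinant of `(a_2, a_3)` and the trivial direction `(t_2, t_3)`. -/
theorem elimination_of_five_le (h : IsVirasoroCocycle Δ Δ' f) (hn : Δ - Δ' = n)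
    (h1 : ∀ i : ℕ, (Δ - Δ' - i) * (f.coeff 1).coeff i = 0) (hn5 : 5 ≤ n) :
    (2 * Δ' + n - 1) ^ 2 = 3 * n + 1 ∨
      lead f 2 * (n * (n - 1) * (n - 2) / 6 + n * (n - 1) / 2 * Δ') =
        lead f 3 * (n * (n - 1) / 2 + n * Δ') := by
  have r3 := h.lead_eq hn h1 1 0
  have r4 := h.lead_eq hn h1 2 0
  have r5 := h.lead_eq hn h1 3 0
  have e := h.lead_eq hn h1 1 2
  simp only [zero_add, add_zero, Nat.reduceAdd, cast_choose_three, cast_choose_four,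
    cast_choose_five, Nat.cast_choose_two, Nat.choose_one_right,
    Nat.cast_sub (show 1 ≤ n by omega), Nat.cast_sub (show 2 ≤ n by omega),
    Nat.cast_sub (show 3 ≤ n by omega), Nat.cast_sub (show 4 ≤ n by omega), Nat.cast_one,
    Nat.cast_ofNat] at r3 r4 r5 e
  generalize lead f 2 = a2 at *
  generalize lead f 3 = a3 at *
  generalize lead f 4 = a4 at *
  generalize lead f 5 = a5 at *
  generalize lead f 6 = a6 at *
  generalize Δ' = d at *
  have hp : ((n : ℂ) - 2) * (n - 3) * (n - 4) ≠ 0 := by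
    obtain ⟨N, rfl⟩ := Nat.exists_eq_add_of_le' hn5
    push_cast
    rw [show ((N : ℂ) + 5 - 2) * (N + 5 - 3) * (N + 5 - 4) = ((N + 3) * (N + 2) * (N + 1) : ℕ) by
      push_cast; ring]
    exact Nat.cast_ne_zero.mpr (by positivity)
  generalize (n : ℂ) = x at *
  obtain rfl := eq_div_of_eq_mul r3 (by norm_num)
  obtain rfl := eq_div_of_eq_mul r4 (by norm_num)
  obtain rfl := eq_div_of_eq_mul r5 (by norm_num)
  have key : ((x - 2) * (x - 3) * (x - 4)) * (((2 * d + x - 1) ^ 2 - (3 * x + 1)) *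
      (a2 * (x * (x - 1) * (x - 2) / 6 + x * (x - 1) / 2 * d) -
        a3 * (x * (x - 1) / 2 + x * d))) = 0 := by
    -- The factor `x` is there because `t_2` and `t_3` are both divisible by `n`.
    linear_combination (72 * x) * e
  rcases mul_eq_zero.mp ((mul_eq_zero.mp key).resolve_left hp) with h0 | h0
  · exact Or.inl (sub_eq_zero.mp h0)
  · exact Or.inr (sub_eq_zero.mp h0)

/-- In the exceptional case `(2Δ' + n - 1) ^ 2 = 3n + 1`, the coefficients of `λ ^ 7 μ ^ 2` and `λ ^
3 μ ^ 6` give two expressions for `a_8`. -/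
theorem elimination_of_seven_le (h : IsVirasoroCocycle Δ Δ' f) (hn : Δ - Δ' = n)
    (h1 : ∀ i : ℕ, (Δ - Δ' - i) * (f.coeff 1).coeff i = 0) (hn7 : 7 ≤ n) :
    lead f 2 * (n * (n - 1) * (n - 2) / 6 + n * (n - 1) / 2 * Δ') =
      lead f 3 * (n * (n - 1) / 2 + n * Δ') := by
  rcases elimination_of_five_le h hn h1 (by omega) with hw | h0
  swap
  · exact h0
  have r3 := h.lead_eq hn h1 1 0
  have r4 := h.lead_eq hn h1 2 0
  have r5 := h.lead_eq hn h1 3 0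
  have r6 := h.lead_eq hn h1 4 0
  have r7 := h.lead_eq hn h1 5 0
  have e := h.lead_eq hn h1 1 4
  simp only [zero_add, add_zero, Nat.reduceAdd, cast_choose_three, cast_choose_four,
    cast_choose_five, cast_choose_six, cast_choose_seven, Nat.cast_choose_two,
    Nat.choose_one_right,
    Nat.cast_sub (show 1 ≤ n by omega), Nat.cast_sub (show 2 ≤ n by omega),
    Nat.cast_sub (show 3 ≤ n by omega), Nat.cast_sub (show 4 ≤ n by omega),
    Nat.cast_sub (show 5 ≤ n by omega), Nat.cast_sub (show 6 ≤ n by omega), Nat.cast_one,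
    Nat.cast_ofNat] at r3 r4 r5 r6 r7 e
  generalize lead f 2 = a2 at *
  generalize lead f 3 = a3 at *
  generalize lead f 4 = a4 at *
  generalize lead f 5 = a5 at *
  generalize lead f 6 = a6 at *
  generalize lead f 7 = a7 at *
  generalize lead f 8 = a8 at *
  generalize Δ' = d at *
  have hp : ((n : ℂ) - 2) * (n - 3) * (n - 4) * (n - 5) * (n - 6) * (n * (n - 1)) ≠ 0 := by
    obtain ⟨N, rfl⟩ := Nat.exists_eq_add_of_le' hn7
    push_cast
    rw [show ((N : ℂ) + 7 - 2) * (N + 7 - 3) * (N + 7 - 4) * (N + 7 - 5) * (N + 7 - 6) *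
      ((N + 7) * (N + 7 - 1)) =
        ((N + 5) * (N + 4) * (N + 3) * (N + 2) * (N + 1) * ((N + 7) * (N + 6)) : ℕ) by
      push_cast; ring]
    exact Nat.cast_ne_zero.mpr (by positivity)
  generalize (n : ℂ) = x at *
  obtain rfl := eq_div_of_eq_mul r3 (by norm_num)
  obtain rfl := eq_div_of_eq_mul r4 (by norm_num)
  obtain rfl := eq_div_of_eq_mul r5 (by norm_num)
  obtain rfl := eq_div_of_eq_mul r6 (by norm_num)
  obtain rfl := eq_div_of_eq_mul r7 (by norm_num)
  generalize hwd : 2 * d + x - 1 = w at hw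
  obtain rfl : d = (w - x + 1) / 2 := by linear_combination hwd / 2
  -- Modulo `w ^ 2 = 3x + 1` the quartic cofactor of the determinant collapses to `x(x - 1) /
  -- 14400`, which is nonzero for `n ≥ 7`.
  have hq : -w ^ 4 / 14400 + w ^ 3 / 1440 + (x / 4320 - 17 / 8640) * w ^ 2 +
      (-x / 480 - 1 / 1440) * w + 13 * x / 2160 + 11 / 5400 = x * (x - 1) / 14400 := by
    linear_combination (-(w ^ 2 + 3 * x + 1) / 14400 + w / 1440 + (x / 4320 - 17 / 8640)) * hw
  have key : (x - 2) * (x - 3) * (x - 4) * (x - 5) * (x - 6) *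
      (-w ^ 4 / 14400 + w ^ 3 / 1440 + (x / 4320 - 17 / 8640) * w ^ 2 +
      (-x / 480 - 1 / 1440) * w + 13 * x / 2160 + 11 / 5400) *
      (a2 * (x * (x - 1) * (x - 2) / 6 + x * (x - 1) / 2 * ((w - x + 1) / 2)) -
        a3 * (x * (x - 1) / 2 + x * ((w - x + 1) / 2))) = 0 := by
    linear_combination (-x) * e
  rw [hq] at key
  have key' : ((x - 2) * (x - 3) * (x - 4) * (x - 5) * (x - 6) * (x * (x - 1))) *
      (a2 * (x * (x - 1) * (x - 2) / 6 + x * (x - 1) / 2 * ((w - x + 1) / 2)) -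
        a3 * (x * (x - 1) / 2 + x * ((w - x + 1) / 2))) = 0 := by
    linear_combination 14400 * key
  exact sub_eq_zero.mp ((mul_eq_zero.mp key').resolve_left hp)

/-- The coefficients of `λ ^ 2 μ ^ 2` and `λ ^ 3 μ` both determine `b_3`. -/
theorem IsMixedCocycle.elimination_of_three (h : IsMixedCocycle 0 Δ Δ' f k) (hn : Δ - Δ' = n)
    (h1 : ∀ i : ℕ, (Δ - Δ' - i) * (f.coeff 1).coeff i = 0) (hn3 : 3 ≤ n) :
    lead k 1 = 0 ∨ (2 * Δ' + n - 1) ^ 2 = n + 1 := by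
  have r2 := h.lead_eq hn h1 0 0
  have r3 := h.lead_eq hn h1 0 1
  have e := h.lead_eq hn h1 1 0
  simp only [zero_add, add_zero, Nat.reduceAdd, cast_choose_three,
    Nat.cast_choose_two, Nat.choose_one_right, Nat.choose_zero_right,
    Nat.cast_sub (show 1 ≤ n by omega), Nat.cast_sub (show 2 ≤ n by omega), Nat.cast_one,
    Nat.cast_ofNat] at r2 r3 e
  generalize lead k 1 = b1 at *
  generalize lead k 2 = b2 at *
  generalize lead k 3 = b3 at *
  generalize Δ' = d at *
  have hp : ((n : ℂ) - 1) * (n - 2) ≠ 0 := by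
    obtain ⟨N, rfl⟩ := Nat.exists_eq_add_of_le' hn3
    push_cast
    rw [show ((N : ℂ) + 3 - 1) * (N + 3 - 2) = ((N + 2) * (N + 1) : ℕ) by push_cast; ring]
    exact Nat.cast_ne_zero.mpr (by positivity)
  generalize (n : ℂ) = x at *
  obtain rfl := eq_neg_div_of_eq_neg_mul r2 (by norm_num)
  obtain rfl := eq_neg_div_of_eq_neg_mul r3 (by norm_num)
  have key : ((x - 1) * (x - 2)) * (b1 * ((2 * d + x - 1) ^ 2 - (x + 1))) = 0 := by
    linear_combination 12 * e
  rcases mul_eq_zero.mp ((mul_eq_zero.mp key).resolve_left hp) with h0 | h0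
  · exact Or.inl h0
  · exact Or.inr (sub_eq_zero.mp h0)

/-- The coefficients of `λ ^ 2 μ ^ 3` and `λ ^ 3 μ ^ 2` both determine `b_4`. -/
theorem IsMixedCocycle.elimination_of_four_le (h : IsMixedCocycle 0 Δ Δ' f k) (hn : Δ - Δ' = n)
    (h1 : ∀ i : ℕ, (Δ - Δ' - i) * (f.coeff 1).coeff i = 0) (hn4 : 4 ≤ n) :
    lead k 1 = 0 := by
  rcases h.elimination_of_three hn h1 (by omega) with h0 | hw
  · exact h0
  have r2 := h.lead_eq hn h1 0 0
  have r3 := h.lead_eq hn h1 0 1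
  have r4 := h.lead_eq hn h1 0 2
  have e := h.lead_eq hn h1 1 1
  simp only [zero_add, add_zero, Nat.reduceAdd, cast_choose_three,
    Nat.cast_choose_two, Nat.choose_one_right, Nat.choose_zero_right,
    Nat.cast_sub (show 1 ≤ n by omega), Nat.cast_sub (show 2 ≤ n by omega),
    Nat.cast_sub (show 3 ≤ n by omega), Nat.cast_one, Nat.cast_ofNat] at r2 r3 r4 e
  generalize lead k 1 = b1 at *
  generalize lead k 2 = b2 at *
  generalize lead k 3 = b3 at *
  generalize lead k 4 = b4 at *
  generalize Δ' = d at *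
  have hp : ((n : ℂ) - 1) * (n - 2) * (n - 3) * n * (n + 1) ≠ 0 := by
    obtain ⟨N, rfl⟩ := Nat.exists_eq_add_of_le' hn4
    push_cast
    rw [show ((N : ℂ) + 4 - 1) * (N + 4 - 2) * (N + 4 - 3) * (N + 4) * (N + 4 + 1) =
      ((N + 3) * (N + 2) * (N + 1) * (N + 4) * (N + 5) : ℕ) by push_cast; ring]
    exact Nat.cast_ne_zero.mpr (by positivity)
  generalize (n : ℂ) = x at *
  obtain rfl := eq_neg_div_of_eq_neg_mul r2 (by norm_num)
  obtain rfl := eq_neg_div_of_eq_neg_mul r3 (by norm_num)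
  obtain rfl := eq_neg_div_of_eq_neg_mul r4 (by norm_num)
  generalize hwd : 2 * d + x - 1 = w at hw
  obtain rfl : d = (w - x + 1) / 2 := by linear_combination hwd / 2
  have key : (x - 1) * (x - 2) * (x - 3) * x * w * b1 = 0 := by
    linear_combination 72 * e + (x - 1) * (x - 2) * (x - 3) * (2 * w - 3) * b1 * hw
  -- Multiplication by `w` turns the factor `w` into `w ^ 2 = x + 1`, which is visibly nonzero.
  have key' : (x - 1) * (x - 2) * (x - 3) * x * (x + 1) * b1 = 0 := by
    linear_combination w * key - (x - 1) * (x - 2) * (x - 3) * x * b1 * hw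
  exact (mul_eq_zero.mp key').resolve_left hp

end HeisenbergVirasoro

namespace HeisenbergVirasoro

variable {α β Δ α' β' Δ' : ℂ} {f g k : ℂ[X][X]} {n : ℕ}

/-! ### Virasoro cocycles without terms of degree at most one in `λ` -/

/-- A Virasoro cocycle divisible by `λ ^ 2`. -/
structure IsReduced (Δ Δ' : ℂ) (f : ℂ[X][X]) : Prop where
  cocycle : IsVirasoroCocycle Δ Δ' f
  coeff_zero : f.coeff 0 = 0
  coeff_one : f.coeff 1 = 0

theorem IsReduced.sub (hf : IsReduced Δ Δ' f) (hg : IsReduced Δ Δ' g) :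
    IsReduced Δ Δ' (f - g) where
  cocycle x l m := by
    simp only [evalEval_sub]
    linear_combination hf.cocycle x l m - hg.cocycle x l m
  coeff_zero := by rw [coeff_sub, hf.coeff_zero, hg.coeff_zero, sub_zero]
  coeff_one := by rw [coeff_sub, hf.coeff_one, hg.coeff_one, sub_zero]

theorem IsReduced.add (hf : IsReduced Δ Δ' f) (hg : IsReduced Δ Δ' g) :
    IsReduced Δ Δ' (f + g) where
  cocycle x l m := by
    simp only [evalEval_add]
    linear_combination hf.cocycle x l m + hg.cocycle x l m
  coeff_zero := by rw [coeff_add, hf.coeff_zero, hg.coeff_zero, add_zero]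
  coeff_one := by rw [coeff_add, hf.coeff_one, hg.coeff_one, add_zero]

theorem IsReduced.scal_mul (hf : IsReduced Δ Δ' f) (c : ℂ) : IsReduced Δ Δ' (scal c * f) where
  cocycle x l m := by
    simp only [evalEval_mul, evalEval_C, eval_C]
    linear_combination c * hf.cocycle x l m
  coeff_zero := by rw [coeff_C_mul, hf.coeff_zero, mul_zero]
  coeff_one := by rw [coeff_C_mul, hf.coeff_one, mul_zero]

theorem IsReduced.zero : IsReduced Δ Δ' 0 where
  cocycle x l m := by simp
  coeff_zero := by simp
  coeff_one := by simp

theorem IsReduced.normalized (hf : IsReduced Δ Δ' f) (i : ℕ) :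
    (Δ - Δ' - i) * (f.coeff 1).coeff i = 0 := by
  rw [hf.coeff_one, Polynomial.coeff_zero, mul_zero]

theorem IsReduced.coeff_succ_eq_zero_of_lead (hf : IsReduced Δ Δ' f) (hn : Δ - Δ' = n) {p : ℕ}
    (h : lead f (p + 1) = 0) : f.coeff (p + 1) = 0 := by
  rcases le_or_gt p n with hp | hp
  · rw [hf.cocycle.coeff_succ_eq hn hf.normalized hp, h]; simp
  · exact hf.cocycle.coeff_succ_eq_zero hn hf.normalized hp

theorem lead_sub (f g : ℂ[X][X]) (j : ℕ) : lead (f - g) j = lead f j - lead g j := by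
  simp [lead]

theorem lead_add (f g : ℂ[X][X]) (j : ℕ) : lead (f + g) j = lead f j + lead g j := by
  simp [lead]

theorem lead_scal_mul (c : ℂ) (f : ℂ[X][X]) (j : ℕ) : lead (scal c * f) j = c * lead f j := by
  simp [lead, coeff_C_mul]

/-- Reduced cocycles thus embed into the plane of pairs `(a_2, a_3)`; the rest of the analysis is
linear algebra there. -/
theorem IsReduced.ext_lead (hf : IsReduced Δ Δ' f) (hg : IsReduced Δ Δ' g) (hn : Δ - Δ' = n)
    (h2 : lead f 2 = lead g 2) (h3 : lead f 3 = lead g 3) : f = g := by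
  have h := hf.sub hg
  refine sub_eq_zero.mp (h.cocycle.eq_zero_of_coeff h.coeff_zero h.coeff_one ?_ ?_)
  · exact h.coeff_succ_eq_zero_of_lead hn (by rw [lead_sub, h2, sub_self])
  · exact h.coeff_succ_eq_zero_of_lead hn (by rw [lead_sub, h3, sub_self])

theorem isVirasoroCocycle_trivialF (φ : ℂ[X]) :
    IsVirasoroCocycle Δ Δ' (trivialF 0 Δ 0 Δ' φ) := by
  intro x l m
  have e1 : x + l + m = x + (l + m) := by ring
  have e2 : x + m + l = x + (l + m) := by ring
  simp only [evalEval_trivialF, e1, e2]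
  ring

/-- The coefficient of `∂ ^ i λ` in the trivial cocycle of `φ` is `(n - i) φ_i`, so multiples of `∂
^ n` contribute no term linear in `λ`. -/
theorem isReduced_trivialF (hn : Δ - Δ' = n) (s : ℂ) :
    IsReduced Δ Δ' (trivialF 0 Δ 0 Δ' (C s * X ^ n)) where
  cocycle := isVirasoroCocycle_trivialF _
  coeff_zero := coeff_trivialF_zero _
  coeff_one := by
    rw [coeff_trivialF_succ, zero_add, hasseDeriv_C_mul_X_pow, hasseDeriv_zero']
    obtain rfl : Δ = Δ' + n := by linear_combination hn
    rcases n with _ | n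
    · simp
    · simp; ring

theorem lead_trivialF_two (s : ℂ) :
    lead (trivialF 0 Δ 0 Δ' (C s * X ^ n)) 2 = -s * (n * (n - 1) / 2 + n * Δ') := by
  rw [lead, coeff_trivialF_succ, hasseDeriv_C_mul_X_pow, hasseDeriv_C_mul_X_pow]
  simp [Nat.cast_choose_two]
  ring

theorem lead_trivialF_three (s : ℂ) :
    lead (trivialF 0 Δ 0 Δ' (C s * X ^ n)) 3 =
      -s * (n * (n - 1) * (n - 2) / 6 + n * (n - 1) / 2 * Δ') := by
  rw [lead, coeff_trivialF_succ, hasseDeriv_C_mul_X_pow, hasseDeriv_C_mul_X_pow]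
  simp [Nat.cast_choose_two, cast_choose_three]
  ring

/-- A reduced cocycle with the leading coefficients of a trivial one is trivial. -/
theorem IsReduced.exists_trivial (hf : IsReduced Δ Δ' f) (hn : Δ - Δ' = n)
    (h : lead f 2 * (n * (n - 1) * (n - 2) / 6 + n * (n - 1) / 2 * Δ') =
      lead f 3 * (n * (n - 1) / 2 + n * Δ'))
    (h' : Δ' ≠ 0 ∨ 2 ≤ n) (hn0 : n ≠ 0) :
    ∃ s, f + trivialF 0 Δ 0 Δ' (C s * X ^ n) = 0 := by
  suffices ∃ s : ℂ, lead f 2 = s * (n * (n - 1) / 2 + n * Δ') ∧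
      lead f 3 = s * (n * (n - 1) * (n - 2) / 6 + n * (n - 1) / 2 * Δ') by
    obtain ⟨s, h2, h3⟩ := this
    refine ⟨s, (hf.add (isReduced_trivialF hn s)).ext_lead IsReduced.zero hn ?_ ?_⟩
    · rw [lead_add, lead_trivialF_two, h2]; simp [lead]
    · rw [lead_add, lead_trivialF_three, h3]; simp [lead]
  -- The trivial direction `(t_2, t_3)` is never zero here: if `t_2 = 0`, then `Δ' = -(n - 1) / 2`,
  -- so `n ≥ 2` and `t_3 = -n(n - 1)(n + 1) / 12`.
  by_cases ht : (n * (n - 1) / 2 + n * Δ' : ℂ) = 0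
  · have hn1 : (n : ℂ) ≠ 0 := Nat.cast_ne_zero.mpr hn0
    have hΔ : Δ' = -(n - 1) / 2 := by
      refine mul_left_cancel₀ hn1 ?_
      linear_combination ht
    have hn2 : 2 ≤ n := by
      rcases h' with h' | h'
      · by_contra hlt
        obtain rfl : n = 1 := by omega
        exact h' (by rw [hΔ]; simp)
      · exact h'
    obtain ⟨m, rfl⟩ := Nat.exists_eq_add_of_le' hn2
    have ht3 : ((m + 2 : ℕ) * ((m + 2 : ℕ) - 1) * ((m + 2 : ℕ) - 2) / 6 +
        (m + 2 : ℕ) * ((m + 2 : ℕ) - 1) / 2 * Δ' : ℂ) ≠ 0 := by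
      rw [hΔ]
      push_cast
      have : ((m : ℂ) + 2) * (m + 1) * (m + 3) ≠ 0 := by
        have : ((m + 2) * (m + 1) * (m + 3) : ℕ) ≠ 0 := by positivity
        exact_mod_cast this
      intro h0
      exact this (by linear_combination -12 * h0)
    rw [ht, mul_zero] at h
    refine ⟨_, ?_, (div_mul_cancel₀ (lead f 3) ht3).symm⟩
    rw [ht, mul_zero]
    exact (mul_eq_zero.mp h).resolve_right ht3
  · refine ⟨_, (div_mul_cancel₀ (lead f 2) ht).symm, ?_⟩
    rw [div_mul_eq_mul_div, eq_div_iff ht]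
    linear_combination -h

/-- The leading coefficients of `g` are not proportional to those of a trivial cocycle. -/
def IsTransversal (n : ℕ) (Δ' : ℂ) (g : ℂ[X][X]) : Prop :=
  lead g 2 * (n * (n - 1) * (n - 2) / 6 + n * (n - 1) / 2 * Δ') -
    lead g 3 * (n * (n - 1) / 2 + n * Δ') ≠ 0

theorem IsReduced.exists_eq_scal_mul (hf : IsReduced Δ Δ' f) (hg : IsReduced Δ Δ' g)
    (hn : Δ - Δ' = n) (h : IsTransversal n Δ' g) :
    ∃ s y, f + trivialF 0 Δ 0 Δ' (C s * X ^ n) = scal y * g := by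
  unfold IsTransversal at h
  generalize h2 : (n * (n - 1) / 2 + n * Δ' : ℂ) = t2 at *
  generalize h3 : (n * (n - 1) * (n - 2) / 6 + n * (n - 1) / 2 * Δ' : ℂ) = t3 at *
  -- Cramer's rule for `(a_2, a_3) = y (g_2, g_3) + s (t_2, t_3)`.
  refine ⟨(lead g 2 * lead f 3 - lead g 3 * lead f 2) / (lead g 2 * t3 - lead g 3 * t2),
    (lead f 2 * t3 - lead f 3 * t2) / (lead g 2 * t3 - lead g 3 * t2),
    (hf.add (isReduced_trivialF hn _)).ext_lead (hg.scal_mul _) hn ?_ ?_⟩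
  · rw [lead_add, lead_trivialF_two, lead_scal_mul, h2]
    field_simp
    ring
  · rw [lead_add, lead_trivialF_three, lead_scal_mul, h3]
    field_simp
    ring

theorem eq_C_mul_X_pow_of_coeff_one {φ : ℂ[X]} (hn : Δ - Δ' = n)
    (h : (trivialF 0 Δ 0 Δ' φ).coeff 1 = 0) : φ = C (φ.eval 1) * X ^ n := by
  refine eq_C_mul_X_pow_of_coeff fun i hi => ?_
  have h1 := congrArg (fun P => P.coeff i) h
  rw [coeff_trivialF_succ, if_pos rfl, zero_add] at h1
  have h5 : (X * hasseDeriv 1 φ).coeff i = i * φ.coeff i := by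
    cases i with
    | zero => simp [mul_coeff_zero]
    | succ i => rw [coeff_X_mul, hasseDeriv_coeff]; simp
  simp only [coeff_sub, coeff_C_mul, h5, hasseDeriv_zero', coeff_zero] at h1
  have h2 : ((n : ℂ) - i) * φ.coeff i = 0 := by
    rw [← hn]; linear_combination h1
  refine (mul_eq_zero.mp h2).resolve_left fun h0 => hi ?_
  rw [sub_eq_zero] at h0
  exact_mod_cast h0.symm

/-- Absence of a `λ`-term forces `φ = s ∂ ^ n`, so a trivial multiple of `g` would lie on the line
from which `g` is transversal. -/
theorem IsTransversal.eq_zero (h : IsTransversal n Δ' g) (hg : IsReduced Δ Δ' g)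
    (hn : Δ - Δ' = n) {y : ℂ} {φ : ℂ[X]} (e : scal y * g = trivialF 0 Δ 0 Δ' φ) : y = 0 := by
  have h1 : (trivialF 0 Δ 0 Δ' φ).coeff 1 = 0 := by rw [← e, coeff_C_mul, hg.coeff_one, mul_zero]
  rw [eq_C_mul_X_pow_of_coeff_one hn h1] at e
  have e2 := congrArg (fun f => lead f 2) e
  have e3 := congrArg (fun f => lead f 3) e
  simp only [lead_scal_mul, lead_trivialF_two, lead_trivialF_three] at e2 e3
  refine (mul_eq_zero.mp ?_).resolve_right h
  linear_combination (n * (n - 1) * (n - 2) / 6 + n * (n - 1) / 2 * Δ' : ℂ) * e2 -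
    (n * (n - 1) / 2 + n * Δ' : ℂ) * e3

/-! ### The nontrivial reduced cocycles -/

theorem isReduced_lam_sq_mul {q : ℂ[X][X]} (h : IsVirasoroCocycle Δ Δ' (lam ^ 2 * q)) :
    IsReduced Δ Δ' (lam ^ 2 * q) :=
  ⟨h, by simp, by simp [coeff_X_pow_mul']⟩

theorem lead_lam_sq_mul_two (q : ℂ[X][X]) : lead (lam ^ 2 * q) 2 = lead q 0 := by
  simp [lead, coeff_X_pow_mul']

theorem lead_lam_sq_mul_three (q : ℂ[X][X]) : lead (lam ^ 2 * q) 3 = lead q 1 := by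
  simp [lead, coeff_X_pow_mul']

noncomputable def cocycleTwo : ℂ[X][X] := lam ^ 2 * (2 * dbar 0 + lam)

noncomputable def cocycleThree : ℂ[X][X] := lam ^ 2 * (dbar 0 * (dbar 0 + lam))

noncomputable def cocycleFour (Δ' : ℂ) : ℂ[X][X] :=
  lam ^ 2 * (4 * dbar 0 ^ 3 + 6 * dbar 0 ^ 2 * lam - dbar 0 * lam ^ 2 + scal Δ' * lam ^ 3)

noncomputable def cocycleFive : ℂ[X][X] :=
  lam ^ 2 * (dbar 0 ^ 4 - 10 * dbar 0 ^ 2 * lam ^ 2 - 17 * dbar 0 * lam ^ 3 - 8 * lam ^ 4)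

noncomputable def cocycleSix (Δ' : ℂ) : ℂ[X][X] :=
  lam ^ 2 * (dbar 0 ^ 4 * lam - scal (2 * Δ' + 3) * dbar 0 ^ 3 * lam ^ 2 -
    scal (3 * Δ') * dbar 0 ^ 2 * lam ^ 3 - scal (3 * Δ' + 1) * dbar 0 * lam ^ 4 -
    scal (Δ' + 9 / 28) * lam ^ 5)

theorem isReduced_cocycleTwo (h : Δ - Δ' = 2) : IsReduced Δ Δ' cocycleTwo := by
  obtain rfl : Δ = Δ' + 2 := by linear_combination h
  refine isReduced_lam_sq_mul fun x l m => ?_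
  simp [evalEval]
  ring

theorem isReduced_cocycleThree (h : Δ - Δ' = 3) : IsReduced Δ Δ' cocycleThree := by
  obtain rfl : Δ = Δ' + 3 := by linear_combination h
  refine isReduced_lam_sq_mul fun x l m => ?_
  simp [evalEval]
  ring

theorem isReduced_cocycleFour (h : Δ - Δ' = 4) : IsReduced Δ Δ' (cocycleFour Δ') := by
  obtain rfl : Δ = Δ' + 4 := by linear_combination h
  refine isReduced_lam_sq_mul fun x l m => ?_
  simp [evalEval]
  ring

theorem isReduced_cocycleFive : IsReduced 1 (-4) cocycleFive := by
  refine isReduced_lam_sq_mul fun x l m => ?_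
  simp [evalEval]
  ring

theorem isReduced_cocycleSix (h : Δ - Δ' = 6) (h' : (2 * Δ' + 5) ^ 2 = 19) :
    IsReduced Δ Δ' (cocycleSix Δ') := by
  obtain rfl : Δ = Δ' + 6 := by linear_combination h
  refine isReduced_lam_sq_mul fun x l m => ?_
  simp [evalEval]
  grind

/-- For `n = 2, 3, 4` the determinant is `-1`, `-2`, `-20`, with no dependence on `Δ'`. -/
theorem isTransversal_cocycleTwo : IsTransversal 2 Δ' cocycleTwo := by
  rw [IsTransversal, cocycleTwo, lead_lam_sq_mul_two, lead_lam_sq_mul_three]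
  simp [lead, coeff_X, coeff_C]
  intro h0
  have : (-1 : ℂ) = 0 := by linear_combination h0
  norm_num at this

theorem isTransversal_cocycleThree : IsTransversal 3 Δ' cocycleThree := by
  rw [IsTransversal, cocycleThree, lead_lam_sq_mul_two, lead_lam_sq_mul_three]
  simp [lead, mul_coeff_one, mul_coeff_zero, coeff_X, coeff_C]
  intro h0
  have : (-2 : ℂ) = 0 := by linear_combination h0
  norm_num at this

theorem isTransversal_cocycleFour : IsTransversal 4 Δ' (cocycleFour Δ') := by
  rw [IsTransversal, cocycleFour, lead_lam_sq_mul_two, lead_lam_sq_mul_three]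
  simp [lead, mul_coeff_one, mul_coeff_zero, pow_succ, coeff_X, coeff_C]
  intro h0
  have : (-20 : ℂ) = 0 := by linear_combination h0
  norm_num at this

theorem isTransversal_cocycleFive : IsTransversal 5 (-4) cocycleFive := by
  rw [IsTransversal, cocycleFive, lead_lam_sq_mul_two, lead_lam_sq_mul_three]
  simp [lead, mul_coeff_one, mul_coeff_zero, pow_succ, coeff_X, coeff_C]
  intro h0
  have : (-30 : ℂ) = 0 := by linear_combination h0
  norm_num at this

theorem isTransversal_cocycleSix (h' : (2 * Δ' + 5) ^ 2 = 19) :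
    IsTransversal 6 Δ' (cocycleSix Δ') := by
  rw [IsTransversal, cocycleSix, lead_lam_sq_mul_two, lead_lam_sq_mul_three]
  simp [lead, mul_coeff_one, mul_coeff_zero, pow_succ, coeff_X, coeff_C]
  intro h0
  -- The determinant is `-3(2Δ' + 5)`, and `2Δ' + 5` is a square root of `19`.
  have : (19 : ℂ) = 0 := by linear_combination -h' - (2 * Δ' + 5) / 3 * h0
  norm_num at this

end HeisenbergVirasoro

namespace HeisenbergVirasoro

variable {α β Δ α' β' Δ' : ℂ} {f k : ℂ[X][X]} {n : ℕ}

theorem IsCocycle.virasoro (h : IsCocycle 0 β Δ 0 β Δ' f k) : IsVirasoroCocycle Δ Δ' f := by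
  intro x l m
  linear_combination h.LL x l m

theorem IsCocycle.mixed (h : IsCocycle 0 β Δ 0 β Δ' f k) : IsMixedCocycle β Δ Δ' f k := by
  intro x l m
  linear_combination h.LN x l m

theorem IsCocycle.symmetric (h : IsCocycle 0 β Δ 0 β Δ' f k) (hβ : β ≠ 0) :
    IsSymmetricCocycle k := by
  intro x l m
  refine mul_left_cancel₀ hβ ?_
  linear_combination h.NN x l m

/-! ### The classification for `α = 0` -/

/-- The pair `(f, k)` is equivalent to `0` or to a listed pair. -/
def IsClassified (β Δ Δ' : ℂ) (f k : ℂ[X][X]) : Prop :=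
  ∃ φ : ℂ[X], (f + trivialF 0 Δ 0 Δ' φ = 0 ∧ k + trivialK β β φ = 0) ∨
    Listed 0 β Δ Δ' (f + trivialF 0 Δ 0 Δ' φ) (k + trivialK β β φ)

theorem trivialF_add (φ ψ : ℂ[X]) :
    trivialF α Δ α' Δ' (φ + ψ) = trivialF α Δ α' Δ' φ + trivialF α Δ α' Δ' ψ := by
  simp only [trivialF, map_add]; ring

theorem trivialK_add (φ ψ : ℂ[X]) :
    trivialK β β' (φ + ψ) = trivialK β β' φ + trivialK β β' ψ := by
  simp only [trivialK, map_add]; ring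

theorem trivialF_zero : trivialF α Δ α' Δ' 0 = 0 := by simp [trivialF]

theorem trivialK_zero : trivialK β β' 0 = 0 := by simp [trivialK]

@[simp]
theorem scal_zero : scal 0 = 0 := by simp

theorem trivialK_zero_zero (φ : ℂ[X]) : trivialK 0 0 φ = 0 := by simp [trivialK]

theorem IsClassified.of_add {φ : ℂ[X]}
    (h : IsClassified β Δ Δ' (f + trivialF 0 Δ 0 Δ' φ) (k + trivialK β β φ)) :
    IsClassified β Δ Δ' f k := by
  obtain ⟨ψ, h⟩ := h
  refine ⟨φ + ψ, ?_⟩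
  rwa [trivialF_add, trivialK_add, ← add_assoc, ← add_assoc]

theorem IsClassified.of_listed (h : (f = 0 ∧ k = 0) ∨ Listed 0 β Δ Δ' f k) :
    IsClassified β Δ Δ' f k := by
  refine ⟨0, ?_⟩
  rwa [trivialF_zero, trivialK_zero, add_zero, add_zero]

theorem exists_normalized (f : ℂ[X][X]) (Δ Δ' : ℂ) : ∃ φ : ℂ[X], ∀ i : ℕ,
    (Δ - Δ' - i) * ((f + trivialF 0 Δ 0 Δ' φ).coeff 1).coeff i = 0 := by
  -- The coefficient of `∂ ^ i λ` changes by `(Δ - Δ' - i) φ_i`. At `i = Δ - Δ'` the quotient is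
  -- zero by convention and nothing is required.
  let φ : ℂ[X] := ∑ i ∈ (f.coeff 1).support, monomial i (-((f.coeff 1).coeff i) / (Δ - Δ' - i))
  have hφ : ∀ i, φ.coeff i = -((f.coeff 1).coeff i) / (Δ - Δ' - i) := by
    intro i
    simp only [φ, finsetSum_coeff, coeff_monomial]
    rw [Finset.sum_ite_eq']
    split_ifs with h
    · rfl
    · rw [notMem_support_iff.mp h]; simp
  refine ⟨φ, fun i => ?_⟩
  have h5 : (X * hasseDeriv 1 φ).coeff i = i * φ.coeff i := by
    cases i with
    | zero => simp [mul_coeff_zero]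
    | succ i => rw [coeff_X_mul, hasseDeriv_coeff]; simp
  rw [coeff_add, coeff_trivialF_succ, if_pos rfl, zero_add]
  simp only [coeff_add, coeff_sub, coeff_C_mul, h5, hasseDeriv_zero', hφ]
  by_cases h : Δ - Δ' - i = 0
  · rw [h, zero_mul]
  · field_simp
    ring

/-- A cocycle all of whose homogeneous components have degree other than `Δ - Δ'` vanishes once
it is normalized. -/
theorem IsCocycle.eq_zero_of_not_nat (h : IsCocycle 0 β Δ 0 β Δ' f k)
    (h1 : ∀ i : ℕ, (Δ - Δ' - i) * (f.coeff 1).coeff i = 0) (hn : ∀ n : ℕ, Δ - Δ' ≠ n) :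
    f = 0 ∧ k = 0 := by
  constructor
  · ext1 p
    ext1 i
    cases p with
    | zero =>
      exact (mul_eq_zero.mp (h.virasoro.homogeneous_zero i)).resolve_left (sub_ne_zero.mpr (hn i))
    | succ p =>
      refine (mul_eq_zero.mp (h.virasoro.homogeneous h1 p i)).resolve_left fun h0 => hn (p + i) ?_
      push_cast
      linear_combination h0
  · ext1 p
    ext1 i
    refine (mul_eq_zero.mp (h.mixed.homogeneous h1 p i)).resolve_left fun h0 => hn (p + i) ?_
    push_cast
    linear_combination h0

/-! #### Degree zero -/

theorem IsCocycle.eq_of_degree_zero (h : IsCocycle 0 β Δ 0 β Δ' f k)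
    (h1 : ∀ i : ℕ, (Δ - Δ' - i) * (f.coeff 1).coeff i = 0) (hn : Δ - Δ' = (0 : ℕ)) :
    f = scal (lead f 0) + scal (lead f 1) * lam ∧ k = scal (lead k 0) := by
  constructor
  · ext1 j
    rcases j with _ | _ | j
    · conv_lhs => rw [h.virasoro.coeff_zero_eq hn]
      simp
    · conv_lhs => rw [h.virasoro.coeff_succ_eq hn h1 le_rfl]
      simp
    · rw [h.virasoro.coeff_succ_eq_zero hn h1 (Nat.succ_pos j)]
      simp
  · ext1 j
    rcases j with _ | j
    · conv_lhs => rw [h.mixed.coeff_eq hn h1 le_rfl]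
      simp
    · rw [h.mixed.coeff_eq_zero hn h1 (Nat.succ_pos j)]
      simp

theorem IsCocycle.isClassified_of_degree_zero (h : IsCocycle 0 β Δ 0 β Δ' f k)
    (h1 : ∀ i : ℕ, (Δ - Δ' - i) * (f.coeff 1).coeff i = 0) (hn : Δ - Δ' = (0 : ℕ)) :
    IsClassified β Δ Δ' f k := by
  obtain ⟨hf, hk⟩ := h.eq_of_degree_zero h1 hn
  obtain rfl : Δ = Δ' := by simpa [sub_eq_zero] using hn
  apply IsClassified.of_listed
  generalize lead f 0 = c₀ at *
  generalize lead f 1 = c₁ at *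
  generalize lead k 0 = a₀ at *
  by_cases h0 : (c₀, c₁, a₀) = (0, 0, 0)
  · simp only [Prod.mk.injEq] at h0
    obtain ⟨rfl, rfl, rfl⟩ := h0
    left
    simp [hf, hk]
  · right
    by_cases hβ : β = 0
    · exact Or.inl ⟨hβ, Or.inl ⟨rfl, c₀, c₁, a₀, h0, hf, hk⟩⟩
    · refine Or.inr ⟨hβ, Or.inl ⟨rfl, a₀, c₀, c₁, ?_, hk, hf⟩⟩
      simp only [ne_eq, Prod.mk.injEq] at h0 ⊢
      tauto

/-! #### The case `β = 0` -/

theorem IsMixedCocycle.sub_scal_mul {κ : ℂ[X][X]} (h : IsMixedCocycle 0 Δ Δ' f k)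
    (h' : IsMixedCocycle 0 Δ Δ' f κ) (c : ℂ) :
    IsMixedCocycle 0 Δ Δ' f (k - scal c * κ) := by
  intro x l m
  simp only [evalEval_sub, evalEval_mul, evalEval_C, eval_C]
  linear_combination h x l m - c * h' x l m

/-- For `β = 0` the mixed identity does not involve `f`, so subtracting a multiple of an explicit
solution leaves a `k` whose first two coefficients vanish. Degrees two and three follow the same
pattern. -/
theorem IsMixedCocycle.eq_of_degree_one (h : IsMixedCocycle 0 Δ Δ' f k) (hf : IsReduced Δ Δ' f)
    (hn : Δ - Δ' = (1 : ℕ)) (hΔ : Δ' ≠ 0) : k = scal (lead k 1) * lam := by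
  have hl : IsMixedCocycle 0 Δ Δ' f lam := by
    obtain rfl : Δ = Δ' + 1 := by push_cast at hn; linear_combination hn
    intro x l m
    simp [evalEval]
    ring
  refine sub_eq_zero.mp ((h.sub_scal_mul hl _).eq_zero_of_coeff ?_ ?_)
  · rw [coeff_sub, h.coeff_zero_eq_zero hn hf.normalized one_ne_zero hΔ]; simp
  · rw [coeff_sub, h.coeff_eq hn hf.normalized le_rfl]; simp

theorem IsMixedCocycle.eq_of_degree_two (h : IsMixedCocycle 0 Δ Δ' f k) (hf : IsReduced Δ Δ' f)
    (hn : Δ - Δ' = (2 : ℕ)) (hΔ : Δ' ≠ 0) :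
    k = scal (lead k 1) * (lam * (dbar 0 - scal Δ' * lam)) := by
  have hl : IsMixedCocycle 0 Δ Δ' f (lam * (dbar 0 - scal Δ' * lam)) := by
    obtain rfl : Δ = Δ' + 2 := by push_cast at hn; linear_combination hn
    intro x l m
    simp [evalEval]
    ring
  refine sub_eq_zero.mp ((h.sub_scal_mul hl _).eq_zero_of_coeff ?_ ?_)
  · rw [coeff_sub, h.coeff_zero_eq_zero hn hf.normalized two_ne_zero hΔ]; simp
  · rw [coeff_sub, h.coeff_eq hn hf.normalized one_le_two]
    simp [mul_coeff_zero]

theorem IsMixedCocycle.eq_of_degree_three (h : IsMixedCocycle 0 Δ Δ' f k) (hf : IsReduced Δ Δ' f)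
    (hn : Δ - Δ' = (3 : ℕ)) (hΔ : Δ' = -2) :
    k = scal (lead k 1) * (lam * (dbar 0 ^ 2 + 3 * dbar 0 * lam + 2 * lam ^ 2)) := by
  have hl : IsMixedCocycle 0 Δ Δ' f (lam * (dbar 0 ^ 2 + 3 * dbar 0 * lam + 2 * lam ^ 2)) := by
    obtain rfl : Δ = 1 := by push_cast at hn; linear_combination hn + hΔ
    subst hΔ
    intro x l m
    simp [evalEval]
    ring
  refine sub_eq_zero.mp ((h.sub_scal_mul hl _).eq_zero_of_coeff ?_ ?_)
  · rw [coeff_sub, h.coeff_zero_eq_zero hn hf.normalized three_ne_zero (by rw [hΔ]; norm_num)]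
    simp
  · rw [coeff_sub, h.coeff_eq hn hf.normalized (by norm_num)]
    simp [mul_coeff_zero, pow_succ]

theorem IsMixedCocycle.eq_zero_of_lead (h : IsMixedCocycle 0 Δ Δ' f k) (hf : IsReduced Δ Δ' f)
    (hn : Δ - Δ' = n) (hn0 : n ≠ 0) (hΔ : Δ' ≠ 0) (h0 : lead k 1 = 0) : k = 0 := by
  refine h.eq_zero_of_coeff (h.coeff_zero_eq_zero hn hf.normalized hn0 hΔ) ?_
  rw [h.coeff_eq hn hf.normalized (Nat.one_le_iff_ne_zero.mpr hn0), h0]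
  simp

theorem IsClassified.of_add_zero {φ : ℂ[X]}
    (h : IsClassified 0 Δ Δ' (f + trivialF 0 Δ 0 Δ' φ) k) : IsClassified 0 Δ Δ' f k := by
  refine IsClassified.of_add (φ := φ) ?_
  rwa [trivialK_zero_zero, add_zero]

theorem IsMixedCocycle.isClassified_of_reduced (h : IsMixedCocycle 0 Δ Δ' f k)
    (hf : IsReduced Δ Δ' f) (hn : Δ - Δ' = n) (hn0 : n ≠ 0) (hΔ : Δ' ≠ 0) :
    IsClassified 0 Δ Δ' f k := by
  obtain rfl | rfl | rfl | hn4 : n = 1 ∨ n = 2 ∨ n = 3 ∨ 4 ≤ n := by omega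
  · have hk := h.eq_of_degree_one hf hn hΔ
    generalize lead k 1 = a at hk
    have h3 : lead f 3 = 0 := by
      rw [lead, hf.cocycle.coeff_succ_eq_zero hn hf.normalized one_lt_two, eval_zero]
    -- For `n = 1` both `t_3` and `a_3` vanish and `t_2 = Δ' ≠ 0`, so `f` is always trivial.
    obtain ⟨s, hs⟩ := hf.exists_trivial hn (by simp [h3]) (Or.inl hΔ) hn0
    refine IsClassified.of_add_zero (φ := C s * X ^ 1) (IsClassified.of_listed ?_)
    by_cases ha : a = 0
    · left; exact ⟨hs, by rw [hk, ha]; simp⟩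
    · right; exact Or.inl ⟨rfl, Or.inr (Or.inl ⟨by simpa using hn, a, ha, hs, hk⟩)⟩
  · have hk := h.eq_of_degree_two hf hn hΔ
    generalize lead k 1 = a at hk
    obtain ⟨s, y, hs⟩ := hf.exists_eq_scal_mul (isReduced_cocycleTwo (by simpa using hn)) hn
      isTransversal_cocycleTwo
    refine IsClassified.of_add_zero (φ := C s * X ^ 2) (IsClassified.of_listed ?_)
    by_cases ha : (y, a) = (0, 0)
    · rw [Prod.mk.injEq] at ha
      left; simp [hs, hk, ha]
    · right
      exact Or.inl ⟨rfl, Or.inr (Or.inr (Or.inl ⟨by simpa using hn, y, a, ha, hs, hk⟩))⟩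
  · obtain ⟨s, y, hs⟩ := hf.exists_eq_scal_mul (isReduced_cocycleThree (by simpa using hn)) hn
      isTransversal_cocycleThree
    refine IsClassified.of_add_zero (φ := C s * X ^ 3) (IsClassified.of_listed ?_)
    have hs' : f + trivialF 0 Δ 0 Δ' (C s * X ^ 3) =
        scal y * (dbar 0 * lam ^ 2 * (dbar 0 + lam)) := by
      rw [hs, cocycleThree]; ring
    by_cases hΔ2 : Δ' = -2
    · have hk := h.eq_of_degree_three hf hn hΔ2
      generalize lead k 1 = a at hk
      by_cases ha : (y, a) = (0, 0)
      · rw [Prod.mk.injEq] at ha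
        left; simp [hs, hk, ha]
      · right
        have hΔ1 : Δ = 1 := by push_cast at hn; linear_combination hn + hΔ2
        exact Or.inl ⟨rfl, Or.inr (Or.inr (Or.inr (Or.inl ⟨hΔ1, hΔ2, y, a, ha, hs', hk⟩)))⟩
    · have hk : k = 0 := by
        refine h.eq_zero_of_lead hf hn hn0 hΔ
          ((h.elimination_of_three hn hf.normalized le_rfl).resolve_right fun hw => ?_)
        -- The condition reads `(2Δ' + 2) ^ 2 = 4`.
        have : Δ' * (Δ' + 2) = 0 := by push_cast at hw; linear_combination hw / 4
        rcases mul_eq_zero.mp this with h0 | h0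
        · exact hΔ h0
        · exact hΔ2 (by linear_combination h0)
      by_cases ha : y = 0
      · left; simp [hs, hk, ha]
      · right
        exact Or.inl ⟨rfl, Or.inr (Or.inr (Or.inr (Or.inr (Or.inl
          ⟨by simpa using hn, hΔ2, y, ha, hs', hk⟩))))⟩
  have hk : k = 0 := h.eq_zero_of_lead hf hn hn0 hΔ (h.elimination_of_four_le hn hf.normalized hn4)
  obtain rfl | rfl | rfl | hn7 : n = 4 ∨ n = 5 ∨ n = 6 ∨ 7 ≤ n := by omega
  · obtain ⟨s, y, hs⟩ := hf.exists_eq_scal_mul (isReduced_cocycleFour (by simpa using hn)) hn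
      isTransversal_cocycleFour
    refine IsClassified.of_add_zero (φ := C s * X ^ 4) (IsClassified.of_listed ?_)
    by_cases ha : y = 0
    · left; simp [hs, hk, ha]
    · right
      exact Or.inl ⟨rfl, Or.inr (Or.inr (Or.inr (Or.inr (Or.inr (Or.inl
        ⟨by simpa using hn, y, ha, hs, hk⟩)))))⟩
  · rcases elimination_of_five_le hf.cocycle hn hf.normalized le_rfl with hw | ht
    · have hΔ4 : Δ' = -4 := by
        -- The condition reads `(2Δ' + 4) ^ 2 = 16`.
        have : Δ' * (Δ' + 4) = 0 := by push_cast at hw; linear_combination hw / 4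
        linear_combination (mul_eq_zero.mp this).resolve_left hΔ
      obtain rfl : Δ = 1 := by push_cast at hn; linear_combination hn + hΔ4
      subst hΔ4
      obtain ⟨s, y, hs⟩ := hf.exists_eq_scal_mul isReduced_cocycleFive hn
        isTransversal_cocycleFive
      refine IsClassified.of_add_zero (φ := C s * X ^ 5) (IsClassified.of_listed ?_)
      by_cases ha : y = 0
      · left; simp [hs, hk, ha]
      · right
        refine Or.inl ⟨rfl, Or.inr (Or.inr (Or.inr (Or.inr (Or.inr (Or.inr (Or.inl
          ⟨rfl, rfl, y, ha, ?_, hk⟩))))))⟩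
        rw [hs, cocycleFive]; ring
    · obtain ⟨s, hs⟩ := hf.exists_trivial hn ht (Or.inl hΔ) hn0
      exact IsClassified.of_add_zero (φ := C s * X ^ 5) (IsClassified.of_listed (Or.inl ⟨hs, hk⟩))
  · rcases elimination_of_five_le hf.cocycle hn hf.normalized (by norm_num) with hw | ht
    · have hw' : (2 * Δ' + 5) ^ 2 = 19 := by push_cast at hw; linear_combination hw
      obtain ⟨s, y, hs⟩ := hf.exists_eq_scal_mul (isReduced_cocycleSix (by simpa using hn) hw') hn
        (isTransversal_cocycleSix hw')
      refine IsClassified.of_add_zero (φ := C s * X ^ 6) (IsClassified.of_listed ?_)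
      by_cases ha : y = 0
      · left; simp [hs, hk, ha]
      · right
        refine Or.inl ⟨rfl, Or.inr (Or.inr (Or.inr (Or.inr (Or.inr (Or.inr (Or.inr
          ⟨2 * Δ' + 5, hw', ?_, by ring, y, ha, ?_, hk⟩))))))⟩
        · push_cast at hn; linear_combination hn
        · rw [hs, cocycleSix]; ring
    · obtain ⟨s, hs⟩ := hf.exists_trivial hn ht (Or.inl hΔ) hn0
      exact IsClassified.of_add_zero (φ := C s * X ^ 6) (IsClassified.of_listed (Or.inl ⟨hs, hk⟩))
  · obtain ⟨s, hs⟩ := hf.exists_trivial hn (elimination_of_seven_le hf.cocycle hn hf.normalized hn7)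
      (Or.inl hΔ) hn0
    exact IsClassified.of_add_zero (φ := C s * X ^ n) (IsClassified.of_listed (Or.inl ⟨hs, hk⟩))

/-! #### The case `β ≠ 0` -/

/-- The NN identity at `μ = 0` makes `k(∂, 0)` constant, while homogeneity makes it a multiple of `∂
^ n`. -/
theorem IsCocycle.coeff_zero_eq_zero (h : IsCocycle 0 β Δ 0 β Δ' f k)
    (h1 : ∀ i : ℕ, (Δ - Δ' - i) * (f.coeff 1).coeff i = 0) (hβ : β ≠ 0) (hn : Δ - Δ' = n)
    (hn0 : n ≠ 0) : k.coeff 0 = 0 := by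
  have h0 := h.mixed.coeff_eq hn h1 (Nat.zero_le n)
  suffices lead k 0 = 0 by rw [h0, this]; simp
  obtain ⟨m, rfl⟩ := Nat.exists_eq_succ_of_ne_zero hn0
  have := congrArg (eval 1) ((h.symmetric hβ).coeff_succ_zero m)
  rw [h0, hasseDeriv_C_mul_X_pow] at this
  simpa using this

theorem IsCocycle.isClassified_of_degree_one (h : IsCocycle 0 β Δ 0 β Δ' f k)
    (h1 : ∀ i : ℕ, (Δ - Δ' - i) * (f.coeff 1).coeff i = 0) (hβ : β ≠ 0)
    (hn : Δ - Δ' = (1 : ℕ)) : IsClassified β Δ Δ' f k := by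
  have hf0 : f.coeff 0 = 0 := by
    have h0 := h.virasoro.coeff_zero_eq hn
    have := congrArg (eval 1) (h.mixed.coeff_zero_succ 0)
    rw [h0, hasseDeriv_C_mul_X_pow] at this
    have h2 : lead f 0 = 0 := by simpa [hβ] using this
    rw [h0, h2]; simp
  have hf1 : f.coeff 1 = 0 := by
    have h0 := h.virasoro.coeff_succ_eq hn h1 zero_le_one
    have := congrArg (eval 1) (h.mixed.coeff_succ_succ 0 0)
    simp only [if_true, eval_add, eval_sub, eval_mul, eval_C, eval_X, eval_neg,
      h.mixed.eval_one_hasseDeriv_coeff hn h1, eval_one_hasseDeriv_coeff_succ h.virasoro hn h1]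
      at this
    simp at this
    change Δ' * lead k 1 - Δ * lead k 1 - β * lead f 1 = -lead k 1 at this
    have h2 : β * lead f 1 = 0 := by
      push_cast at hn
      linear_combination -this - lead k 1 * hn
    rw [h0, (mul_eq_zero.mp h2).resolve_left hβ]; simp
  have hf : f = scal (lead f 2) * lam ^ 2 := by
    ext1 j
    rcases j with _ | _ | _ | j
    · rw [hf0]; simp
    · rw [hf1]; simp [coeff_X_pow]
    · conv_lhs => rw [h.virasoro.coeff_succ_eq hn h1 le_rfl]
      simp
    · rw [h.virasoro.coeff_succ_eq_zero hn h1 (by omega)]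
      simp
  have hk : k = scal (lead k 1) * lam := by
    ext1 j
    rcases j with _ | _ | j
    · rw [h.coeff_zero_eq_zero h1 hβ hn one_ne_zero]; simp
    · conv_lhs => rw [h.mixed.coeff_eq hn h1 le_rfl]
      simp
    · rw [h.mixed.coeff_eq_zero hn h1 (by omega)]
      simp
  generalize lead f 2 = c at hf
  generalize lead k 1 = b at hk
  by_cases hc : β * c = Δ' * b
  · refine ⟨C (b / β) * X, Or.inl ⟨?_, ?_⟩⟩
    · refine ext_evalEval fun x l => ?_
      obtain rfl : Δ = Δ' + 1 := by push_cast at hn; linear_combination hn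
      obtain rfl : c = Δ' * b / β := by rw [eq_div_iff hβ, mul_comm, hc]
      rw [evalEval_add, evalEval_trivialF, hf]
      simp [evalEval]
      ring
    · refine ext_evalEval fun x l => ?_
      rw [evalEval_add, evalEval_trivialK, hk]
      simp [evalEval]
      field_simp
      ring
  · exact IsClassified.of_listed (Or.inr (Or.inr ⟨hβ, Or.inr (Or.inl
      ⟨by simpa using hn, b, c, hc, hk, hf⟩)⟩))

/-- Once the `λ`-coefficient of `k` is zero, the NN identity kills all coefficients of `k` below `λ
^ n`. The coefficient of `λ ^ (p + 1) μ` in the LN identity then ties `f` to `k`, leaving only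
`b_n`, `a_n`, `a_(n+1)`. For `n = 2` these are the listed pairs; for `n ≥ 3` one more LN coefficient
gives `b_n = 0`, and then `a_2 = a_3 = 0`. -/
theorem IsCocycle.isClassified_of_two_le (h : IsCocycle 0 β Δ 0 β Δ' f k)
    (hf : IsReduced Δ Δ' f) (hβ : β ≠ 0) (hn : Δ - Δ' = n) (hn2 : 2 ≤ n) (hk1 : k.coeff 1 = 0) :
    IsClassified β Δ Δ' f k := by
  have h1 := hf.normalized
  have hk : ∀ j, j < n → k.coeff j = 0 := by
    intro j hj
    rcases j with _ | j
    · exact h.coeff_zero_eq_zero h1 hβ hn (by omega)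
    · have := congrArg (eval 1) ((h.symmetric hβ).coeff_succ_succ 0 j)
      rw [zero_add, hk1, map_zero, h.mixed.eval_one_hasseDeriv_coeff hn h1] at this
      have hne : (((n - (j + 1)).choose 1 : ℕ) : ℂ) ≠ 0 := by
        rw [Nat.choose_one_right]
        exact Nat.cast_ne_zero.mpr (by omega)
      rw [h.mixed.coeff_eq hn h1 hj.le, (mul_eq_zero.mp (this.trans eval_zero)).resolve_left hne]
      simp
  have hfk : ∀ p, p ≠ 0 → p ≤ n → β * ((n - p) * lead f (p + 1)) = lead k (p + 1) := by
    intro p hp hpn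
    have := congrArg (eval 1) (h.mixed.coeff_succ_succ p 0)
    simp only [hp, if_false, eval_add, eval_sub, eval_mul, eval_C, eval_X, eval_neg, zero_add,
      hk1, map_zero, eval_zero, eval_one_hasseDeriv_coeff_succ h.virasoro hn h1,
      Nat.choose_one_right, Nat.choose_zero_right, Nat.cast_sub hpn] at this
    simp at this
    exact this
  have hfj : ∀ p, p ≠ 0 → p + 1 < n → lead f (p + 1) = 0 := by
    intro p hp hpn
    have := hfk p hp (by omega)
    rw [show lead k (p + 1) = 0 by rw [lead, hk _ hpn, eval_zero]] at this
    have hne : (n - p : ℂ) ≠ 0 := by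
      rw [← Nat.cast_sub (by omega)]
      exact Nat.cast_ne_zero.mpr (by omega)
    simpa [hβ, hne] using this
  obtain rfl | hn3 : n = 2 ∨ 3 ≤ n := by omega
  · have hk' : k = scal (lead k 2) * lam ^ 2 := by
      ext1 j
      rcases j with _ | _ | _ | j
      · rw [hk 0 (by norm_num)]; simp
      · rw [hk1]; simp [coeff_X_pow]
      · conv_lhs => rw [h.mixed.coeff_eq hn h1 le_rfl]
        simp
      · rw [h.mixed.coeff_eq_zero hn h1 (by omega)]
        simp
    have hf2 : lead f 2 = lead k 2 / β := by
      have := hfk 1 one_ne_zero one_le_two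
      rw [eq_div_iff hβ]
      push_cast at this
      linear_combination this
    have hf' : f = scal (lead k 2 / β) * dbar 0 * lam ^ 2 + scal (lead f 3) * lam ^ 3 := by
      ext1 j
      rcases j with _ | _ | _ | _ | j
      · rw [hf.coeff_zero]; simp
      · rw [hf.coeff_one, coeff_add, coeff_mul_X_pow', coeff_mul_X_pow']; simp
      · conv_lhs => rw [h.virasoro.coeff_succ_eq hn h1 one_le_two]
        rw [hf2, coeff_add, coeff_mul_X_pow', coeff_mul_X_pow']
        simp [mul_coeff_zero]
      · conv_lhs => rw [h.virasoro.coeff_succ_eq hn h1 le_rfl]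
        rw [coeff_add, coeff_mul_X_pow', coeff_mul_X_pow']
        simp [coeff_C]
      · rw [h.virasoro.coeff_succ_eq_zero hn h1 (by omega)]
        rw [coeff_add, coeff_mul_X_pow', coeff_mul_X_pow']
        simp
    generalize lead k 2 = b at *
    generalize lead f 3 = c at *
    apply IsClassified.of_listed
    by_cases h0 : (b, c) = (0, 0)
    · rw [Prod.mk.injEq] at h0
      obtain ⟨rfl, rfl⟩ := h0
      left; rw [hf', hk']; simp
    · right
      exact Or.inr ⟨hβ, Or.inr (Or.inr ⟨by simpa using hn, b, c, h0, hk', hf'⟩)⟩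
  · obtain ⟨m, rfl⟩ := Nat.exists_eq_add_of_le' hn3
    have hkn : k.coeff (m + 3) = 0 := by
      -- The coefficient of `λ ^ (n - 1) μ ^ 2`, where `n = m + 3`: it involves only `b_2`,
      -- `a_(n-1)`, both zero, and `b_n`.
      have e := h.mixed.coeff_succ_succ (m + 1) 1
      have hfz : f.coeff (m + 1 + 1) = 0 :=
        hf.coeff_succ_eq_zero_of_lead hn (hfj (m + 1) (Nat.succ_ne_zero m) (by omega))
      rw [hk (1 + 1) (by omega), hfz] at e
      have e1 : m + 1 + 1 + 1 = m + 3 := rfl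
      simp only [map_zero, mul_zero, Nat.succ_ne_zero, if_false, sub_zero, add_zero, e1] at e
      refine (mul_eq_zero.mp e.symm).resolve_left ?_
      rw [neg_eq_zero, C_eq_zero, Nat.choose_one_right]
      exact Nat.cast_ne_zero.mpr (by omega)
    have hk0 : k = 0 := by
      ext1 j
      rcases lt_trichotomy j (m + 3) with hj | rfl | hj
      · exact hk j hj
      · exact hkn
      · exact h.mixed.coeff_eq_zero hn h1 hj
    have hf2 : lead f 2 = 0 := hfj 1 one_ne_zero (by omega)
    have hf3 : lead f 3 = 0 := by
      have := hfk 2 two_ne_zero (by omega)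
      rw [hk0] at this
      have hne : ((m + 3 : ℕ) - (2 : ℕ) : ℂ) ≠ 0 := by
        rw [← Nat.cast_sub (by omega)]
        exact Nat.cast_ne_zero.mpr (by omega)
      simp only [lead, Polynomial.coeff_zero, eval_zero, mul_eq_zero, hβ, hne, false_or] at this
      exact this
    have hf0 : f = 0 := hf.ext_lead IsReduced.zero hn (hf2.trans (by simp [lead])) (hf3.trans (by simp [lead]))
    exact IsClassified.of_listed (Or.inl ⟨hf0, hk0⟩)

theorem IsCocycle.isClassified (h : IsCocycle 0 β Δ 0 β Δ' f k) (hΔ : β = 0 → Δ' ≠ 0) :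
    IsClassified β Δ Δ' f k := by
  obtain ⟨φ, h1⟩ := exists_normalized f Δ Δ'
  refine IsClassified.of_add (φ := φ) ?_
  replace h := h.add_trivial φ
  generalize f + trivialF 0 Δ 0 Δ' φ = f at *
  generalize k + trivialK β β φ = k at *
  by_cases hn : ∃ n : ℕ, Δ - Δ' = n
  swap
  · push Not at hn
    exact IsClassified.of_listed (Or.inl (h.eq_zero_of_not_nat h1 hn))
  obtain ⟨n, hn⟩ := hn
  rcases eq_or_ne n 0 with rfl | hn0
  · exact h.isClassified_of_degree_zero h1 hn
  have hred : Δ' ≠ 0 ∨ 2 ≤ n → IsReduced Δ Δ' f := fun h' =>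
    ⟨h.virasoro, h.virasoro.coeff_zero_eq_zero hn hn0 h',
      h.virasoro.coeff_one_eq_zero hn h1 hn0 h'⟩
  rcases eq_or_ne β 0 with rfl | hβ
  · exact h.mixed.isClassified_of_reduced (hred (Or.inl (hΔ rfl))) hn hn0 (hΔ rfl)
  obtain rfl | hn2 : n = 1 ∨ 2 ≤ n := by omega
  · exact h.isClassified_of_degree_one h1 hβ hn
  have hf := hred (Or.inr hn2)
  have hnC : (n : ℂ) ≠ 0 := Nat.cast_ne_zero.mpr hn0
  -- The trivial pair of `s ∂ ^ n` adds `-β n s ∂ ^ (n - 1)` to the `λ`-coefficient of `k`, and it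
  -- keeps `f` reduced.
  let s := lead k 1 / (β * n)
  refine IsClassified.of_add (φ := C s * X ^ n) ?_
  refine (h.add_trivial (C s * X ^ n)).isClassified_of_two_le
    (hf.add (isReduced_trivialF hn s)) hβ hn hn2 ?_
  rw [coeff_add, coeff_trivialK, h.mixed.coeff_eq hn h1 (by omega), if_neg one_ne_zero,
    hasseDeriv_C_mul_X_pow, Nat.choose_one_right, zero_sub, ← mul_assoc, ← C_mul, ← neg_mul,
    ← C_neg, ← add_mul, ← C_add]
  have : lead k 1 + -(β * (n * s)) = 0 := by
    simp only [s]; field_simp; ring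
  rw [this]; simp

end HeisenbergVirasoro

namespace HeisenbergVirasoro

variable {α β Δ α' β' Δ' : ℂ} {f k : ℂ[X][X]}

/-! ### Listed pairs are not trivial -/

theorem Listed.ne_trivial_of_eq (h : Listed 0 β Δ Δ' f k) {φ : ℂ[X]}
    (hf : f = trivialF 0 Δ 0 Δ' φ) : k ≠ trivialK β β φ := by
  intro hk
  have hf' : ∀ x l : ℂ, f.evalEval x l =
      (x + Δ * l) * φ.eval x - (x + Δ' * l) * φ.eval (x + l) := by
    intro x l
    rw [hf, evalEval_trivialF]
    ring
  have hk' : ∀ x l : ℂ, k.evalEval x l = β * (φ.eval x - φ.eval (x + l)) := by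
    intro x l
    rw [hk, evalEval_trivialK]
    ring
  have zero : Δ = Δ' → ∀ a₀ c₀ c₁ : ℂ, f = scal c₀ + scal c₁ * lam → k = scal a₀ →
      c₀ = 0 ∧ c₁ = 0 ∧ a₀ = 0 := by
    rintro rfl a₀ c₀ c₁ e e'
    -- At both points the factors `x + Δ * l` vanish, so `f` does too, whatever `φ` is.
    have h0 := hf' 0 0
    have h1 := hf' (-Δ) 1
    have h2 := hk' 0 0
    rw [e] at h0 h1
    rw [e'] at h2
    simp [evalEval] at h0 h1 h2
    exact ⟨h0, by linear_combination h1 - h0, h2⟩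
  rcases h with ⟨rfl, h⟩ | ⟨hβ, h⟩
  · rw [trivialK_zero_zero] at hk
    have lin : ∀ (a : ℂ) (q : ℂ[X][X]), k = scal a * q → q.evalEval 1 1 ≠ 0 → a = 0 := by
      intro a q e hq
      have := congrArg (evalEval 1 1) (e.symm.trans hk)
      simpa [hq] using this
    rcases h with ⟨hn, c₀, c₁, a₀, h0, e, e'⟩ | ⟨hn, a, h0, e, e'⟩ | ⟨hn, c, a, h0, e, e'⟩ |
      ⟨hn, hn', c, a, h0, e, e'⟩ | ⟨hn, -, c, h0, e, e'⟩ | ⟨hn, c, h0, e, e'⟩ |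
      ⟨hn, hn', c, h0, e, e'⟩ | ⟨s, hs, hn, hn', c, h0, e, e'⟩
    · obtain ⟨rfl, rfl, rfl⟩ := zero hn a₀ c₀ c₁ e e'
      exact h0 rfl
    · exact h0 (lin a _ e' (by simp [evalEval]))
    · have hc : c = 0 := isTransversal_cocycleTwo.eq_zero
        (isReduced_cocycleTwo hn) (by simpa using hn) (e.symm.trans hf)
      subst hc
      -- Two points are needed: the values are `a(1 - Δ')` and `a(2 - Δ')`, one of which may vanish.
      have h1 := congrArg (evalEval 1 1) (e'.symm.trans hk)
      have h2 := congrArg (evalEval 2 1) (e'.symm.trans hk)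
      simp [evalEval] at h1 h2
      have ha : a = 0 := by grind
      exact h0 (by rw [ha])
    · have hc : c = 0 := by
        refine isTransversal_cocycleThree.eq_zero (Δ := Δ) (Δ' := Δ')
          (isReduced_cocycleThree (by rw [hn, hn']; norm_num)) (by rw [hn, hn']; norm_num)
          (y := c) (φ := φ) ?_
        rw [← hf, e, cocycleThree]; ring
      have ha : a = 0 := lin a _ e' (by simp [evalEval]; norm_num)
      exact h0 (by rw [ha, hc])
    · refine h0 (isTransversal_cocycleThree.eq_zero (isReduced_cocycleThree hn)
        (by simpa using hn) (φ := φ) ?_)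
      rw [← hf, e, cocycleThree]; ring
    · exact h0 (isTransversal_cocycleFour.eq_zero (isReduced_cocycleFour hn)
        (by simpa using hn) (e.symm.trans hf))
    · subst hn hn'
      refine h0 (isTransversal_cocycleFive.eq_zero isReduced_cocycleFive (by norm_num)
        (φ := φ) ?_)
      rw [← hf, e, cocycleFive]; ring
    · have hw : (2 * Δ' + 5) ^ 2 = 19 := by rw [hn']; linear_combination hs
      have hn6 : Δ - Δ' = 6 := by rw [hn, hn']; ring
      refine h0 ((isTransversal_cocycleSix hw).eq_zero (isReduced_cocycleSix hn6 hw)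
        (by simpa using hn6) (φ := φ) ?_)
      rw [← hf, e, cocycleSix]; ring
  · rcases h with ⟨hn, a₀, c₀, c₁, h0, e', e⟩ | ⟨hn, b, c, h0, e', e⟩ | ⟨hn, b, c, h0, e', e⟩
    · obtain ⟨rfl, rfl, rfl⟩ := zero hn a₀ c₀ c₁ e e'
      exact h0 rfl
    · have k1 := hk' 0 1
      have k2 := hk' 0 (-1)
      have f1 := hf' 0 1
      have f2 := hf' 0 (-1)
      rw [e'] at k1 k2
      rw [e] at f1 f2
      simp [evalEval] at k1 k2 f1 f2
      -- In `f(0, 1) + f(0, -1)` the value `φ(0)` cancels, leaving `Δ'(φ(-1) - φ(1))`, which the two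
      -- values of `k` express as `2Δ'b / β`.
      exact h0 (by linear_combination β / 2 * (f1 + f2) + Δ' / 2 * (k2 - k1))
    · have k1 := hk' 0 1
      have k2 := hk' 0 2
      have k3 := hk' 1 1
      have f1 := hf' 0 1
      have f2 := hf' 0 2
      rw [e'] at k1 k2 k3
      rw [e] at f1 f2
      simp [evalEval] at k1 k2 k3 f1 f2
      rw [one_add_one_eq_two] at k3
      -- A trivial `k` telescopes: `k(0, 2) = k(0, 1) + k(1, 1)`, that is `4b = 2b`. Then `φ` agrees
      -- at `0, 1, 2`, and `f(0, 2) - 2 f(0, 1) = 6c` vanishes.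
      have hb : b = 0 := by linear_combination (k2 - k1 - k3) / 2
      rw [hb, zero_eq_mul, or_iff_right hβ] at k1
      rw [hb, zero_mul, zero_eq_mul, or_iff_right hβ] at k2
      have hc : c = 0 := by
        linear_combination (f2 - 2 * f1 + 2 * Δ' * k2 - 2 * Δ' * k1) / 6
      exact h0 (by rw [hb, hc])

/-! ### Translation in `∂` -/

/-- The substitution of `∂ + γ` for `∂`. -/
noncomputable def translate (γ : ℂ) : ℂ[X][X] →+* ℂ[X][X] :=
  mapRingHom (compRingHom (X + C γ))

theorem evalEval_translate (γ x l : ℂ) (f : ℂ[X][X]) :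
    (translate γ f).evalEval x l = f.evalEval (x + γ) l := by
  induction f using Polynomial.induction_on' with
  | add p q hp hq => simp only [map_add, evalEval_add, hp, hq]
  | monomial n q => simp [translate, evalEval, eval_comp]

theorem translate_translate_neg (γ : ℂ) (f : ℂ[X][X]) : translate γ (translate (-γ) f) = f :=
  ext_evalEval fun x l => by simp [evalEval_translate]

theorem translate_scal (γ c : ℂ) : translate γ (scal c) = scal c := by simp [translate]

theorem translate_lam (γ : ℂ) : translate γ lam = lam := by simp [translate]

theorem translate_dbar (γ α : ℂ) : translate γ (dbar α) = dbar (α + γ) :=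
  ext_evalEval fun x l => by rw [evalEval_translate]; simp [evalEval]; ring

theorem translate_trivialF (γ : ℂ) (φ : ℂ[X]) : translate γ (trivialF α Δ α' Δ' φ) =
    trivialF (α + γ) Δ (α' + γ) Δ' (φ.comp (X + C γ)) := by
  refine ext_evalEval fun x l => ?_
  have e : x + γ + l = x + l + γ := by ring
  rw [evalEval_translate, evalEval_trivialF, evalEval_trivialF]
  simp only [eval_comp, eval_add, eval_X, eval_C, e]
  ring

theorem translate_trivialK (γ : ℂ) (φ : ℂ[X]) : translate γ (trivialK β β' φ) =
    trivialK β β' (φ.comp (X + C γ)) := by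
  refine ext_evalEval fun x l => ?_
  have e : x + γ + l = x + l + γ := by ring
  rw [evalEval_translate, evalEval_trivialK, evalEval_trivialK]
  simp only [eval_comp, eval_add, eval_X, eval_C, e]

theorem IsCocycle.translate (h : IsCocycle α β Δ α' β' Δ' f k) (γ : ℂ) :
    IsCocycle (α + γ) β Δ (α' + γ) β' Δ' (translate γ f) (translate γ k) where
  LL x l m := by
    have h1 := h.LL (x + γ) l m
    simp only [evalEval_translate, add_right_comm x _ γ]
    linear_combination h1
  LN x l m := by
    have h1 := h.LN (x + γ) l m
    simp only [evalEval_translate, add_right_comm x _ γ]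
    linear_combination h1
  NN x l m := by
    have h1 := h.NN (x + γ) l m
    simp only [evalEval_translate, add_right_comm x _ γ]
    linear_combination h1

/-- The list involves `α` only through `∂ + α`. -/
theorem Listed.translate (h : Listed α β Δ Δ' f k) (γ : ℂ) :
    Listed (α + γ) β Δ Δ' (translate γ f) (translate γ k) := by
  rcases h with ⟨hβ, h⟩ | ⟨hβ, h⟩
  · refine Or.inl ⟨hβ, ?_⟩
    rcases h with ⟨hn, c₀, c₁, a₀, h0, rfl, rfl⟩ | ⟨hn, a, h0, rfl, rfl⟩ |
      ⟨hn, c, a, h0, rfl, rfl⟩ | ⟨hn, hn', c, a, h0, rfl, rfl⟩ | ⟨hn, hn', c, h0, rfl, rfl⟩ |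
      ⟨hn, c, h0, rfl, rfl⟩ | ⟨hn, hn', c, h0, rfl, rfl⟩ | ⟨s, hs, hn, hn', c, h0, rfl, rfl⟩ <;>
    simp only [map_add, map_sub, map_mul, map_pow, map_zero, map_ofNat, translate_scal,
      translate_lam, ↓translate_dbar]
    · exact Or.inl ⟨hn, c₀, c₁, a₀, h0, rfl, rfl⟩
    · exact Or.inr (Or.inl ⟨hn, a, h0, rfl, rfl⟩)
    · exact Or.inr (Or.inr (Or.inl ⟨hn, c, a, h0, rfl, rfl⟩))
    · exact Or.inr (Or.inr (Or.inr (Or.inl ⟨hn, hn', c, a, h0, rfl, rfl⟩)))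
    · exact Or.inr (Or.inr (Or.inr (Or.inr (Or.inl ⟨hn, hn', c, h0, rfl, rfl⟩))))
    · exact Or.inr (Or.inr (Or.inr (Or.inr (Or.inr (Or.inl ⟨hn, c, h0, rfl, rfl⟩)))))
    · exact Or.inr (Or.inr (Or.inr (Or.inr (Or.inr (Or.inr (Or.inl
        ⟨hn, hn', c, h0, rfl, rfl⟩))))))
    · exact Or.inr (Or.inr (Or.inr (Or.inr (Or.inr (Or.inr (Or.inr
        ⟨s, hs, hn, hn', c, h0, rfl, rfl⟩))))))
  · refine Or.inr ⟨hβ, ?_⟩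
    rcases h with ⟨hn, a₀, c₀, c₁, h0, rfl, rfl⟩ | ⟨hn, b, c, h0, rfl, rfl⟩ |
      ⟨hn, b, c, h0, rfl, rfl⟩ <;>
    simp only [map_add, map_mul, map_pow, translate_scal, translate_lam, ↓translate_dbar]
    · exact Or.inl ⟨hn, a₀, c₀, c₁, h0, rfl, rfl⟩
    · exact Or.inr (Or.inl ⟨hn, b, c, h0, rfl, rfl⟩)
    · exact Or.inr (Or.inr ⟨hn, b, c, h0, rfl, rfl⟩)

theorem Listed.not_trivial (h : Listed α β Δ Δ' f k) :
    ¬ ∃ φ : ℂ[X], f = trivialF α Δ α Δ' φ ∧ k = trivialK β β φ := by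
  rintro ⟨φ, rfl, rfl⟩
  have h' := h.translate (-α)
  rw [add_neg_cancel] at h'
  refine h'.ne_trivial_of_eq (φ := φ.comp (X + C (-α))) ?_ (translate_trivialK _ _)
  rw [translate_trivialF, add_neg_cancel]

/-! ### The classification -/

/-- Put `μ = 0` in the LL identity and `λ = 0` in the LN identity: `(α - α')f` and `(α - α')k`
become the trivial pair of `f(∂, 0)`. -/
theorem IsCocycle.isTrivial_of_ne (h : IsCocycle α β Δ α' β' Δ' f k) (hα : α ≠ α') :
    ∃ φ : ℂ[X], f = trivialF α Δ α' Δ' φ ∧ k = trivialK β β' φ := by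
  have hne : α - α' ≠ 0 := sub_ne_zero.mpr hα
  have he : ∀ x : ℂ, f.evalEval x 0 = (f.coeff 0).eval x := by
    intro x; rw [evalEval, map_zero, coeff_zero_eq_eval_zero]
  refine ⟨C (1 / (α - α')) * f.coeff 0, ext_evalEval fun x l => ?_, ext_evalEval fun x l => ?_⟩
  · have h1 := h.LL x l 0
    rw [evalEval_trivialF]
    simp only [add_zero, he, eval_mul, eval_C] at h1 ⊢
    field_simp
    linear_combination h1
  · have h1 := h.LN x 0 l
    rw [evalEval_trivialK]
    simp only [add_zero, zero_add, he, eval_mul, eval_C] at h1 ⊢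
    field_simp
    linear_combination -h1

/-- The same with `k(∂, 0)`, putting `μ = 0` in the LN and NN identities; the former uses that both
modules have the same `α`. -/
theorem IsCocycle.isTrivial_of_ne_right (h : IsCocycle α β Δ α β' Δ' f k) (hβ : β ≠ β') :
    ∃ φ : ℂ[X], f = trivialF α Δ α Δ' φ ∧ k = trivialK β β' φ := by
  have hne : β - β' ≠ 0 := sub_ne_zero.mpr hβ
  have he : ∀ x : ℂ, k.evalEval x 0 = (k.coeff 0).eval x := by
    intro x; rw [evalEval, map_zero, coeff_zero_eq_eval_zero]
  refine ⟨C (1 / (β - β')) * k.coeff 0, ext_evalEval fun x l => ?_, ext_evalEval fun x l => ?_⟩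
  · have h1 := h.LN x l 0
    rw [evalEval_trivialF]
    simp only [add_zero, he, eval_mul, eval_C] at h1 ⊢
    field_simp
    linear_combination h1
  · have h1 := h.NN x l 0
    rw [evalEval_trivialK]
    simp only [add_zero, he, eval_mul, eval_C] at h1 ⊢
    field_simp
    linear_combination h1

theorem IsCocycle.exists_listed (h : IsCocycle α β Δ α β Δ' f k) (hΔ : β = 0 → Δ' ≠ 0) :
    ∃ φ : ℂ[X], (f + trivialF α Δ α Δ' φ = 0 ∧ k + trivialK β β φ = 0) ∨
      Listed α β Δ Δ' (f + trivialF α Δ α Δ' φ) (k + trivialK β β φ) := by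
  have h0 := h.translate (-α)
  rw [add_neg_cancel] at h0
  obtain ⟨φ, hφ⟩ := h0.isClassified hΔ
  have ef : HeisenbergVirasoro.translate α (HeisenbergVirasoro.translate (-α) f +
      trivialF 0 Δ 0 Δ' φ) = f + trivialF α Δ α Δ' (φ.comp (X + C α)) := by
    rw [map_add, translate_translate_neg, translate_trivialF, zero_add]
  have ek : HeisenbergVirasoro.translate α (HeisenbergVirasoro.translate (-α) k +
      trivialK β β φ) = k + trivialK β β (φ.comp (X + C α)) := by
    rw [map_add, translate_translate_neg, translate_trivialK]
  refine ⟨φ.comp (X + C α), ?_⟩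
  rw [← ef, ← ek]
  rcases hφ with ⟨h1, h2⟩ | hφ
  · rw [h1, h2]
    exact Or.inl ⟨map_zero _, map_zero _⟩
  · have := hφ.translate α
    rw [zero_add] at this
    exact Or.inr this

/-- A cocycle that is not trivial has `α = α'` and `β = β'` and is equivalent to a listed pair. -/
theorem IsCocycle.listed_of_not_trivial (h : IsCocycle α β Δ α' β' Δ' f k)
    (hΔ : β' = 0 → Δ' ≠ 0)
    (hn : ¬ ∃ φ : ℂ[X], f = trivialF α Δ α' Δ' φ ∧ k = trivialK β β' φ) :
    α = α' ∧ β = β' ∧ ∃ φ : ℂ[X],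
      Listed α β Δ Δ' (f + trivialF α Δ α' Δ' φ) (k + trivialK β β' φ) := by
  obtain rfl : α = α' := by
    by_contra hα
    exact hn (h.isTrivial_of_ne hα)
  obtain rfl : β = β' := by
    by_contra hβ
    exact hn (h.isTrivial_of_ne_right hβ)
  obtain ⟨φ, ⟨h1, h2⟩ | hφ⟩ := h.exists_listed hΔ
  · refine absurd ⟨-φ, ?_, ?_⟩ hn
    · rw [trivialF_neg]; exact eq_neg_of_add_eq_zero_left h1
    · rw [trivialK_neg]; exact eq_neg_of_add_eq_zero_left h2
  · exact ⟨rfl, rfl, φ, hφ⟩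

end HeisenbergVirasoro

/-! ### The theorem, read off from the classification of cocycles. -/

theorem mainTheorem10 (α β Δ α' β' Δ' : ℂ) (h : (Δ, β) ≠ (0, 0)) (h' : (Δ', β') ≠ (0, 0)) :
    -- every extension is described by some pair of polynomials
    (∀ E : ConformalModule.Extension.{u} (HeisenbergVirasoro.modV α' β' Δ')
        (HeisenbergVirasoro.modV α β Δ),
      ∃ f k : ℂ[X][X], HeisenbergVirasoro.IsGivenBy E f k) ∧
    -- nontrivial extensions exist only if `α = α'`, `β = β'`, and are then given by the list
    (∀ E : ConformalModule.Extension.{u} (HeisenbergVirasoro.modV α' β' Δ')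
        (HeisenbergVirasoro.modV α β Δ),
      ¬ E.IsTrivial →
        α = α' ∧ β = β' ∧ ∃ f k : ℂ[X][X], HeisenbergVirasoro.Listed α β Δ Δ' f k ∧
          ∃ E' : ConformalModule.Extension.{0} (HeisenbergVirasoro.modV α' β' Δ')
            (HeisenbergVirasoro.modV α β Δ),
            E.Equivalent E' ∧ HeisenbergVirasoro.IsGivenBy E' f k) ∧
    -- every listed pair gives an extension, and this extension is nontrivial
    (α = α' → β = β' → ∀ f k : ℂ[X][X], HeisenbergVirasoro.Listed α β Δ Δ' f k →
      (∃ E : ConformalModule.Extension.{0} (HeisenbergVirasoro.modV α' β' Δ')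
        (HeisenbergVirasoro.modV α β Δ), HeisenbergVirasoro.IsGivenBy E f k) ∧
      ∀ E : ConformalModule.Extension.{u} (HeisenbergVirasoro.modV α' β' Δ')
        (HeisenbergVirasoro.modV α β Δ), HeisenbergVirasoro.IsGivenBy E f k → ¬ E.IsTrivial) ∧
    -- the pairs that describe trivial extensions
    (∀ (E : ConformalModule.Extension.{u} (HeisenbergVirasoro.modV α' β' Δ')
        (HeisenbergVirasoro.modV α β Δ)) (f k : ℂ[X][X]), HeisenbergVirasoro.IsGivenBy E f k →
      (E.IsTrivial ↔ ∃ φ : ℂ[X], f = HeisenbergVirasoro.trivialF α Δ α' Δ' φ ∧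
        k = HeisenbergVirasoro.trivialK β β' φ)) ∧
    (∀ φ : ℂ[X], ∃ E : ConformalModule.Extension.{0} (HeisenbergVirasoro.modV α' β' Δ')
        (HeisenbergVirasoro.modV α β Δ), E.IsTrivial ∧
      HeisenbergVirasoro.IsGivenBy E (HeisenbergVirasoro.trivialF α Δ α' Δ' φ)
        (HeisenbergVirasoro.trivialK β β' φ)) := by
  have hΔ : β' = 0 → Δ' ≠ 0 := by
    rintro rfl rfl
    exact h' rfl
  refine ⟨HeisenbergVirasoro.exists_isGivenBy, fun E hE => ?_, ?_,
    fun E f k hE => hE.isTrivial_iff,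
    fun φ => ⟨_, HeisenbergVirasoro.split_isTrivial, HeisenbergVirasoro.split_isGivenBy φ⟩⟩
  · obtain ⟨f, k, hfk⟩ := HeisenbergVirasoro.exists_isGivenBy E
    rw [hfk.isTrivial_iff] at hE
    obtain ⟨hα, hβ, φ, hφ⟩ := hfk.isCocycle.listed_of_not_trivial hΔ hE
    have hc := hfk.isCocycle.add_trivial φ
    exact ⟨hα, hβ, _, _, hφ, HeisenbergVirasoro.ext hc,
      ((hfk.add_trivial φ).ext_equivalent hc).symm, HeisenbergVirasoro.ext_isGivenBy hc⟩
  · rintro rfl rfl f k hfk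
    refine ⟨⟨_, HeisenbergVirasoro.ext_isGivenBy hfk.isCocycle⟩, fun E hE => ?_⟩
    rw [hE.isTrivial_iff]
    exact hfk.not_trivial
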